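/- Let $n\ge 1$, write points of $\mathbb R^{n+1}$ as $Z=(z,t)$ with $z\in\mathbb R^n$, $t\in\mathbb R$, and put $\langle Z\rangle=(1+|z|^2+t^2)^{1/2}$, $D_{z_j}=-i\partial_{z_j}$, $D_t=-i\partial_t$. For $c\in\mathbb R$ consider, besides the identity, the generators $$D_{z_j},\qquad D_t,\qquad z_iD_{z_j}-z_jD_{z_i},\qquad tD_{z_j}-\tfrac{c z_j}{2},\qquad 2tD_t+z\cdot D_z \qquad (1\le i,j\le n),$$ acting on tempered distributions and listed in a fixed order as $A_1,\dots,A_N$. Their orders (parabolic regularity order, spacetime order) are $(1,0)$, $(2,0)$, $(1,1)$, $(1,1)$, $(2,1)$ respectively, and orders add up under composition. For $k\in\mathbb N$ let $\mathcal A_k$ be the set of multi-indices $\alpha\in\mathbb N^N$ with $|\alpha|\le k$ such that $A^\alpha=A_1^{\alpha_1}\cdots A_N^{\alpha_N}$ has order at most $(k,k)$. For $r\in\mathbb R$ let $$H^{0,r;k}_{\mathcal D_c}=\Big\{u\in\mathcal S'(\mathbb R^{n+1}) : \langle Z\rangle^{r}A^\alpha u\in L^2(\mathbb R^{n+1})\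 \text{ for all } \alpha\in\mathcal A_k\Big\},\qquad \|u\|_{H^{0,r;k}_{\mathcal D_c}}^2=\sum_{\alpha\in\mathcal A_k}\big\|\langle Z\rangle^{r}A^\alpha u\big\|_{L^2}^2 .$$ (Taking $\alpha=0$, every element is a function in $\langle Z\rangle^{-r}L^2$.) **Proposition.** Let $r,r_1,r_2\in\mathbb R$, $c,c_1,c_2\in\mathbb R\setminus\{0\}$ and $k\in\mathbb N$ with $k>\max(n/2+2,3)$. 1. If $u_1\in H^{0,r_1;k}_{\mathcal D_{c_1}}$ and $u_2\in H^{0,r_2;k}_{\mathcal D_{c_2}}$, then the pointwise product $u_1u_2$ is a tempered distribution and lies in $H^{0,\,r_1+r_2+(n+1)/2;\,k}_{\mathcal D_{c_1+c_2}}$. Moreover multiplication is a continuous bilinear map between these spaces: there is a constant $C$, independent of $u_1,u_2$, with $$\|u_1u_2\|_{H^{0,r_1+r_2+(n+1)/2;k}_{\mathcal D_{c_1+c_2}}}\le C\,\|u_1\|_{H^{0,r_1;k}_{\mathcal D_{c_1}}}\,\|u_2\|_{H^{0,r_2;k}_{\mathcal D_{c_2}}}.$$ 2. For every tempered distribution $u$,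 one has $u\in H^{0,r;k}_{\mathcal D_c}$ if and only if its complex conjugate $\bar u\in H^{0,r;k}_{\mathcal D_{-c}}$. -/

import Mathlib

open MeasureTheory SchwartzMap
open scoped ENNReal NNReal ComplexConjugate

noncomputable section

namespace ModuleRegularity

/-- Spacetime `ℝⁿ × ℝ`, with Euclidean norm and Lebesgue measure. A point is `Z = (z, t)`: the first
`n` coordinates are the space variables `z₁, …, zₙ`, the last one is the time variable `t`. -/
abbrev Spacetime (n : ℕ) : Type := EuclideanSpace ℝ (Fin (n + 1))

/-- The space coordinate `z_j`, as a function on spacetime. -/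
def zCoord {n : ℕ} (j : Fin n) (Z : Spacetime n) : ℂ := ((Z j.castSucc : ℝ) : ℂ)

/-- The time coordinate `t`, as a function on spacetime. -/
def tCoord {n : ℕ} (Z : Spacetime n) : ℂ := ((Z (Fin.last n) : ℝ) : ℂ)

/-- The weight `⟨Z⟩ ^ r = (1 + |z|² + t²) ^ (r / 2)`. -/
def weight (n : ℕ) (r : ℝ) (Z : Spacetime n) : ℂ := (((1 + ‖Z‖ ^ 2) ^ (r / 2) : ℝ) : ℂ)

/-- Multiplication of tempered distributions by `z_j`. -/
def mulZ {n : ℕ} (j : Fin n) : 𝓢'(Spacetime n, ℂ) →L[ℂ] 𝓢'(Spacetime n, ℂ) :=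
  TemperedDistribution.smulLeftCLM ℂ (zCoord j)

/-- Multiplication of tempered distributions by `t`. -/
def mulT (n : ℕ) : 𝓢'(Spacetime n, ℂ) →L[ℂ] 𝓢'(Spacetime n, ℂ) :=
  TemperedDistribution.smulLeftCLM ℂ tCoord

/-- Multiplication of tempered distributions by `⟨Z⟩ ^ r`. -/
def mulWeight (n : ℕ) (r : ℝ) : 𝓢'(Spacetime n, ℂ) →L[ℂ] 𝓢'(Spacetime n, ℂ) :=
  TemperedDistribution.smulLeftCLM ℂ (weight n r)

/-! The multipliers above have temperate growth, so `smulLeftCLM` is the actual multiplication. -/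

theorem zCoord_hasTemperateGrowth {n : ℕ} (j : Fin n) :
    (zCoord (n := n) j).HasTemperateGrowth :=
  (Complex.ofRealCLM.comp
    (EuclideanSpace.proj j.castSucc : Spacetime n →L[ℝ] ℝ)).hasTemperateGrowth

theorem tCoord_hasTemperateGrowth (n : ℕ) : (tCoord (n := n)).HasTemperateGrowth :=
  (Complex.ofRealCLM.comp
    (EuclideanSpace.proj (Fin.last n) : Spacetime n →L[ℝ] ℝ)).hasTemperateGrowth

theorem weight_hasTemperateGrowth (n : ℕ) (r : ℝ) : (weight n r).HasTemperateGrowth := by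
  unfold weight
  fun_prop

/-- `D_{z_j} = -i ∂_{z_j}` on tempered distributions. -/
def DZ {n : ℕ} (j : Fin n) : 𝓢'(Spacetime n, ℂ) →L[ℂ] 𝓢'(Spacetime n, ℂ) :=
  (-Complex.I) • LineDeriv.lineDerivOpCLM ℂ 𝓢'(Spacetime n, ℂ)
    (EuclideanSpace.single j.castSucc (1 : ℝ))

/-- `D_t = -i ∂_t` on tempered distributions. -/
def DT (n : ℕ) : 𝓢'(Spacetime n, ℂ) →L[ℂ] 𝓢'(Spacetime n, ℂ) :=
  (-Complex.I) • LineDeriv.lineDerivOpCLM ℂ 𝓢'(Spacetime n, ℂ)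
    (EuclideanSpace.single (Fin.last n) (1 : ℝ))

/-- Labels for the generators other than the identity. -/
inductive Gen (n : ℕ) : Type
  | dz (j : Fin n)
  | dt
  | rot (i j : Fin n)
  | gal (j : Fin n)
  | dil
  deriving DecidableEq, Fintype

/-- The generators `D_{z_j}`, `D_t`, `z_i D_{z_j} - z_j D_{z_i}`, `t D_{z_j} - c z_j / 2` and
`2 t D_t + z · D_z`. -/
def Gen.op {n : ℕ} (c : ℝ) : Gen n → (𝓢'(Spacetime n, ℂ) →L[ℂ] 𝓢'(Spacetime n, ℂ))
  | .dz j => DZ j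
  | .dt => DT n
  | .rot i j => (mulZ i).comp (DZ j) - (mulZ j).comp (DZ i)
  | .gal j => (mulT n).comp (DZ j) - ((c : ℂ) / 2) • mulZ j
  | .dil => (2 : ℂ) • (mulT n).comp (DT n) + ∑ j : Fin n, (mulZ j).comp (DZ j)

/-- The parabolic regularity order of a generator (`D_{z_j}` counts `1`, `D_t` counts `2`). -/
def Gen.regOrder {n : ℕ} : Gen n → ℕ
  | .dz _ => 1
  | .dt => 2
  | .rot _ _ => 1
  | .gal _ => 1
  | .dil => 2

/-- The spacetime order of a generator, i.e. the growth order of its coefficients. -/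
def Gen.spaceOrder {n : ℕ} : Gen n → ℕ
  | .dz _ => 0
  | .dt => 0
  | .rot _ _ => 1
  | .gal _ => 1
  | .dil => 1

/-- The generators in a fixed order. -/
def genList (n : ℕ) : List (Gen n) :=
  (List.finRange n).map Gen.dz ++ [Gen.dt] ++
    (List.finRange n ×ˢ List.finRange n).map (fun p => Gen.rot p.1 p.2) ++
    (List.finRange n).map Gen.gal ++ [Gen.dil]

/-- The ordered monomial `A^α = A₁^{α₁} ⋯ A_N^{α_N}` in the generators with parameter `c`. -/
def genMonomial {n : ℕ} (c : ℝ) (α : Gen n → ℕ) :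
    𝓢'(Spacetime n, ℂ) →L[ℂ] 𝓢'(Spacetime n, ℂ) :=
  ((genList n).map fun g => g.op c ^ α g).prod

/-- The multi-indices `α` with `|α| ≤ k` for which `A^α` has order at most `(k, k)`: orders are
additive under composition, as principal symbols are multiplicative. The bound `α g ≤ k` in
`piFinset` is implied by `|α| ≤ k`. -/
def multiIndices (n k : ℕ) : Finset (Gen n → ℕ) :=
  (Fintype.piFinset fun _ : Gen n => Finset.range (k + 1)).filter fun α =>
    ∑ g, α g ≤ k ∧ ∑ g, α g * g.regOrder ≤ k ∧ ∑ g, α g * g.spaceOrder ≤ k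

/-- The norm `‖⟨Z⟩ ^ r u‖_{L²}` of the weighted space `⟨Z⟩ ^ (-r) L²(ℝⁿ⁺¹)`; it is `∞` when
`⟨Z⟩ ^ r u` is not in `L²` (otherwise there is exactly one `g`). -/
def weightedNorm {n : ℕ} (r : ℝ) (u : 𝓢'(Spacetime n, ℂ)) : ℝ≥0∞ :=
  ⨅ (g : Lp ℂ 2 (volume : Measure (Spacetime n))) (_ : mulWeight n r u = (g : 𝓢'(Spacetime n, ℂ))),
    ‖g‖ₑ

/-- `u ∈ ⟨Z⟩ ^ (-r) L²(ℝⁿ⁺¹)`, the parabolic Sobolev space of order `(0, r)`. -/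
def MemWeightedL2 {n : ℕ} (r : ℝ) (u : 𝓢'(Spacetime n, ℂ)) : Prop :=
  ∃ g : Lp ℂ 2 (volume : Measure (Spacetime n)), mulWeight n r u = (g : 𝓢'(Spacetime n, ℂ))

/-- The module regularity space `H^{0, r; k}` of the module with parameter `c`: all
`A^α u` of order at most `(k, k)`, in particular `u` itself (`α = 0`), lie in `⟨Z⟩ ^ (-r) L²`. -/
def modRegSpace (n : ℕ) (c r : ℝ) (k : ℕ) : Set 𝓢'(Spacetime n, ℂ) :=
  {u | ∀ α ∈ multiIndices n k, MemWeightedL2 r (genMonomial c α u)}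

/-- The norm of `H^{0, r; k}`: the square root of `∑_α ‖A^α u‖²`, with weighted `L²` norms. -/
def modRegNorm {n : ℕ} (c r : ℝ) (k : ℕ) (u : 𝓢'(Spacetime n, ℂ)) : ℝ≥0∞ :=
  (∑ α ∈ multiIndices n k, weightedNorm r (genMonomial c α u) ^ 2) ^ (1 / 2 : ℝ)

/-- The tempered distribution `u` is the function `f`. -/
def IsFunction {n : ℕ} (u : 𝓢'(Spacetime n, ℂ)) (f : Spacetime n → ℂ) : Prop :=
  ∀ φ : 𝓢(Spacetime n, ℂ), Integrable (fun Z => φ Z * f Z) ∧ u φ = ∫ Z, φ Z * f Z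

/-- `u` and `v` are functions, and the tempered distribution `w` is their pointwise product. -/
def IsProduct {n : ℕ} (u v w : 𝓢'(Spacetime n, ℂ)) : Prop :=
  ∃ f g : Spacetime n → ℂ, IsFunction u f ∧ IsFunction v g ∧ IsFunction w fun Z => f Z * g Z

/-- The complex conjugate of a Schwartz function. -/
def conjSchwartz {n : ℕ} : 𝓢(Spacetime n, ℂ) →L[ℝ] 𝓢(Spacetime n, ℂ) :=
  SchwartzMap.postcompCLM (Complex.conjCLE : ℂ →L[ℝ] ℂ)

theorem conjSchwartz_smul {n : ℕ} (a : ℂ) (φ : 𝓢(Spacetime n, ℂ)) :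
    conjSchwartz (a • φ) = conj a • conjSchwartz φ := by
  ext Z
  simp [conjSchwartz]

/-- The complex conjugate `ū` of a tempered distribution: `ū(φ)` is the conjugate of `u(φ̄)`. -/
def conjDistribution {n : ℕ} (u : 𝓢'(Spacetime n, ℂ)) : 𝓢'(Spacetime n, ℂ) :=
  ContinuousLinearMap.toPointwiseConvergenceCLM ℂ (RingHom.id ℂ) 𝓢(Spacetime n, ℂ) ℂ
    { toFun := fun φ => conj (u (conjSchwartz φ))
      map_add' := fun φ ψ => by simp
      map_smul' := fun a φ => by simp [conjSchwartz_smul]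
      cont := Complex.continuous_conj.comp (u.continuous.comp conjSchwartz.continuous) }

end ModuleRegularity

end

/-!
The product estimate is proved for test functions and extended by density; conjugation is a direct
computation, since `A ū = -conj (A u)` when the parameter of the generator `A` changes sign.

**Reduction to graph norms.** In the multi-index set only the regularity order matters
(`mem_multiIndices`), and commutators of generators lose one unit of it (`weylGen_comm_mem`). Hence,
as in the Poincaré–Birkhoff–Witt theorem, all words of order at most `k` are combinations of ordered
monomials of order at most `k` (`word_mem_span_genMonomial`), and the norm of `H^{0,r;k}` is
equivalent to the graph norm `distW` of words. Leibniz' rule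
`A (f g) = (A f) g + f (A g)`, with parameters `c₁ + c₂`, `c₁`, `c₂` (`testOp_mul`), then reduces the
claim to the estimate `testNorm_mul_le` of `⟨Z⟩^{r₁ + r₂ + (n + 1) / 2} f g` in `L²` by `a` orders
on `f` and `b` orders on `g`, where `a + b = k`.

**The lens transform.** The substitution `(z, t) = (cosh s · y, sinh s)` gives
`⟨Z⟩ = cosh s · ⟨y⟩` with Jacobian `cosh^{n + 1} s`. After multiplication by
`cosh^q s · exp (-i c |y|² sinh s / 4)` with `q = r + (n + 1) / 2`, the powers of `cosh s` cancel on
both sides of the product estimate (`testNorm_mul_eq`, `lensNorm_lensT_le`). For `c ≠ 0` the module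
becomes the one generated by `y_j`, `∂_{y_j}`, the rotations and `∂_s`, up to coefficients that are
polynomials in `tanh s` and `sech s` (`op_lensT_mem`), and there is no loss in `s` any more.

**Charts.** What is left is an estimate with weights `⟨y⟩` (`lensNorm_mul_le`). Regions `|y| ~ j` and
`s ~ m` are parametrized by a fixed annulus, shifted radially by `j` and in time by `m`. Because the
rotations have size `⟨y⟩` in angular directions, the lens generators control all derivatives in the
chart, uniformly in `j` and `m`, while the Jacobian `~ j^{n - 1}` yields the weight `(n - 1) / 2`.
The remaining power of `⟨y⟩` costs one order on one of the factors (`lensW_add_one_le`). In a chart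
the estimate is the anisotropic Sobolev multiplication `l2Norm_mul_le`, proved by Cauchy–Schwarz for
the convolution of Fourier transforms. The total number of orders needed there leads to
`k - 2 > n / 2`.

**Density and completeness.** A function with finite graph norm is cut off in spacetime: the
generators are homogeneous of nonnegative degree under dilations, so the commutators with a dilated
cutoff tend to zero (`exists_mulDist_close`). For functions of compact support the graph norm is an
anisotropic Sobolev norm, and the Fourier transform of the function is cut off
(`exists_schwartz_momW_sub_le`). Products of approximating test functions form a Cauchy sequence;
the spaces are complete (`exists_tendsto_distW`), and the limit is the pointwise product because the
factors converge in weighted `L²` spaces (`isProduct_of_tendsto`).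
-/

noncomputable section

namespace ModuleRegularity

/-! ### Words in weighted generators -/

section Words

variable {Γ V W P K : Type*}

/-- The weight of a word in generators `g` of weight `d g`. -/
def wt (d : Γ → ℕ) (w : List Γ) : ℕ := (w.map d).sum

@[simp] theorem wt_nil (d : Γ → ℕ) : wt d [] = 0 := rfl

@[simp] theorem wt_cons (d : Γ → ℕ) (g : Γ) (w : List Γ) : wt d (g :: w) = d g + wt d w := by
  simp [wt]

@[simp] theorem wt_append (d : Γ → ℕ) (v w : List Γ) : wt d (v ++ w) = wt d v + wt d w := by
  simp [wt]

theorem length_le_wt {d : Γ → ℕ} (hd : ∀ g, 1 ≤ d g) (w : List Γ) : w.length ≤ wt d w := by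
  induction w with
  | nil => simp
  | cons g w ih => have := hd g; simp only [List.length_cons, wt_cons]; omega

/-- The words of weight at most `a`. The bound on the length is implied when all weights are
positive. -/
def wordsLE [Finite Γ] (d : Γ → ℕ) (a : ℕ) : Finset (List Γ) :=
  (List.finite_length_le Γ a).toFinset.filter fun w => wt d w ≤ a

theorem mem_wordsLE [Finite Γ] {d : Γ → ℕ} (hd : ∀ g, 1 ≤ d g) {a : ℕ} {w : List Γ} :
    w ∈ wordsLE d a ↔ wt d w ≤ a := by
  simp only [wordsLE, Finset.mem_filter, Set.Finite.mem_toFinset, Set.mem_ofPred_eq,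
    and_iff_right_iff_imp]
  exact (length_le_wt hd w).trans

theorem wt_le_of_mem_wordsLE [Finite Γ] {d : Γ → ℕ} {a : ℕ} {w : List Γ} (hw : w ∈ wordsLE d a) :
    wt d w ≤ a := (Finset.mem_filter.1 hw).2

/-- The action of a word, the last letter acting first. -/
def act (A : Γ → V → V) (w : List Γ) (f : V) : V := w.foldr (fun g x => A g x) f

@[simp] theorem act_nil (A : Γ → V → V) (f : V) : act A [] f = f := rfl

@[simp] theorem act_cons (A : Γ → V → V) (g : Γ) (w : List Γ) (f : V) :
    act A (g :: w) f = A g (act A w f) := rfl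

theorem act_append (A : Γ → V → V) (v w : List Γ) (f : V) :
    act A (v ++ w) f = act A v (act A w f) := by
  simp [act]

/-- The graph norm of a gauge `S`: the sum of `S (A_w f)` over the words of weight at most `a`. -/
def wnorm [Finite Γ] (d : Γ → ℕ) (A : Γ → V → V) (S : V → ℝ≥0∞) (a : ℕ) (f : V) : ℝ≥0∞ :=
  ∑ w ∈ wordsLE d a, S (act A w f)

theorem le_wnorm [Finite Γ] {d : Γ → ℕ} (hd : ∀ g, 1 ≤ d g) (A : Γ → V → V) (S : V → ℝ≥0∞)
    {a : ℕ} {w : List Γ} (hw : wt d w ≤ a) (f : V) : S (act A w f) ≤ wnorm d A S a f :=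
  Finset.single_le_sum (f := fun w => S (act A w f)) (fun _ _ => zero_le)
    ((mem_wordsLE hd).2 hw)

theorem wnorm_act_le [Finite Γ] {d : Γ → ℕ} (hd : ∀ g, 1 ≤ d g) (A : Γ → V → V) (S : V → ℝ≥0∞)
    {a b : ℕ} {w : List Γ} (hw : a + wt d w ≤ b) (f : V) :
    wnorm d A S a (act A w f) ≤ (wordsLE d a).card * wnorm d A S b f := by
  rw [← nsmul_eq_mul]
  refine Finset.sum_le_card_nsmul _ _ _ fun v hv => ?_
  rw [← act_append]
  refine le_wnorm hd A S ?_ f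
  have := wt_le_of_mem_wordsLE hv
  rw [wt_append]; omega

theorem wnorm_mono [Finite Γ] {d : Γ → ℕ} (hd : ∀ g, 1 ≤ d g) (A : Γ → V → V) (S : V → ℝ≥0∞)
    {a b : ℕ} (hab : a ≤ b) (f : V) : wnorm d A S a f ≤ wnorm d A S b f :=
  Finset.sum_le_sum_of_subset fun _ hw =>
    (mem_wordsLE hd).2 ((wt_le_of_mem_wordsLE hw).trans hab)

/-- A gauge: subadditive and compatible with scalars, but possibly infinite. -/
structure IsGauge [AddCommMonoid W] [Module ℂ W] (S : W → ℝ≥0∞) : Prop where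
  add_le : ∀ f g, S (f + g) ≤ S f + S g
  smul_le : ∀ (c : ℂ) f, S (c • f) ≤ ‖c‖ₑ * S f

theorem IsGauge.zero [AddCommMonoid W] [Module ℂ W] {S : W → ℝ≥0∞} (hS : IsGauge S) :
    S 0 = 0 := by
  have := hS.smul_le 0 0
  simpa using this

section Transfer

variable [AddCommGroup W] [Module ℂ W] {d : Γ → ℕ} {A : Γ → V → V} {τ : K → P → V → W}

/-- The span of the maps `f ↦ τ κ p (A_w f)` with coefficients `κ` and words `w` of weight at most
`a`. The expressions are uniform in the parameter `p`. -/
def transfer (d : Γ → ℕ) (A : Γ → V → V) (τ : K → P → V → W) (a : ℕ) :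
    Submodule ℂ (P → V → W) :=
  Submodule.span ℂ {T | ∃ κ w, wt d w ≤ a ∧ T = fun p f => τ κ p (act A w f)}

theorem transfer_of (κ : K) {w : List Γ} {a : ℕ} (hw : wt d w ≤ a) :
    (fun p f => τ κ p (act A w f)) ∈ transfer d A τ a :=
  Submodule.subset_span ⟨κ, w, hw, rfl⟩

theorem transfer_mono {a b : ℕ} (hab : a ≤ b) : transfer d A τ a ≤ transfer d A τ b :=
  Submodule.span_mono fun _ ⟨κ, w, hw, hT⟩ => ⟨κ, w, hw.trans hab, hT⟩

theorem transfer_precomp {a : ℕ} (v : List Γ) {T : P → V → W} (hT : T ∈ transfer d A τ a) :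
    (fun p f => T p (act A v f)) ∈ transfer d A τ (a + wt d v) := by
  induction hT using Submodule.span_induction with
  | mem T hT =>
    obtain ⟨κ, w, hw, rfl⟩ := hT
    simp_rw [← act_append]
    exact transfer_of κ (by rw [wt_append]; omega)
  | zero => exact Submodule.zero_mem _
  | add T U _ _ hT hU => exact Submodule.add_mem _ hT hU
  | smul c T _ hT => exact Submodule.smul_mem _ c hT

theorem transfer_comp {a e : ℕ} (B : W →ₗ[ℂ] W)
    (hB : ∀ κ, (fun p f => B (τ κ p f)) ∈ transfer d A τ e) {T : P → V → W}
    (hT : T ∈ transfer d A τ a) : (fun p f => B (T p f)) ∈ transfer d A τ (a + e) := by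
  induction hT using Submodule.span_induction with
  | mem T hT =>
    obtain ⟨κ, w, hw, rfl⟩ := hT
    exact transfer_mono (by omega) (transfer_precomp w (hB κ))
  | zero => simp only [Pi.zero_apply, map_zero]; exact Submodule.zero_mem _
  | add T U _ _ hT hU => simp only [Pi.add_apply, map_add]; exact Submodule.add_mem _ hT hU
  | smul c T _ hT => simp only [Pi.smul_apply, map_smul]; exact Submodule.smul_mem _ c hT

theorem transfer_act {Δ : Type*} {e : Δ → ℕ} {B : Δ → W →ₗ[ℂ] W}
    (hB : ∀ b κ, (fun p f => B b (τ κ p f)) ∈ transfer d A τ (e b)) (v : List Δ) (κ : K) :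
    (fun p f => act (fun b => B b) v (τ κ p f)) ∈ transfer d A τ (wt e v) := by
  induction v with
  | nil => exact transfer_of (w := []) κ le_rfl
  | cons b v ih =>
    rw [wt_cons, add_comm]
    exact transfer_comp (B b) (hB b) ih

theorem transfer_bound [Finite Γ] (hd : ∀ g, 1 ≤ d g) {SW : W → ℝ≥0∞} (hSW : IsGauge SW)
    {SV : P → V → ℝ≥0∞} (hτ : ∀ κ, ∃ C : ℝ≥0, ∀ p f, SW (τ κ p f) ≤ C * SV p f)
    {a : ℕ} {T : P → V → W} (hT : T ∈ transfer d A τ a) :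
    ∃ C : ℝ≥0, ∀ p f, SW (T p f) ≤ C * wnorm d A (SV p) a f := by
  induction hT using Submodule.span_induction with
  | mem T hT =>
    obtain ⟨κ, w, hw, rfl⟩ := hT
    obtain ⟨C, hC⟩ := hτ κ
    refine ⟨C, fun p f => (hC p _).trans ?_⟩
    gcongr
    exact le_wnorm hd A (SV p) hw f
  | zero => exact ⟨0, fun p f => by simp [hSW.zero]⟩
  | add T U _ _ hT hU =>
    obtain ⟨C, hC⟩ := hT
    obtain ⟨D, hD⟩ := hU
    refine ⟨C + D, fun p f => (hSW.add_le _ _).trans ?_⟩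
    rw [ENNReal.coe_add, add_mul]
    exact add_le_add (hC p f) (hD p f)
  | smul c T _ hT =>
    obtain ⟨C, hC⟩ := hT
    refine ⟨‖c‖₊ * C, fun p f => (hSW.smul_le _ _).trans ?_⟩
    rw [ENNReal.coe_mul, mul_assoc]
    exact mul_le_mul' le_rfl (hC p f)

/-- If every target generator `B b` maps each `τ κ` into combinations of `τ κ' ∘ A_w` with `w` of
weight at most `e b`, then graph norms for `B` are controlled by graph norms for `A`, with
constants uniform in the parameter. -/
theorem wnorm_transfer_le [Finite Γ] (hd : ∀ g, 1 ≤ d g) {Δ : Type*} [Finite Δ] {e : Δ → ℕ}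
    {B : Δ → W →ₗ[ℂ] W}
    (hB : ∀ b κ, (fun p f => B b (τ κ p f)) ∈ transfer d A τ (e b))
    {SW : W → ℝ≥0∞} (hSW : IsGauge SW) {SV : P → V → ℝ≥0∞}
    (hτ : ∀ κ, ∃ C : ℝ≥0, ∀ p f, SW (τ κ p f) ≤ C * SV p f) (a : ℕ) (κ : K) :
    ∃ C : ℝ≥0, ∀ p f, wnorm e (fun b => B b) SW a (τ κ p f) ≤ C * wnorm d A (SV p) a f := by
  have h : ∀ v : List Δ, ∃ C : ℝ≥0, wt e v ≤ a →
      ∀ p f, SW (act (fun b => B b) v (τ κ p f)) ≤ C * wnorm d A (SV p) a f := by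
    intro v
    by_cases hv : wt e v ≤ a
    · obtain ⟨C, hC⟩ := transfer_bound hd hSW hτ (transfer_mono hv (transfer_act hB v κ))
      exact ⟨C, fun _ => hC⟩
    · exact ⟨0, fun h => absurd h hv⟩
  choose C hC using h
  refine ⟨∑ v ∈ wordsLE e a, C v, fun p f => ?_⟩
  rw [wnorm, ENNReal.ofNNReal_finsetSum, Finset.sum_mul]
  exact Finset.sum_le_sum fun v hv => hC v (wt_le_of_mem_wordsLE hv) p f

end Transfer

end Words

/-! ### Reordering words -/

section Reorder

variable {Γ R : Type*} [Ring R] [Algebra ℂ R] {d : Γ → ℕ} {X : Γ → R}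

/-- The span of the products of words of weight at most `a`. -/
def wordSpan (d : Γ → ℕ) (X : Γ → R) (a : ℕ) : Submodule ℂ R :=
  Submodule.span ℂ {x | ∃ w, wt d w ≤ a ∧ x = (w.map X).prod}

theorem wordSpan_of {a : ℕ} {w : List Γ} (hw : wt d w ≤ a) : (w.map X).prod ∈ wordSpan d X a :=
  Submodule.subset_span ⟨w, hw, rfl⟩

theorem gen_mem_wordSpan {a : ℕ} {g : Γ} (hg : d g ≤ a) : X g ∈ wordSpan d X a := by
  simpa using wordSpan_of (X := X) (w := [g]) (by simpa using hg)

theorem one_mem_wordSpan {a : ℕ} : (1 : R) ∈ wordSpan d X a := by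
  simpa using wordSpan_of (X := X) (d := d) (w := []) (Nat.zero_le a)

theorem wordSpan_mono {a b : ℕ} (hab : a ≤ b) : wordSpan d X a ≤ wordSpan d X b :=
  Submodule.span_mono fun _ ⟨w, hw, hx⟩ => ⟨w, hw.trans hab, hx⟩

theorem gen_mul_mem_wordSpan {a : ℕ} (g : Γ) {x : R} (hx : x ∈ wordSpan d X a) :
    X g * x ∈ wordSpan d X (d g + a) := by
  induction hx using Submodule.span_induction with
  | mem x hx =>
    obtain ⟨w, hw, rfl⟩ := hx
    exact Submodule.subset_span ⟨g :: w, by simpa using hw, by simp⟩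
  | zero => simp
  | add x y _ _ hx hy => rw [mul_add]; exact Submodule.add_mem _ hx hy
  | smul c x _ hx => rw [mul_smul_comm]; exact Submodule.smul_mem _ c hx

theorem mul_word_mem_wordSpan {a : ℕ} (v : List Γ) {x : R} (hx : x ∈ wordSpan d X a) :
    x * (v.map X).prod ∈ wordSpan d X (a + wt d v) := by
  induction hx using Submodule.span_induction with
  | mem x hx =>
    obtain ⟨w, hw, rfl⟩ := hx
    exact Submodule.subset_span ⟨w ++ v, by simpa using hw, by simp⟩
  | zero => simp
  | add x y _ _ hx hy => rw [add_mul]; exact Submodule.add_mem _ hx hy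
  | smul c x _ hx => rw [smul_mul_assoc]; exact Submodule.smul_mem _ c hx

/-- Permuting the letters of a word changes its product by words of lower weight, provided
commutators of generators lose one unit of weight. -/
theorem prod_sub_prod_mem_wordSpan (hd : ∀ g, 1 ≤ d g)
    (hcomm : ∀ g h, X g * X h - X h * X g ∈ wordSpan d X (d g + d h - 1))
    {v w : List Γ} (hvw : v.Perm w) :
    (v.map X).prod - (w.map X).prod ∈ wordSpan d X (wt d v - 1) := by
  induction hvw with
  | nil => simp
  | cons g hp ih =>
    rename_i l₁ l₂
    simp only [List.map_cons, List.prod_cons, ← mul_sub, wt_cons]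
    rcases Nat.eq_zero_or_pos (wt d l₁) with h0 | h0
    · have : l₁ = [] := List.length_eq_zero_iff.1 (by have := length_le_wt hd l₁; omega)
      subst this
      have : l₂ = [] := by simpa using hp
      subst this
      simp
    · exact wordSpan_mono (by omega) (gen_mul_mem_wordSpan g ih)
  | swap g h l =>
    have := mul_word_mem_wordSpan l (hcomm h g)
    simp only [List.map_cons, List.prod_cons, wt_cons]
    rw [← mul_assoc, ← mul_assoc, ← sub_mul]
    refine wordSpan_mono ?_ this
    have := hd g
    omega
  | trans h₁ h₂ ih₁ ih₂ =>
    rename_i l₁ l₂ l₃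
    have hw : wt d l₂ = wt d l₁ := (h₁.symm.map d).sum_eq
    rw [← sub_add_sub_cancel]
    exact Submodule.add_mem _ ih₁ (hw ▸ ih₂)

/-- Words of weight at most `a` are combinations of ordered monomials of weight at most `a`, as in
the Poincaré–Birkhoff–Witt theorem. -/
theorem wordSpan_le_span_ordered [Fintype Γ] [DecidableEq Γ] (hd : ∀ g, 1 ≤ d g)
    (hcomm : ∀ g h, X g * X h - X h * X g ∈ wordSpan d X (d g + d h - 1))
    {L : List Γ} (hL : L.Nodup) (hmem : ∀ g, g ∈ L) (a : ℕ) :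
    wordSpan d X a ≤ Submodule.span ℂ
      {x | ∃ α : Γ → ℕ, ∑ g, α g * d g ≤ a ∧ x = (L.map fun g => X g ^ α g).prod} := by
  induction a using Nat.strong_induction_on with
  | _ a ih =>
  refine Submodule.span_le.2 ?_
  rintro _ ⟨w, hw, rfl⟩
  let v : List Γ := L.flatMap fun g => List.replicate (w.count g) g
  have hcount : ∀ g, v.count g = w.count g := by
    intro g
    simp only [v, List.count_flatMap, Function.comp_def, List.count_replicate]
    have : (L.map fun x => if (x == g) = true then List.count x w else 0).sum
        = ∑ x ∈ L.toFinset, if x = g then List.count x w else 0 := by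
      rw [List.sum_toFinset _ hL]
      simp
    rw [this]
    simp [hmem]
  have hperm : w.Perm v := (List.perm_iff_count.2 hcount).symm
  have hv : (v.map X).prod = (L.map fun g => X g ^ w.count g).prod := by
    simp only [v]
    clear hmem hL hcount hperm v ih
    induction L with
    | nil => simp
    | cons g L ihL => simp [List.prod_replicate, ihL]
  have hwt : ∑ g, w.count g * d g = wt d w := by
    rw [wt, Finset.sum_list_map_count]
    simp only [smul_eq_mul]
    refine (Finset.sum_subset (Finset.subset_univ _) fun g _ hg => ?_).symm
    rw [List.count_eq_zero_of_not_mem (by simpa using hg), zero_mul]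
  have hmain := prod_sub_prod_mem_wordSpan hd hcomm hperm
  have hO : (v.map X).prod ∈ Submodule.span ℂ
      {x | ∃ α : Γ → ℕ, ∑ g, α g * d g ≤ a ∧ x = (L.map fun g => X g ^ α g).prod} :=
    Submodule.subset_span ⟨fun g => w.count g, hwt.trans_le hw, hv⟩
  rcases Nat.eq_zero_or_pos (wt d w) with h0 | h0
  · have : w = [] := List.length_eq_zero_iff.1 (by have := length_le_wt hd w; omega)
    subst this
    have h1 : (List.map X v).prod = 1 := by rw [hv]; simp
    rw [h1] at hO
    simpa using hO
  · have h1 := ih (wt d w - 1) (by omega) hmain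
    have h2 := Submodule.span_mono (R := ℂ) (s := {x | ∃ α : Γ → ℕ, ∑ g, α g * d g ≤ wt d w - 1 ∧
      x = (L.map fun g => X g ^ α g).prod}) (fun x ⟨α, hα, hx⟩ =>
        (⟨α, hα.trans (by omega), hx⟩ : ∃ α : Γ → ℕ, ∑ g, α g * d g ≤ a ∧
          x = (L.map fun g => X g ^ α g).prod)) h1
    have := Submodule.add_mem _ h2 hO
    rwa [sub_add_cancel] at this

end Reorder

end ModuleRegularity

end

noncomputable section

namespace ModuleRegularity

/-! ### Commutators of the generators -/

section Weyl

variable {R : Type*} [Ring R] {n : ℕ}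

/-- The commutator `x y - y x`. -/
def comm (x y : R) : R := x * y - y * x

theorem comm_skew (x y : R) : -comm y x = comm x y := by simp [comm]

theorem comm_mul (x y z : R) : comm x (y * z) = comm x y * z + y * comm x z := by
  simp only [comm]; noncomm_ring

theorem mul_comm_right (x y z : R) : comm (x * y) z = x * comm y z + comm x z * y := by
  simp only [comm]; noncomm_ring

theorem comm_add (x y z : R) : comm x (y + z) = comm x y + comm x z := by
  simp only [comm]; noncomm_ring

theorem add_comm_left (x y z : R) : comm (x + y) z = comm x z + comm y z := by
  simp only [comm]; noncomm_ring

theorem comm_sub (x y z : R) : comm x (y - z) = comm x y - comm x z := by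
  simp only [comm]; noncomm_ring

theorem sub_comm_left (x y z : R) : comm (x - y) z = comm x z - comm y z := by
  simp only [comm]; noncomm_ring

theorem comm_sum {ι : Type*} (s : Finset ι) (x : R) (f : ι → R) :
    comm x (∑ i ∈ s, f i) = ∑ i ∈ s, comm x (f i) := by
  simp only [comm, Finset.mul_sum, Finset.sum_mul, Finset.sum_sub_distrib]

theorem sum_comm_left {ι : Type*} (s : Finset ι) (f : ι → R) (x : R) :
    comm (∑ i ∈ s, f i) x = ∑ i ∈ s, comm (f i) x := by
  simp only [comm, Finset.mul_sum, Finset.sum_mul, Finset.sum_sub_distrib]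

variable [Algebra ℂ R]

theorem comm_smul (c : ℂ) (x y : R) : comm x (c • y) = c • comm x y := by
  simp only [comm, mul_smul_comm, smul_mul_assoc, smul_sub]

theorem smul_comm_left (c : ℂ) (x y : R) : comm (c • x) y = c • comm x y := by
  simp only [comm, mul_smul_comm, smul_mul_assoc, smul_sub]

/-- The generators, formed from the positions `q` and momenta `p` of a Weyl algebra. -/
def weylGen (q p : Fin (n + 1) → R) (c : ℝ) : Gen n → R
  | .dz j => p j.castSucc
  | .dt => p (Fin.last n)
  | .rot i j => q i.castSucc * p j.castSucc - q j.castSucc * p i.castSucc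
  | .gal j => q (Fin.last n) * p j.castSucc - ((c : ℂ) / 2) • q j.castSucc
  | .dil => (2 : ℂ) • (q (Fin.last n) * p (Fin.last n)) +
      ∑ j : Fin n, q j.castSucc * p j.castSucc

variable {q p : Fin (n + 1) → R}

/-- Commutators of generators lose one unit of parabolic regularity order. -/
theorem weylGen_comm_mem (hq : ∀ a b, comm (q a) (q b) = 0) (hp : ∀ a b, comm (p a) (p b) = 0)
    (hpq : ∀ a b, comm (p a) (q b) = if a = b then -Complex.I • (1 : R) else 0) (c : ℝ)
    (g h : Gen n) :
    comm (weylGen q p c g) (weylGen q p c h) ∈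
      wordSpan Gen.regOrder (weylGen q p c) (g.regOrder + h.regOrder - 1) := by
  have hqp : ∀ a b, comm (q a) (p b) = if a = b then Complex.I • (1 : R) else 0 := by
    intro a b
    rw [← comm_skew, hpq]
    by_cases hab : a = b
    · subst hab; simp
    · rw [if_neg hab, if_neg (Ne.symm hab), neg_zero]
  have hne : ∀ j : Fin n, ¬ j.castSucc = Fin.last n := fun j => (Fin.castSucc_lt_last j).ne
  have hne' : ∀ j : Fin n, ¬ Fin.last n = j.castSucc := fun j h => hne j h.symm
  -- antisymmetry reduces the table to half of its entries
  suffices H : ∀ g h : Gen n, (match g, h with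
      | .dz _, _ => True | .dt, .dz _ => False | .dt, _ => True
      | .rot _ _, .dz _ => False | .rot _ _, .dt => False | .rot _ _, _ => True
      | .gal _, .gal _ => True | .gal _, .dil => True | .gal _, _ => False
      | .dil, .dil => True | .dil, _ => False) → comm (weylGen q p c g) (weylGen q p c h) ∈
      wordSpan Gen.regOrder (weylGen q p c) (g.regOrder + h.regOrder - 1) by
    have H' := H g h
    have H'' := H h g
    rw [← comm_skew, neg_mem_iff, add_comm] at H''
    cases g <;> cases h <;> first | exact H' trivial | exact H'' trivial
  intro g h hgh
  have mdz : ∀ (j : Fin n) a, 1 ≤ a → p j.castSucc ∈ wordSpan Gen.regOrder (weylGen q p c) a :=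
    fun j a ha => gen_mem_wordSpan (X := weylGen q p c) (g := .dz j) ha
  have mdt : ∀ a, 2 ≤ a → p (Fin.last n) ∈ wordSpan Gen.regOrder (weylGen q p c) a :=
    fun a ha => gen_mem_wordSpan (X := weylGen q p c) (g := .dt) ha
  have mone : ∀ a, (1 : R) ∈ wordSpan Gen.regOrder (weylGen q p c) a :=
    fun a => one_mem_wordSpan
  have mrot : ∀ (i j : Fin n) a, 1 ≤ a → q i.castSucc * p j.castSucc - q j.castSucc * p i.castSucc ∈
      wordSpan Gen.regOrder (weylGen q p c) a :=
    fun i j a ha => gen_mem_wordSpan (X := weylGen q p c) (g := .rot i j) ha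
  have mgal : ∀ (j : Fin n) a, 1 ≤ a →
      q (Fin.last n) * p j.castSucc - ((c : ℂ) / 2) • q j.castSucc ∈
      wordSpan Gen.regOrder (weylGen q p c) a :=
    fun j a ha => gen_mem_wordSpan (X := weylGen q p c) (g := .gal j) ha
  cases g <;> cases h <;> first | exact hgh.elim | skip
  all_goals
    simp only [weylGen, Gen.regOrder, comm_sub, sub_comm_left, comm_add, add_comm_left, comm_smul,
      smul_comm_left, comm_mul, mul_comm_right, hq, hp, hpq, hqp, comm_sum, sum_comm_left, hne, hne',
      if_false, if_true, mul_zero, zero_mul,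
      add_zero, zero_add, sub_zero, smul_zero, zero_sub, Finset.sum_const_zero, ite_mul, mul_ite,
      Fin.castSucc_inj, smul_mul_assoc, mul_smul_comm, one_mul, mul_one, Finset.sum_ite_eq,
      Finset.sum_ite_eq', Finset.mem_univ]
  case dz.dz | dz.dt | dt.dt | dt.rot => exact Submodule.zero_mem _
  case dz.rot l i j =>
    refine Submodule.sub_mem _ ?_ ?_ <;> split_ifs <;> first
      | exact Submodule.zero_mem _
      | exact Submodule.smul_mem _ _ (mdz _ _ le_rfl)
  case dz.gal =>
    refine Submodule.neg_mem _ (Submodule.smul_mem _ _ ?_)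
    split_ifs
    · exact Submodule.smul_mem _ _ (mone _)
    · exact Submodule.zero_mem _
  case dz.dil | dt.gal => exact Submodule.smul_mem _ _ (mdz _ _ (by norm_num))
  case dt.dil => exact Submodule.smul_mem _ _ (Submodule.smul_mem _ _ (mdt _ (by norm_num)))
  case rot.rot i j k l =>
    have key : ∀ (P : Prop) [Decidable P] (x y : R), (x - y ∈ wordSpan Gen.regOrder (weylGen q p c)
        (1 + 1 - 1)) → ((if P then -Complex.I • x else 0) - (if P then -Complex.I • y else 0)) ∈
        wordSpan Gen.regOrder (weylGen q p c) (1 + 1 - 1) := by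
      intro P _ x y h
      split_ifs
      · rw [← smul_sub]; exact Submodule.smul_mem _ _ h
      · simp
    have h1 := key (j = k) _ _ (mrot i l _ le_rfl)
    have h2 := key (i = k) _ _ (mrot j l _ le_rfl)
    have h3 := key (j = l) _ _ (mrot i k _ le_rfl)
    have h4 := key (i = l) _ _ (mrot j k _ le_rfl)
    convert Submodule.add_mem _ (Submodule.sub_mem _ (Submodule.sub_mem _ h1 h2) h3) h4 using 1
    split_ifs <;> simp only [sub_mul, mul_sub, smul_mul_assoc, mul_smul_comm, zero_mul, mul_zero] <;>
      module
  case rot.gal i j l =>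
    have key : ∀ (P : Prop) [Decidable P] (x : R), (x ∈ wordSpan Gen.regOrder (weylGen q p c)
        (1 + 1 - 1)) → (if P then Complex.I • x else 0) ∈
        wordSpan Gen.regOrder (weylGen q p c) (1 + 1 - 1) := by
      intro P _ x h
      split_ifs
      · exact Submodule.smul_mem _ _ h
      · simp
    convert Submodule.sub_mem _ (key (i = l) _ (mgal j _ le_rfl)) (key (j = l) _ (mgal i _ le_rfl))
      using 1
    split_ifs <;> simp only [mul_sub, mul_smul_comm, mul_zero] <;>
      module
  case rot.dil =>
    simp only [sub_mul, mul_sub, ite_mul, mul_ite, zero_mul, mul_zero, Finset.sum_add_distrib,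
      Finset.sum_sub_distrib, Finset.sum_ite_eq, Finset.mem_univ, if_true, smul_mul_assoc,
      mul_smul_comm]
    convert Submodule.zero_mem _ using 1
    module
  case gal.gal i j =>
    convert Submodule.zero_mem _ using 1
    by_cases h : i = j
    · simp only [h, if_true, mul_neg, mul_smul_comm, mul_one]; module
    · simp [h]
  case gal.dil j =>
    have h := Submodule.smul_mem _ Complex.I (mgal j (1 + 2 - 1) (by norm_num))
    convert h using 1
    simp only [smul_ite, smul_zero, Finset.sum_add_distrib, mul_neg, mul_ite, mul_smul_comm,
      mul_one, mul_zero, Finset.sum_neg_distrib, Finset.sum_ite_eq, Finset.mem_univ, if_true]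
    module
  case dil.dil =>
    convert Submodule.zero_mem _ using 1
    have : ∀ x : R, -Complex.I • x + Complex.I • x = 0 := fun x => by module
    simp only [this, Finset.sum_const_zero]
    module

end Weyl

end ModuleRegularity

end

noncomputable section

namespace ModuleRegularity

open scoped ContDiff LineDeriv

variable {n : ℕ}

/-! ### Test functions -/

/-- The coordinate functions of spacetime; the last one is the time. -/
def coord (a : Fin (n + 1)) (Z : Spacetime n) : ℂ := ((Z a : ℝ) : ℂ)

/-- The coordinate unit vectors of spacetime. -/
def unitVec (a : Fin (n + 1)) : Spacetime n := EuclideanSpace.single a (1 : ℝ)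

theorem unitVec_apply (a b : Fin (n + 1)) : unitVec a b = if b = a then (1 : ℝ) else 0 := by
  simp [unitVec]

/-- The smooth functions on spacetime. -/
abbrev Smooth (n : ℕ) : Type := {a : Spacetime n → ℂ // ContDiff ℝ ∞ a}

/-- The space of smooth compactly supported functions on spacetime, as a subspace. -/
def testSubmodule (n : ℕ) : Submodule ℂ (Spacetime n → ℂ) where
  carrier := {f | ContDiff ℝ ∞ f ∧ HasCompactSupport f}
  add_mem' := fun {f g} (hf : ContDiff ℝ ∞ f ∧ HasCompactSupport f)
    (hg : ContDiff ℝ ∞ g ∧ HasCompactSupport g) => ⟨hf.1.add hg.1, hf.2.add hg.2⟩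
  zero_mem' := ⟨contDiff_const, HasCompactSupport.zero⟩
  smul_mem' := fun c f (hf : ContDiff ℝ ∞ f ∧ HasCompactSupport f) =>
    ⟨contDiff_const.smul hf.1, HasCompactSupport.smul_left (f := fun _ => c) hf.2⟩

/-- The space of smooth compactly supported functions on spacetime. -/
abbrev Test (n : ℕ) : Type := testSubmodule n

theorem Test.contDiff (f : Test n) : ContDiff ℝ ∞ f.1 := f.2.1

theorem Test.hasCompactSupport (f : Test n) : HasCompactSupport f.1 := f.2.2

theorem Test.differentiable (f : Test n) : Differentiable ℝ f.1 :=
  f.contDiff.differentiable (by simp)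

theorem Test.continuous (f : Test n) : Continuous f.1 := f.contDiff.continuous

@[simp] theorem Test.smul_apply (a : ℂ) (f : Test n) (Z : Spacetime n) :
    (a • f).1 Z = a * f.1 Z := rfl

@[simp] theorem Test.add_apply (f g : Test n) (Z : Spacetime n) :
    (f + g).1 Z = f.1 Z + g.1 Z := rfl

@[simp] theorem Test.neg_apply (f : Test n) (Z : Spacetime n) : (-f).1 Z = -f.1 Z := rfl

@[simp] theorem Test.sub_apply (f g : Test n) (Z : Spacetime n) :
    (f - g).1 Z = f.1 Z - g.1 Z := rfl

@[simp] theorem Test.sum_apply {ι : Type*} (s : Finset ι) (f : ι → Test n) (Z : Spacetime n) :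
    (∑ i ∈ s, f i).1 Z = ∑ i ∈ s, (f i).1 Z := by
  have : (∑ i ∈ s, f i).1 = ∑ i ∈ s, (f i).1 := map_sum (testSubmodule n).subtype _ _
  rw [this, Finset.sum_apply]

theorem Test.ext {f g : Test n} (h : ∀ Z, f.1 Z = g.1 Z) : f = g := Subtype.ext (funext h)

/-- Multiplication of test functions by a smooth function. -/
def mulTest (a : Smooth n) : Test n →ₗ[ℂ] Test n where
  toFun f := ⟨fun Z => a.1 Z * f.1 Z, a.2.mul f.contDiff, f.hasCompactSupport.mul_left⟩
  map_add' f g := Test.ext fun Z => by simp [mul_add]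
  map_smul' c f := Test.ext fun Z => by simp [mul_left_comm]

@[simp] theorem mulTest_apply (a : Smooth n) (f : Test n) (Z : Spacetime n) :
    (mulTest a f).1 Z = a.1 Z * f.1 Z := rfl

/-- The product of test functions. -/
def Test.mul (f g : Test n) : Test n := mulTest ⟨f.1, f.contDiff⟩ g

@[simp] theorem Test.mul_apply (f g : Test n) (Z : Spacetime n) :
    (f.mul g).1 Z = f.1 Z * g.1 Z := rfl

/-- The coordinate functions as elements of the algebra of smooth functions. -/
def coordS (a : Fin (n + 1)) : Smooth n :=
  ⟨coord a, (Complex.ofRealCLM.comp (EuclideanSpace.proj a : Spacetime n →L[ℝ] ℝ)).contDiff⟩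

/-- Partial derivatives of test functions. -/
def pd (a : Fin (n + 1)) : Test n →ₗ[ℂ] Test n where
  toFun f := ⟨fun Z => fderiv ℝ f.1 Z (unitVec a),
    (f.contDiff.fderiv_right (m := ∞) (by simp)).clm_apply contDiff_const,
    f.hasCompactSupport.fderiv_apply (𝕜 := ℝ) _⟩
  map_add' f g := Test.ext fun Z => by
    have : (f + g).1 = f.1 + g.1 := rfl
    simp only [Test.add_apply, this]
    rw [fderiv_add (f.differentiable Z) (g.differentiable Z)]
    rfl
  map_smul' c f := Test.ext fun Z => by
    have : (c • f).1 = c • f.1 := rfl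
    simp only [this, RingHom.id_apply, Test.smul_apply]
    rw [fderiv_const_smul (f.differentiable Z)]
    rfl

theorem pd_apply (a : Fin (n + 1)) (f : Test n) (Z : Spacetime n) :
    (pd a f).1 Z = fderiv ℝ f.1 Z (unitVec a) := rfl

theorem hasFDerivAt_coord (a : Fin (n + 1)) (Z : Spacetime n) :
    HasFDerivAt (coord a) (Complex.ofRealCLM.comp
      (EuclideanSpace.proj a : Spacetime n →L[ℝ] ℝ)) Z :=
  (Complex.ofRealCLM.comp (EuclideanSpace.proj a : Spacetime n →L[ℝ] ℝ)).hasFDerivAt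

theorem pd_mul_apply (a : Fin (n + 1)) (f g : Test n) (Z : Spacetime n) :
    (pd a (f.mul g)).1 Z = (pd a f).1 Z * g.1 Z + f.1 Z * (pd a g).1 Z := by
  have : (f.mul g).1 = f.1 * g.1 := rfl
  simp only [pd_apply, this]
  rw [fderiv_mul (f.differentiable Z) (g.differentiable Z)]
  simp [mul_comm, add_comm]

/-- A test function as a Schwartz function. -/
def toSchw : Test n →ₗ[ℂ] 𝓢(Spacetime n, ℂ) where
  toFun f := f.hasCompactSupport.toSchwartzMap f.contDiff
  map_add' f g := by ext; simp
  map_smul' c f := by ext; simp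

@[simp] theorem toSchw_apply (f : Test n) (Z : Spacetime n) : toSchw f Z = f.1 Z := rfl

/-- A test function as a tempered distribution. -/
def toDist : Test n →ₗ[ℂ] 𝓢'(Spacetime n, ℂ) :=
  (SchwartzMap.toTemperedDistributionCLM (Spacetime n) ℂ volume).toLinearMap ∘ₗ toSchw

theorem toDist_apply (f : Test n) (φ : 𝓢(Spacetime n, ℂ)) :
    toDist f φ = ∫ Z, φ Z * f.1 Z := by
  simp [toDist]

/-! ### The generators on distributions and on test functions -/

/-- Multiplication of tempered distributions by a coordinate. -/
def posD (a : Fin (n + 1)) : 𝓢'(Spacetime n, ℂ) →L[ℂ] 𝓢'(Spacetime n, ℂ) :=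
  TemperedDistribution.smulLeftCLM ℂ (coord a)

/-- The operator `-i ∂_a` on tempered distributions. -/
def momD (a : Fin (n + 1)) : 𝓢'(Spacetime n, ℂ) →L[ℂ] 𝓢'(Spacetime n, ℂ) :=
  (-Complex.I) • LineDeriv.lineDerivOpCLM ℂ 𝓢'(Spacetime n, ℂ) (unitVec a)

theorem coord_hasTemperateGrowth (a : Fin (n + 1)) : (coord (n := n) a).HasTemperateGrowth :=
  (Complex.ofRealCLM.comp (EuclideanSpace.proj a : Spacetime n →L[ℝ] ℝ)).hasTemperateGrowth

theorem op_eq_weylGen (c : ℝ) (g : Gen n) : g.op c = weylGen posD momD c g := by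
  cases g <;> rfl

/-- Multiplication of test functions by a coordinate. -/
def posT (a : Fin (n + 1)) : Test n →ₗ[ℂ] Test n := mulTest (coordS a)

/-- The operator `-i ∂_a` on test functions. -/
def momT (a : Fin (n + 1)) : Test n →ₗ[ℂ] Test n := (-Complex.I) • pd a

theorem posT_apply (a : Fin (n + 1)) (f : Test n) (Z : Spacetime n) :
    (posT a f).1 Z = coord a Z * f.1 Z := rfl

theorem momT_apply (a : Fin (n + 1)) (f : Test n) (Z : Spacetime n) :
    (momT a f).1 Z = -Complex.I * (pd a f).1 Z := rfl

/-- The generators on test functions. -/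
def testOp (c : ℝ) (g : Gen n) : Test n →ₗ[ℂ] Test n :=
  weylGen (R := Module.End ℂ (Test n)) posT momT c g

theorem toDist_mulTest (a : Smooth n) (ha : a.1.HasTemperateGrowth) (f : Test n) :
    toDist (mulTest a f) = TemperedDistribution.smulLeftCLM ℂ a.1 (toDist f) := by
  ext φ
  rw [TemperedDistribution.smulLeftCLM_apply_apply, toDist_apply, toDist_apply]
  refine integral_congr_ae (.of_forall fun Z => ?_)
  simp only [mulTest_apply, SchwartzMap.smulLeftCLM_apply_apply ha, smul_eq_mul]
  ring

theorem toSchw_pd (a : Fin (n + 1)) (f : Test n) : toSchw (pd a f) = ∂_{unitVec a} (toSchw f) := by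
  ext Z
  rw [SchwartzMap.lineDerivOp_apply_eq_fderiv]
  rfl

theorem toDist_pd (a : Fin (n + 1)) (f : Test n) :
    toDist (pd a f) = ∂_{unitVec a} (toDist f) := by
  have h : ∀ f : Test n, toDist f = SchwartzMap.toTemperedDistributionCLM _ ℂ volume (toSchw f) :=
    fun _ => rfl
  rw [h, h, toSchw_pd, TemperedDistribution.lineDerivOp_toTemperedDistributionCLM_eq]

theorem toDist_testOp (c : ℝ) (g : Gen n) (f : Test n) :
    toDist (testOp c g f) = g.op c (toDist f) := by
  have hq : ∀ a f, toDist (posT (n := n) a f) = posD a (toDist f) := fun a f =>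
    toDist_mulTest _ (coord_hasTemperateGrowth a) f
  have hp : ∀ a f, toDist (momT (n := n) a f) = momD a (toDist f) := fun a f => by
    rw [momT, LinearMap.smul_apply, map_smul, toDist_pd]; rfl
  rw [op_eq_weylGen]
  cases g <;> simp [testOp, weylGen, hq, hp]

theorem toDist_act (c : ℝ) (w : List (Gen n)) (f : Test n) :
    toDist (act (fun g => testOp c g) w f) = act (fun g => Gen.op c g) w (toDist f) := by
  induction w with
  | nil => rfl
  | cons g w ih => rw [act_cons, act_cons, toDist_testOp, ih]

theorem act_op_eq_prod (c : ℝ) (w : List (Gen n)) (u : 𝓢'(Spacetime n, ℂ)) :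
    act (fun g => Gen.op c g) w u = (w.map (Gen.op c)).prod u := by
  induction w with
  | nil => rfl
  | cons g w ih => rw [act_cons, ih, List.map_cons, List.prod_cons]; rfl

theorem comm_momD_posD (a b : Fin (n + 1)) :
    comm (momD (n := n) a) (posD b) = if a = b then -Complex.I • 1 else 0 := by
  ext u φ
  have key : SchwartzMap.smulLeftCLM ℂ (coord b) (∂_{unitVec a} φ) =
      ∂_{unitVec a} (SchwartzMap.smulLeftCLM ℂ (coord b) φ) - (if a = b then (1 : ℂ) else 0) • φ := by
    ext Z
    have h1 : (SchwartzMap.smulLeftCLM ℂ (coord b) φ : Spacetime n → ℂ) = coord b * φ := by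
      ext Z; simp [SchwartzMap.smulLeftCLM_apply_apply (coord_hasTemperateGrowth b)]
    simp only [SchwartzMap.smulLeftCLM_apply_apply (coord_hasTemperateGrowth b), sub_apply,
      smul_apply, SchwartzMap.lineDerivOp_apply_eq_fderiv, h1]
    rw [((hasFDerivAt_coord b Z).mul φ.differentiableAt.hasFDerivAt).fderiv]
    simp only [smul_eq_mul, add_apply, smul_apply,
      ContinuousLinearMap.comp_apply, Complex.ofRealCLM_apply, PiLp.proj_apply, unitVec_apply, eq_comm (a := a)]
    split_ifs <;> simp
  have h2 : comm (momD (n := n) a) (posD b) u φ =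
      -Complex.I * (u (SchwartzMap.smulLeftCLM ℂ (coord b) (-∂_{unitVec a} φ)) ) -
      -Complex.I * (u (-∂_{unitVec a} (SchwartzMap.smulLeftCLM ℂ (coord b) φ))) := rfl
  rw [h2, map_neg, key]
  split_ifs
  · simp
    ring
  · simp

theorem comm_posD_posD (a b : Fin (n + 1)) : comm (posD (n := n) a) (posD b) = 0 := by
  ext u φ
  have h : posD (n := n) a (posD b u) = posD b (posD a u) := by
    simp only [posD, TemperedDistribution.smulLeftCLM_smulLeftCLM_apply (coord_hasTemperateGrowth a)
      (coord_hasTemperateGrowth b), TemperedDistribution.smulLeftCLM_smulLeftCLM_apply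
      (coord_hasTemperateGrowth b) (coord_hasTemperateGrowth a), mul_comm (coord b)]
  have h2 : comm (posD (n := n) a) (posD b) u φ = posD a (posD b u) φ - posD b (posD a u) φ := rfl
  rw [h2, h, sub_self]
  rfl

theorem pd_comm_schwartz (v w : Spacetime n) (φ : 𝓢(Spacetime n, ℂ)) :
    ∂_{v} (∂_{w} φ) = ∂_{w} (∂_{v} φ) := by
  ext Z
  have h : ∀ v w, (∂_{v} (∂_{w} φ) : 𝓢(Spacetime n, ℂ)) Z = fderiv ℝ (fderiv ℝ φ) Z v w := by
    intro v w
    rw [SchwartzMap.lineDerivOp_apply_eq_fderiv]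
    have h1 : ((∂_{w} φ : 𝓢(Spacetime n, ℂ)) : Spacetime n → ℂ) = fun Z => fderiv ℝ φ Z w := by
      ext Z; rw [SchwartzMap.lineDerivOp_apply_eq_fderiv]
    have h2 : DifferentiableAt ℝ (fderiv ℝ φ) Z :=
      ((φ.smooth 2).fderiv_right (m := 1) (by norm_num)).differentiable (by simp) Z
    rw [h1, fderiv_clm_apply h2 (differentiableAt_const w)]
    simp
  rw [h, h]
  exact ((φ.smooth 2).contDiffAt.isSymmSndFDerivAt (by simp)).eq v w

theorem comm_momD_momD (a b : Fin (n + 1)) : comm (momD (n := n) a) (momD b) = 0 := by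
  ext u φ
  have h2 : comm (momD (n := n) a) (momD b) u φ =
      -Complex.I * (-Complex.I * u (-∂_{unitVec b} (-∂_{unitVec a} φ))) -
      -Complex.I * (-Complex.I * u (-∂_{unitVec a} (-∂_{unitVec b} φ))) := rfl
  have h3 : -∂_{unitVec b} (-∂_{unitVec a} φ) = -∂_{unitVec a} (-∂_{unitVec b} φ) := by
    rw [LineDeriv.lineDerivOp_neg, LineDeriv.lineDerivOp_neg, pd_comm_schwartz]
  rw [h2, h3]
  simp

theorem one_le_regOrder (g : Gen n) : 1 ≤ g.regOrder := by
  cases g <;> simp [Gen.regOrder]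

theorem genList_nodup (n : ℕ) : (genList n).Nodup := by
  have h1 : ((List.finRange n).map (Gen.dz (n := n))).Nodup :=
    (List.nodup_finRange n).map fun _ _ h => by simpa using h
  have h2 : ((List.finRange n).map (Gen.gal (n := n))).Nodup :=
    (List.nodup_finRange n).map fun _ _ h => by simpa using h
  have h3 : ((List.finRange n ×ˢ List.finRange n).map fun p => Gen.rot (n := n) p.1 p.2).Nodup :=
    ((List.nodup_finRange n).product (List.nodup_finRange n)).map fun p q h => by
      simpa [Prod.ext_iff] using h
  simp only [genList, List.nodup_append, h1, h2, h3, List.nodup_singleton, List.mem_append,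
    List.mem_map, List.mem_singleton, true_and]
  refine ⟨⟨⟨?_, ?_⟩, ?_⟩, ?_⟩ <;> simp <;> grind

theorem mem_genList (g : Gen n) : g ∈ genList n := by
  cases g <;> simp [genList]

theorem mem_multiIndices {k : ℕ} {α : Gen n → ℕ} :
    α ∈ multiIndices n k ↔ ∑ g, α g * g.regOrder ≤ k := by
  simp only [multiIndices, Finset.mem_filter, Fintype.mem_piFinset, Finset.mem_range]
  refine ⟨fun h => h.2.2.1, fun h => ?_⟩
  have h1 : ∑ g, α g ≤ k := (Finset.sum_le_sum fun g _ =>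
    Nat.le_mul_of_pos_right _ (one_le_regOrder g)).trans h
  refine ⟨fun g => Nat.lt_succ_of_le ((Finset.single_le_sum (f := α) (fun _ _ => Nat.zero_le _)
    (Finset.mem_univ g)).trans h1), h1, h, (Finset.sum_le_sum fun g _ => ?_).trans h⟩
  refine Nat.mul_le_mul_left _ ?_
  cases g <;> simp [Gen.regOrder, Gen.spaceOrder]

/-- Words are combinations of the ordered monomials of the same order. -/
theorem word_mem_span_genMonomial (c : ℝ) {k : ℕ} {w : List (Gen n)} (hw : wt Gen.regOrder w ≤ k) :
    (w.map (Gen.op c)).prod ∈ Submodule.span ℂ (genMonomial c '' (multiIndices n k : Set _)) := by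
  have h := wordSpan_le_span_ordered (X := weylGen posD momD c) one_le_regOrder
    (weylGen_comm_mem comm_posD_posD comm_momD_momD comm_momD_posD c) (genList_nodup n) mem_genList k
    (wordSpan_of hw)
  have h2 : Gen.op c = weylGen (n := n) posD momD c := funext (op_eq_weylGen c)
  rw [h2]
  refine Submodule.span_mono ?_ h
  rintro _ ⟨α, hα, rfl⟩
  refine ⟨α, mem_multiIndices.2 hα, ?_⟩
  rw [genMonomial, h2]

theorem genMonomial_eq_act (c : ℝ) (α : Gen n → ℕ) :
    ∃ w : List (Gen n), wt Gen.regOrder w = ∑ g, α g * g.regOrder ∧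
      ∀ u, genMonomial c α u = act (fun g => Gen.op c g) w u := by
  refine ⟨(genList n).flatMap fun g => List.replicate (α g) g, ?_, fun u => ?_⟩
  · have h : ∑ g, α g * g.regOrder = ((genList n).map fun g => α g * g.regOrder).sum := by
      rw [← List.sum_toFinset _ (genList_nodup n)]
      exact (Finset.sum_subset (Finset.subset_univ _) fun g _ hg =>
        absurd (List.mem_toFinset.2 (mem_genList g)) hg).symm
    rw [h]
    generalize genList n = L
    induction L with
    | nil => rfl
    | cons g L ih =>
      rw [List.flatMap_cons, wt_append, ih, List.map_cons, List.sum_cons]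
      simp [wt]
  · rw [act_op_eq_prod, genMonomial]
    congr 1
    generalize genList n = L
    induction L with
    | nil => rfl
    | cons g L ih => simp [ih, List.prod_replicate]

/-! ### Weighted norms of distributions -/

theorem lp_toTemperedDistribution_injective {g h : Lp ℂ 2 (volume : Measure (Spacetime n))}
    (H : (g : 𝓢'(Spacetime n, ℂ)) = h) : g = h :=
  LinearMap.ker_eq_bot.1 (Lp.ker_toTemperedDistributionCLM_eq_bot (F := ℂ)
    (μ := (volume : Measure (Spacetime n))) (p := 2)) H

theorem weightedNorm_eq {r : ℝ} {u : 𝓢'(Spacetime n, ℂ)}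
    {g : Lp ℂ 2 (volume : Measure (Spacetime n))} (h : mulWeight n r u = (g : 𝓢'(Spacetime n, ℂ))) :
    weightedNorm r u = ‖g‖ₑ := by
  refine le_antisymm (iInf₂_le g h) (le_iInf₂ fun g' h' => ?_)
  rw [lp_toTemperedDistribution_injective (h.symm.trans h')]

theorem weightedNorm_eq_top {r : ℝ} {u : 𝓢'(Spacetime n, ℂ)} (h : ¬ MemWeightedL2 r u) :
    weightedNorm r u = ⊤ :=
  iInf₂_eq_top.2 fun g hg => absurd ⟨g, hg⟩ h

theorem memWeightedL2_iff {r : ℝ} {u : 𝓢'(Spacetime n, ℂ)} :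
    MemWeightedL2 r u ↔ weightedNorm r u ≠ ⊤ := by
  refine ⟨fun ⟨g, hg⟩ => ?_, fun h => by_contra fun h' => h (weightedNorm_eq_top h')⟩
  rw [weightedNorm_eq hg]
  exact enorm_ne_top

theorem coe_lp_add (g h : Lp ℂ 2 (volume : Measure (Spacetime n))) :
    ((g + h : Lp ℂ 2 (volume : Measure (Spacetime n))) : 𝓢'(Spacetime n, ℂ)) = g + h :=
  map_add (Lp.toTemperedDistributionCLM ℂ (volume : Measure (Spacetime n)) 2) g h

theorem coe_lp_smul (c : ℂ) (g : Lp ℂ 2 (volume : Measure (Spacetime n))) :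
    ((c • g : Lp ℂ 2 (volume : Measure (Spacetime n))) : 𝓢'(Spacetime n, ℂ)) =
      c • (g : 𝓢'(Spacetime n, ℂ)) :=
  map_smul (Lp.toTemperedDistributionCLM ℂ (volume : Measure (Spacetime n)) 2) c g

theorem isGauge_weightedNorm (r : ℝ) : IsGauge (weightedNorm (n := n) r) where
  add_le u v := by
    by_cases hu : MemWeightedL2 r u
    · by_cases hv : MemWeightedL2 r v
      · obtain ⟨g, hg⟩ := hu
        obtain ⟨h, hh⟩ := hv
        rw [weightedNorm_eq hg, weightedNorm_eq hh, weightedNorm_eq (g := g + h)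
          (by rw [map_add, hg, hh, coe_lp_add])]
        exact enorm_add_le _ _
      · simp [weightedNorm_eq_top hv]
    · simp [weightedNorm_eq_top hu]
  smul_le c u := by
    by_cases hu : MemWeightedL2 r u
    · obtain ⟨g, hg⟩ := hu
      rw [weightedNorm_eq hg, weightedNorm_eq (g := c • g) (by rw [map_smul, hg, coe_lp_smul]),
        enorm_smul]
    · rcases eq_or_ne c 0 with rfl | hc
      · rw [zero_smul, weightedNorm_eq (g := 0) (by
          rw [map_zero]
          exact (map_zero (Lp.toTemperedDistributionCLM ℂ (volume : Measure (Spacetime n)) 2)).symm)]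
        simp
      · rw [weightedNorm_eq_top hu, ENNReal.mul_top (by simpa using hc)]
        exact le_top

/-- The weighted norm of a test function. -/
def testNorm (r : ℝ) (f : Test n) : ℝ≥0∞ := eLpNorm (fun Z => weight n r Z * f.1 Z) 2 volume

theorem weight_contDiff (r : ℝ) : ContDiff ℝ ∞ (weight n r) :=
  (weight_hasTemperateGrowth n r).1

/-- The weights as elements of the algebra of smooth functions. -/
def weightS (n : ℕ) (r : ℝ) : Smooth n := ⟨weight n r, weight_contDiff r⟩

theorem toDist_eq_coe_toLp (f : Test n) :
    toDist f = (((toSchw f).toLp 2 volume : Lp ℂ 2 (volume : Measure (Spacetime n))) :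
      𝓢'(Spacetime n, ℂ)) :=
  (Lp.toTemperedDistribution_toLp_eq (toSchw f)).symm

theorem enorm_toLp (f : Test n) : ‖(toSchw f).toLp 2 volume‖ₑ = eLpNorm f.1 2 volume := by
  rw [Lp.enorm_def]
  exact eLpNorm_congr_ae ((toSchw f).coeFn_toLp 2 volume)

theorem weightedNorm_toDist (r : ℝ) (f : Test n) : weightedNorm r (toDist f) = testNorm r f := by
  have h : mulWeight n r (toDist f) = toDist (mulTest (weightS n r) f) := by
    rw [toDist_mulTest (weightS n r) (weight_hasTemperateGrowth n r) f]
    rfl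
  rw [toDist_eq_coe_toLp (mulTest (weightS n r) f)] at h
  rw [weightedNorm_eq h, enorm_toLp]
  rfl

theorem isGauge_testNorm (r : ℝ) : IsGauge (testNorm (n := n) r) where
  add_le f g := by
    simp only [← weightedNorm_toDist, map_add]
    exact (isGauge_weightedNorm r).add_le _ _
  smul_le c f := by
    simp only [← weightedNorm_toDist, map_smul]
    exact (isGauge_weightedNorm r).smul_le _ _

/-! ### Leibniz rule -/

theorem testOp_mul (c₁ c₂ : ℝ) (g : Gen n) (f h : Test n) :
    testOp (c₁ + c₂) g (f.mul h) = (testOp c₁ g f).mul h + f.mul (testOp c₂ g h) := by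
  refine Test.ext fun Z => ?_
  cases g <;> simp only [testOp, weylGen, LinearMap.sub_apply, LinearMap.add_apply,
    Module.End.mul_apply, LinearMap.smul_apply, LinearMap.sum_apply, Test.sub_apply, Test.add_apply,
    Test.smul_apply, Test.sum_apply, Test.mul_apply, posT_apply, momT_apply, pd_mul_apply] <;>
    push_cast
  case dil =>
    have : ∀ a b a' b' : ℂ, ∀ s : Fin n → ℂ, ∀ s₁ s₂ : Fin n → ℂ, (∀ j, s j = s₁ j + s₂ j) →
        a = a' + b' → a + ∑ j, s j = (a' + ∑ j, s₁ j) + (b' + ∑ j, s₂ j) := by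
      intro a b a' b' s s₁ s₂ hs ha
      simp only [hs, Finset.sum_add_distrib, ha]
      ring
    simp only [add_mul, mul_add _ _ (∑ _, _), Finset.sum_mul, Finset.mul_sum]
    refine this _ 0 _ _ _ _ _ (fun j => ?_) ?_ <;> ring
  all_goals ring

end ModuleRegularity

end

noncomputable section

namespace ModuleRegularity

open scoped ContDiff LineDeriv FourierTransform

variable {n : ℕ}

/-! ### An anisotropic Sobolev multiplication theorem -/

theorem sq_lintegral_mul_le {α : Type*} [MeasurableSpace α] {μ : Measure α} {f g : α → ℝ≥0∞}
    (hf : AEMeasurable f μ) (hg : AEMeasurable g μ) :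
    (∫⁻ x, f x * g x ∂μ) ^ 2 ≤ (∫⁻ x, f x ^ 2 ∂μ) * ∫⁻ x, g x ^ 2 ∂μ := by
  have h := ENNReal.lintegral_mul_le_Lp_mul_Lq μ Real.HolderConjugate.two_two hf hg
  simp only [Pi.mul_apply, ENNReal.rpow_two] at h
  calc (∫⁻ x, f x * g x ∂μ) ^ 2
      ≤ ((∫⁻ x, f x ^ 2 ∂μ) ^ (1 / 2 : ℝ) * (∫⁻ x, g x ^ 2 ∂μ) ^ (1 / 2 : ℝ)) ^ 2 := by gcongr
    _ = _ := by
      rw [mul_pow, ← ENNReal.rpow_natCast, ← ENNReal.rpow_natCast, ← ENNReal.rpow_mul,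
        ← ENNReal.rpow_mul]
      norm_num

theorem lintegral_fourierInv_sq (f : 𝓢(Spacetime n, ℂ)) :
    ∫⁻ ξ, ‖𝓕⁻ f ξ‖ₑ ^ 2 = ∫⁻ x, ‖f x‖ₑ ^ 2 := by
  have key : ∀ g : 𝓢(Spacetime n, ℂ), ∫⁻ x, ‖g x‖ₑ ^ 2 = ENNReal.ofReal (∫ x, ‖g x‖ ^ 2) := by
    intro g
    rw [ofReal_integral_eq_lintegral_ofReal]
    · refine lintegral_congr fun x => ?_
      rw [ENNReal.ofReal_pow (norm_nonneg _), ofReal_norm]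
    · exact (memLp_two_iff_integrable_sq_norm (g.memLp 2).aestronglyMeasurable).1 (g.memLp 2)
    · exact .of_forall fun x => by positivity
  rw [key, key, ← SchwartzMap.integral_norm_sq_fourier (𝓕⁻ f), FourierTransform.fourier_fourierInv_eq]

/-- Weighted Young inequality: Cauchy–Schwarz in the convolution on the Fourier side. -/
theorem lintegral_mul_sq_le_of_weights {m₁ m₂ : Spacetime n → ℝ≥0∞} (h₁ : Measurable m₁)
    (h₂ : Measurable m₂) (h₁0 : ∀ ξ, m₁ ξ ≠ 0) (h₁t : ∀ ξ, m₁ ξ ≠ ⊤) (h₂0 : ∀ ξ, m₂ ξ ≠ 0)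
    (h₂t : ∀ ξ, m₂ ξ ≠ ⊤) {K : ℝ≥0∞}
    (hK : ∀ x, ∫⁻ t, ((m₁ t)⁻¹ * (m₂ (x - t))⁻¹) ^ 2 ≤ K) (f g : 𝓢(Spacetime n, ℂ)) :
    ∫⁻ x, ‖f x * g x‖ₑ ^ 2 ≤
      K * (∫⁻ ξ, (m₁ ξ * ‖𝓕⁻ f ξ‖ₑ) ^ 2) * ∫⁻ ξ, (m₂ ξ * ‖𝓕⁻ g ξ‖ₑ) ^ 2 := by
  set F := 𝓕⁻ f
  set G := 𝓕⁻ g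
  let B : ℂ →L[ℂ] ℂ →L[ℂ] ℂ := ContinuousLinearMap.mul ℂ ℂ
  have hconv : ∀ x, f x * g x = 𝓕 (SchwartzMap.convolution B F G) x := by
    intro x
    rw [SchwartzMap.fourier_convolution, SchwartzMap.pairing_apply_apply]
    simp [B, F, G]
  have hF : Measurable fun x => ‖F x‖ₑ := F.continuous.enorm.measurable
  have hG : Measurable fun x => ‖G x‖ₑ := G.continuous.enorm.measurable
  have hmeas : Measurable fun p : Spacetime n × Spacetime n =>
      ((m₁ p.2 * ‖F p.2‖ₑ) * (m₂ (p.1 - p.2) * ‖G (p.1 - p.2)‖ₑ)) ^ 2 := by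
    have hs : Measurable fun p : Spacetime n × Spacetime n => p.1 - p.2 :=
      measurable_fst.sub measurable_snd
    exact (((h₁.comp measurable_snd).mul (hF.comp measurable_snd)).mul
      ((h₂.comp hs).mul (hG.comp hs))).pow_const 2
  calc ∫⁻ x, ‖f x * g x‖ₑ ^ 2
      = ∫⁻ x, ‖SchwartzMap.convolution B F G x‖ₑ ^ 2 := by
        rw [lintegral_congr fun x => by rw [hconv x],
          ← lintegral_fourierInv_sq (𝓕 (SchwartzMap.convolution B F G)),
          FourierTransform.fourierInv_fourier_eq]
    _ ≤ ∫⁻ x, K * ∫⁻ t, ((m₁ t * ‖F t‖ₑ) * (m₂ (x - t) * ‖G (x - t)‖ₑ)) ^ 2 := by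
        refine lintegral_mono fun x => ?_
        have h1 : ‖SchwartzMap.convolution B F G x‖ₑ ≤ ∫⁻ t, ((m₁ t)⁻¹ * (m₂ (x - t))⁻¹) *
            ((m₁ t * ‖F t‖ₑ) * (m₂ (x - t) * ‖G (x - t)‖ₑ)) := by
          rw [SchwartzMap.convolution_apply, MeasureTheory.convolution]
          refine (enorm_integral_le_lintegral_enorm _).trans (lintegral_mono fun t => ?_)
          simp only [B, ContinuousLinearMap.mul_apply', enorm_mul]
          rw [show (m₁ t)⁻¹ * (m₂ (x - t))⁻¹ * (m₁ t * ‖F t‖ₑ * (m₂ (x - t) * ‖G (x - t)‖ₑ)) =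
            ((m₁ t)⁻¹ * m₁ t) * ((m₂ (x - t))⁻¹ * m₂ (x - t)) * (‖F t‖ₑ * ‖G (x - t)‖ₑ) by ring,
            ENNReal.inv_mul_cancel (h₁0 t) (h₁t t), ENNReal.inv_mul_cancel (h₂0 _) (h₂t _)]
          simp
        have hs : Measurable fun t : Spacetime n => x - t := measurable_const.sub measurable_id
        calc _ ≤ (∫⁻ t, ((m₁ t)⁻¹ * (m₂ (x - t))⁻¹) *
            ((m₁ t * ‖F t‖ₑ) * (m₂ (x - t) * ‖G (x - t)‖ₑ))) ^ 2 := by gcongr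
          _ ≤ (∫⁻ t, ((m₁ t)⁻¹ * (m₂ (x - t))⁻¹) ^ 2) * _ := by
            refine sq_lintegral_mul_le ?_ ?_
            · exact (h₁.inv.mul (h₂.comp hs).inv).aemeasurable
            · exact ((h₁.mul hF).mul ((h₂.comp hs).mul (hG.comp hs))).aemeasurable
          _ ≤ _ := by gcongr; exact hK x
    _ = K * ∫⁻ x, ∫⁻ t, ((m₁ t * ‖F t‖ₑ) * (m₂ (x - t) * ‖G (x - t)‖ₑ)) ^ 2 :=
        lintegral_const_mul _ hmeas.lintegral_prod_right'
    _ = K * ∫⁻ t, ∫⁻ x, ((m₁ t * ‖F t‖ₑ) * (m₂ (x - t) * ‖G (x - t)‖ₑ)) ^ 2 := by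
        rw [lintegral_lintegral_swap hmeas.aemeasurable]
    _ = K * ∫⁻ t, (m₁ t * ‖F t‖ₑ) ^ 2 * ∫⁻ ξ, (m₂ ξ * ‖G ξ‖ₑ) ^ 2 := by
        congr 1
        refine lintegral_congr fun t => ?_
        simp only [mul_pow _ (m₂ _ * _)]
        rw [lintegral_const_mul]
        · congr 1
          exact lintegral_sub_right_eq_self (fun ξ => (m₂ ξ * ‖G ξ‖ₑ) ^ 2) t
        · have hs : Measurable fun x : Spacetime n => x - t := measurable_id.sub measurable_const
          exact ((h₂.comp hs).mul (hG.comp hs)).pow_const 2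
    _ = _ := by
        rw [lintegral_mul_const _ (show Measurable fun t => (m₁ t * ‖F t‖ₑ) ^ 2 from
          (h₁.mul hF).pow_const 2), mul_assoc]

theorem lintegral_spacetime (h : (Fin n → ℝ) → ℝ → ℝ≥0∞) (hh : Measurable (Function.uncurry h)) :
    ∫⁻ Z : Spacetime n, h (fun j => Z j.castSucc) (Z (Fin.last n)) = ∫⁻ y, ∫⁻ τ, h y τ := by
  have e1 := PiLp.volume_preserving_ofLp (Fin (n + 1))
  have e2 := volume_preserving_piFinSuccAbove (fun _ : Fin (n + 1) => ℝ) (Fin.last n)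
  have hsw : Measurable fun p : ℝ × (Fin n → ℝ) => h p.2 p.1 := hh.comp measurable_swap
  have := (e2.comp e1).lintegral_comp hsw
  have h3 : ∀ Z : Spacetime n, h (fun j => Z j.castSucc) (Z (Fin.last n)) =
      (fun p : ℝ × (Fin n → ℝ) => h p.2 p.1)
        ((MeasurableEquiv.piFinSuccAbove (fun _ : Fin (n + 1) => ℝ) (Fin.last n) ∘ WithLp.ofLp) Z) := by
    intro Z
    simp [MeasurableEquiv.piFinSuccAbove, Fin.insertNthEquiv]
    rfl
  simp only [h3, this]
  rw [Measure.volume_eq_prod, lintegral_prod_symm _ hsw.aemeasurable]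

/-- The squared length of the spatial part. -/
def spSq (Z : Spacetime n) : ℝ := ∑ j : Fin n, Z j.castSucc ^ 2

theorem spSq_nonneg (Z : Spacetime n) : 0 ≤ spSq Z := Finset.sum_nonneg fun _ _ => sq_nonneg _

theorem lintegral_time_le {A : ℝ} (hA : 1 ≤ A) {b : ℕ} (hb : 2 ≤ b) :
    ∫⁻ τ : ℝ, ENNReal.ofReal ((A ^ b + A ^ (b - 2) * τ ^ 2)⁻¹) =
      ENNReal.ofReal (Real.pi * (A ^ (b - 1))⁻¹) := by
  have hA0 : A ≠ 0 := by positivity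
  have h1 : ∀ τ : ℝ, (A ^ b + A ^ (b - 2) * τ ^ 2)⁻¹ = (A ^ b)⁻¹ * (1 + (τ / A) ^ 2)⁻¹ := by
    intro τ
    obtain ⟨b, rfl⟩ := Nat.exists_eq_add_of_le hb
    rw [← mul_inv]
    congr 1
    simp only [Nat.add_sub_cancel_left, pow_add]
    field_simp
  simp only [h1]
  rw [← ofReal_integral_eq_lintegral_ofReal]
  · rw [integral_const_mul, Measure.integral_comp_div (fun x : ℝ => (1 + x ^ 2)⁻¹) A,
      integral_univ_inv_one_add_sq, abs_of_pos (by positivity), smul_eq_mul]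
    congr 1
    obtain ⟨b, rfl⟩ := Nat.exists_eq_add_of_le (show 1 ≤ b by omega)
    simp only [Nat.add_sub_cancel_left, pow_add]
    field_simp
  · exact (integrable_inv_one_add_sq.comp_div hA0).const_mul _
  · exact .of_forall fun τ => by positivity

theorem inv_mul_inv_le_add {X Y : ℝ} (hX : 1 ≤ X) (hY : 1 ≤ Y) (a b : ℕ) :
    (X ^ a)⁻¹ * (Y ^ b)⁻¹ ≤ (X ^ (a + b))⁻¹ + (Y ^ (a + b))⁻¹ := by
  have hX0 : 0 < X := by linarith
  have hY0 : 0 < Y := by linarith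
  rcases le_total X Y with h | h
  · have : (X ^ a)⁻¹ * (Y ^ b)⁻¹ ≤ (X ^ (a + b))⁻¹ := by
      rw [pow_add, mul_inv]; gcongr
    have h2 : 0 ≤ (Y ^ (a + b))⁻¹ := by positivity
    linarith
  · have : (X ^ a)⁻¹ * (Y ^ b)⁻¹ ≤ (Y ^ (a + b))⁻¹ := by
      rw [pow_add, mul_inv]; gcongr
    have h2 : 0 ≤ (X ^ (a + b))⁻¹ := by positivity
    linarith

theorem lintegral_bracket_lt_top {s : ℕ} (hs : n < 2 * s) :
    ∫⁻ y : Fin n → ℝ, ENNReal.ofReal (((1 + ∑ j, y j ^ 2) ^ s)⁻¹) < ⊤ := by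
  have h := integrable_rpow_neg_one_add_norm_sq (E := EuclideanSpace ℝ (Fin n)) (r := 2 * s)
    (μ := volume) (by simpa using (by exact_mod_cast hs : (n : ℝ) < 2 * s))
  have h2 := h.lintegral_lt_top
  rw [← (PiLp.volume_preserving_toLp (Fin n)).lintegral_comp (by fun_prop)] at h2
  refine lt_of_eq_of_lt (lintegral_congr fun y => ?_) h2
  congr 1
  rw [EuclideanSpace.norm_sq_eq]
  have : (0 : ℝ) ≤ 1 + ∑ j, y j ^ 2 := by positivity
  rw [show -(2 * (s : ℝ)) / 2 = -(s : ℝ) by ring, Real.rpow_neg (by simpa using this), Real.rpow_natCast]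
  simp

/-- The constant in the Cauchy–Schwarz argument. The integral over the time frequency turns the exponent
`b` of the second weight into `b - 1`, and a product of negative powers of two brackets is
at most the sum of the total powers. -/
theorem exists_weight_bound {a b : ℕ} (hb : 2 ≤ b) (hab : n < 2 * (a + (b - 1))) :
    ∃ K : ℝ≥0, ∀ x : Spacetime n,
      ∫⁻ t, ENNReal.ofReal ((((1 + spSq t) ^ a)⁻¹) *
        ((1 + spSq (x - t)) ^ b + (1 + spSq (x - t)) ^ (b - 2) * (x - t) (Fin.last n) ^ 2)⁻¹) ≤
      K := by
  have hI := lintegral_bracket_lt_top (n := n) hab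
  set I := ∫⁻ y : Fin n → ℝ, ENNReal.ofReal (((1 + ∑ j, y j ^ 2) ^ (a + (b - 1)))⁻¹) with hIdef
  have hK : ENNReal.ofReal Real.pi * (I + I) ≠ ⊤ := by finiteness
  refine ⟨(ENNReal.ofReal Real.pi * (I + I)).toNNReal, fun x => ?_⟩
  rw [ENNReal.coe_toNNReal hK]
  let x' : Fin n → ℝ := fun j => x j.castSucc
  have h1 := lintegral_spacetime (n := n) (fun y τ => ENNReal.ofReal (((1 + ∑ j, y j ^ 2) ^ a)⁻¹ *
    ((1 + ∑ j, (x' j - y j) ^ 2) ^ b + (1 + ∑ j, (x' j - y j) ^ 2) ^ (b - 2) *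
      (x (Fin.last n) - τ) ^ 2)⁻¹)) (by unfold Function.uncurry; fun_prop)
  refine (le_of_eq ?_).trans (h1.le.trans ?_)
  · rfl
  calc _ = ∫⁻ y : Fin n → ℝ, ENNReal.ofReal ((((1 + ∑ j, y j ^ 2) ^ a)⁻¹) *
        (Real.pi * ((1 + ∑ j, (x' j - y j) ^ 2) ^ (b - 1))⁻¹)) := by
        refine lintegral_congr fun y => ?_
        have hp : (0 : ℝ) ≤ ((1 + ∑ j, y j ^ 2) ^ a)⁻¹ := by positivity
        simp only [ENNReal.ofReal_mul hp]
        rw [lintegral_const_mul _ (by fun_prop)]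
        congr 1
        rw [lintegral_sub_left_eq_self (fun τ => ENNReal.ofReal
          (((1 + ∑ j, (x' j - y j) ^ 2) ^ b + (1 + ∑ j, (x' j - y j) ^ 2) ^ (b - 2) * τ ^ 2)⁻¹))]
        refine lintegral_time_le ?_ hb
        have : (0 : ℝ) ≤ ∑ j, (x' j - y j) ^ 2 := by positivity
        linarith
    _ ≤ ∫⁻ y : Fin n → ℝ, ENNReal.ofReal Real.pi *
        (ENNReal.ofReal (((1 + ∑ j, y j ^ 2) ^ (a + (b - 1)))⁻¹) +
          ENNReal.ofReal (((1 + ∑ j, (x' j - y j) ^ 2) ^ (a + (b - 1)))⁻¹)) := by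
        refine lintegral_mono fun y => ?_
        rw [← ENNReal.ofReal_add (by positivity) (by positivity),
          ← ENNReal.ofReal_mul Real.pi_pos.le]
        refine ENNReal.ofReal_le_ofReal ?_
        have h1 : (0 : ℝ) ≤ ∑ j, (x' j - y j) ^ 2 := by positivity
        have h2 : (0 : ℝ) ≤ ∑ j, y j ^ 2 := by positivity
        have := inv_mul_inv_le_add (X := 1 + ∑ j, y j ^ 2) (Y := 1 + ∑ j, (x' j - y j) ^ 2)
          (by linarith) (by linarith) a (b - 1)
        nlinarith [Real.pi_pos]
    _ = _ := by
        rw [lintegral_const_mul _ (by fun_prop), lintegral_add_left (by fun_prop)]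
        congr 2
        exact lintegral_sub_left_eq_self (fun y : Fin n → ℝ =>
          ENNReal.ofReal (((1 + ∑ j, y j ^ 2) ^ (a + (b - 1)))⁻¹)) x'

end ModuleRegularity

end

noncomputable section

namespace ModuleRegularity

open scoped ContDiff LineDeriv FourierTransform

variable {n : ℕ}

/-- The anisotropic weights of the partial derivatives: the time derivative counts twice. -/
def pdOrder (a : Fin (n + 1)) : ℕ := if a = Fin.last n then 2 else 1

theorem one_le_pdOrder (a : Fin (n + 1)) : 1 ≤ pdOrder a := by
  unfold pdOrder; split_ifs <;> simp

/-- The `L²` norm of a test function. -/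
def l2Norm (f : Test n) : ℝ≥0∞ := eLpNorm f.1 2 volume

theorem eLpNorm_two_sq {α : Type*} [MeasurableSpace α] {μ : Measure α} (f : α → ℂ) :
    eLpNorm f 2 μ ^ 2 = ∫⁻ x, ‖f x‖ₑ ^ 2 ∂μ := by
  have := eLpNorm_nnreal_pow_eq_lintegral (f := f) (μ := μ) (p := 2) (by simp)
  simpa using this

theorem isGauge_eLpNorm {μ : Measure (Spacetime n)} (a : Smooth n) :
    IsGauge fun f : Test n => eLpNorm (fun Z => a.1 Z * f.1 Z) 2 μ where
  add_le f g := by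
    have h : (fun Z => a.1 Z * (f + g).1 Z) =
        (fun Z => a.1 Z * f.1 Z) + fun Z => a.1 Z * g.1 Z := by
      ext Z; simp [mul_add]
    rw [h]
    exact eLpNorm_add_le (a.2.continuous.mul f.continuous).aestronglyMeasurable
      (a.2.continuous.mul g.continuous).aestronglyMeasurable (by norm_num)
  smul_le c f := by
    have h : (fun Z => a.1 Z * (c • f).1 Z) = c • fun Z => a.1 Z * f.1 Z := by
      ext Z; simp [mul_left_comm]
    rw [h, eLpNorm_const_smul]

theorem isGauge_l2Norm : IsGauge (l2Norm (n := n)) := by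
  have := isGauge_eLpNorm (n := n) (μ := volume) ⟨fun _ => 1, contDiff_const⟩
  simp only [one_mul] at this
  exact this

theorem enorm_fourierInv_pd (a : Fin (n + 1)) (F : Test n) (ξ : Spacetime n) :
    ENNReal.ofReal (ξ a ^ 2) * ‖𝓕⁻ (toSchw F) ξ‖ₑ ^ 2 ≤ ‖𝓕⁻ (toSchw (pd a F)) ξ‖ₑ ^ 2 := by
  have ht : (fun x : Spacetime n => inner ℝ x (unitVec a)).HasTemperateGrowth := by fun_prop
  rw [toSchw_pd, SchwartzMap.fourierInv_lineDerivOp_eq, smul_apply,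
    SchwartzMap.smulLeftCLM_apply_apply ht]
  have h1 : inner ℝ ξ (unitVec a) = ξ a := by
    simp [unitVec, EuclideanSpace.inner_single_right]
  have h2 : ‖-(2 * (Real.pi : ℂ) * Complex.I) • (inner ℝ ξ (unitVec a)) • 𝓕⁻ (toSchw F) ξ‖ =
      2 * Real.pi * (|ξ a| * ‖𝓕⁻ (toSchw F) ξ‖) := by
    rw [h1, norm_smul, norm_smul]
    simp [abs_of_pos Real.pi_pos]
  rw [← ofReal_norm, ← ofReal_norm, h2, ← ENNReal.ofReal_pow (by positivity),
    ← ENNReal.ofReal_pow (by positivity), ← ENNReal.ofReal_mul (by positivity)]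
  refine ENNReal.ofReal_le_ofReal ?_
  have h3 : (1 : ℝ) ≤ (2 * Real.pi) ^ 2 := by nlinarith [Real.pi_gt_three]
  rw [mul_pow (2 * Real.pi), mul_pow |ξ a|, sq_abs]
  exact le_mul_of_one_le_left (by positivity) h3

/-- The squared spatial Sobolev norm of order `a`, on the Fourier side. -/
def sobSq (a : ℕ) (F : Test n) : ℝ≥0∞ :=
  ∫⁻ ξ, ENNReal.ofReal ((1 + spSq ξ) ^ a) * ‖𝓕⁻ (toSchw F) ξ‖ₑ ^ 2

theorem continuous_spSq : Continuous (spSq (n := n)) := by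
  unfold spSq; fun_prop

theorem measurable_enorm_fourierInv (F : Test n) :
    Measurable fun ξ => ‖𝓕⁻ (toSchw F) ξ‖ₑ :=
  (𝓕⁻ (toSchw F)).continuous.enorm.measurable

theorem sobSq_succ_le (a : ℕ) (F : Test n) :
    sobSq (a + 1) F ≤ sobSq a F + ∑ j : Fin n, sobSq a (pd j.castSucc F) := by
  have hc := continuous_spSq (n := n)
  have hm : ∀ F : Test n, Measurable fun ξ =>
      ENNReal.ofReal ((1 + spSq ξ) ^ a) * ‖𝓕⁻ (toSchw F) ξ‖ₑ ^ 2 := fun F =>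
    (ENNReal.measurable_ofReal.comp ((continuous_const.add hc).pow a).measurable).mul
      ((measurable_enorm_fourierInv F).pow_const 2)
  unfold sobSq
  rw [← lintegral_finsetSum _ fun j _ => hm _, ← lintegral_add_left (hm F)]
  refine lintegral_mono fun ξ => ?_
  have h0 := spSq_nonneg ξ
  have h1 : ENNReal.ofReal ((1 + spSq ξ) ^ (a + 1)) = ENNReal.ofReal ((1 + spSq ξ) ^ a) +
      ∑ j : Fin n, ENNReal.ofReal ((1 + spSq ξ) ^ a) * ENNReal.ofReal (ξ j.castSucc ^ 2) := by
    rw [← Finset.mul_sum, ← ENNReal.ofReal_sum_of_nonneg fun _ _ => sq_nonneg _,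
      ← ENNReal.ofReal_mul (by positivity), ← ENNReal.ofReal_add (by positivity) (by positivity),
      pow_succ, mul_add, mul_one]
    rfl
  rw [h1, add_mul, Finset.sum_mul]
  refine add_le_add le_rfl (Finset.sum_le_sum fun j _ => ?_)
  rw [mul_assoc]
  exact mul_le_mul_right (enorm_fourierInv_pd _ F ξ) _

theorem sobSq_zero (F : Test n) : sobSq 0 F = l2Norm F ^ 2 := by
  simp only [sobSq, pow_zero, ENNReal.ofReal_one, one_mul]
  rw [lintegral_fourierInv_sq, l2Norm, eLpNorm_two_sq]
  rfl

/-- The anisotropic Sobolev norm of order `a`. -/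
abbrev sobNorm (a : ℕ) (F : Test n) : ℝ≥0∞ := wnorm pdOrder (fun i => pd i) l2Norm a F

theorem sobNorm_pd_le {a b : ℕ} (i : Fin (n + 1)) (h : a + pdOrder i ≤ b) :
    ∃ C : ℝ≥0, ∀ F : Test n, sobNorm a (pd i F) ≤ C * sobNorm b F :=
  ⟨_, fun F => wnorm_act_le one_le_pdOrder (fun i => pd i) l2Norm (w := [i]) (by simpa using h) F⟩

theorem sobSq_le (a : ℕ) : ∃ C : ℝ≥0, ∀ F : Test n, sobSq a F ≤ C * sobNorm a F ^ 2 := by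
  induction a with
  | zero =>
    refine ⟨1, fun F => ?_⟩
    rw [sobSq_zero, ENNReal.coe_one, one_mul]
    gcongr
    exact le_wnorm one_le_pdOrder _ _ (w := []) (by simp) F
  | succ a ih =>
    obtain ⟨C, hC⟩ := ih
    choose K hK using fun j : Fin n => sobNorm_pd_le (a := a) (b := a + 1) j.castSucc
      (by simp [pdOrder, (Fin.castSucc_lt_last j).ne])
    refine ⟨C + ∑ j, C * K j ^ 2, fun F => (sobSq_succ_le a F).trans ?_⟩
    rw [ENNReal.coe_add, ENNReal.ofNNReal_finsetSum, add_mul, Finset.sum_mul]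
    gcongr with j
    · refine (hC F).trans ?_
      gcongr
      exact wnorm_mono one_le_pdOrder _ _ (Nat.le_succ a) F
    · refine (hC _).trans ?_
      push_cast
      rw [mul_assoc, ← mul_pow]
      gcongr
      exact hK j F

/-- Sobolev multiplication `H^a × H^b → L²`, anisotropic with the time derivative counting twice.
The time frequency is integrated against the weight of the second factor alone, at the cost of one
of its `b` derivatives; this is why only `b ≥ 2` and `a + b - 1 > n / 2` is required. -/
theorem l2Norm_mul_le {a b : ℕ} (hb : 2 ≤ b) (hab : n < 2 * (a + (b - 1))) :
    ∃ C : ℝ≥0, ∀ F G : Test n, l2Norm (F.mul G) ≤ C * sobNorm a F * sobNorm b G := by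
  obtain ⟨K, hK⟩ := exists_weight_bound (n := n) hb hab
  obtain ⟨C₁, h₁⟩ := sobSq_le (n := n) a
  obtain ⟨C₂, h₂⟩ := sobSq_le (n := n) b
  obtain ⟨C₃, h₃⟩ := sobSq_le (n := n) (b - 2)
  obtain ⟨C₄, h₄⟩ := sobNorm_pd_le (n := n) (a := b - 2) (b := b) (Fin.last n)
    (by simp [pdOrder]; omega)
  have hc := continuous_spSq (n := n)
  let w₁ : Spacetime n → ℝ := fun ξ => (1 + spSq ξ) ^ a
  -- `b` derivatives in space, or `b - 2` in space and one in time
  let w₂ : Spacetime n → ℝ := fun ξ =>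
    (1 + spSq ξ) ^ b + (1 + spSq ξ) ^ (b - 2) * ξ (Fin.last n) ^ 2
  have hw₁ : ∀ ξ, 0 < w₁ ξ := fun ξ => by have := spSq_nonneg ξ; positivity
  have hw₂ : ∀ ξ, 0 < w₂ ξ := fun ξ => by have := spSq_nonneg ξ; positivity
  have hw₁c : Continuous w₁ := by fun_prop
  have hw₂c : Continuous w₂ := by fun_prop
  have hsq : ∀ {x : ℝ}, 0 < x → ENNReal.ofReal √x ^ 2 = ENNReal.ofReal x := fun hx => by
    rw [← ENNReal.ofReal_pow (Real.sqrt_nonneg _), Real.sq_sqrt hx.le]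
  have hne : ∀ {x : ℝ}, 0 < x → ENNReal.ofReal √x ≠ 0 := fun hx => by
    simpa using Real.sqrt_pos.2 hx
  have main := lintegral_mul_sq_le_of_weights (n := n) (m₁ := fun ξ => ENNReal.ofReal √(w₁ ξ))
    (m₂ := fun ξ => ENNReal.ofReal √(w₂ ξ)) (by fun_prop) (by fun_prop) (fun ξ => hne (hw₁ ξ))
    (fun _ => ENNReal.ofReal_ne_top) (fun ξ => hne (hw₂ ξ)) (fun _ => ENNReal.ofReal_ne_top)
    (K := K) (fun x => by
      refine le_of_eq_of_le (lintegral_congr fun t => ?_) (hK x)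
      rw [mul_pow, ← ENNReal.inv_pow, ← ENNReal.inv_pow, hsq (hw₁ _), hsq (hw₂ _),
        ← ENNReal.ofReal_inv_of_pos (hw₁ _), ← ENNReal.ofReal_inv_of_pos (hw₂ _),
        ← ENNReal.ofReal_mul (by have := hw₁ t; positivity)])
  have e₁ : ∀ F : Test n, ∫⁻ ξ, (ENNReal.ofReal √(w₁ ξ) * ‖𝓕⁻ (toSchw F) ξ‖ₑ) ^ 2 ≤
      C₁ * sobNorm a F ^ 2 := fun F => by
    refine le_of_eq_of_le (lintegral_congr fun ξ => ?_) (h₁ F)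
    rw [mul_pow, hsq (hw₁ ξ)]
  have e₂ : ∀ G : Test n, ∫⁻ ξ, (ENNReal.ofReal √(w₂ ξ) * ‖𝓕⁻ (toSchw G) ξ‖ₑ) ^ 2 ≤
      (C₂ + C₃ * C₄ ^ 2) * sobNorm b G ^ 2 := fun G => by
    calc _ ≤ sobSq b G + sobSq (b - 2) (pd (Fin.last n) G) := by
          unfold sobSq
          rw [← lintegral_add_left (show Measurable fun ξ =>
            ENNReal.ofReal ((1 + spSq ξ) ^ b) * ‖𝓕⁻ (toSchw G) ξ‖ₑ ^ 2 from
            (ENNReal.measurable_ofReal.comp ((continuous_const.add hc).pow b).measurable).mul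
            ((measurable_enorm_fourierInv G).pow_const 2))]
          refine lintegral_mono fun ξ => ?_
          have := spSq_nonneg ξ
          rw [mul_pow, hsq (hw₂ ξ), ENNReal.ofReal_add (by positivity) (by positivity), add_mul,
            ENNReal.ofReal_mul (by positivity), mul_assoc]
          gcongr
          exact enorm_fourierInv_pd _ G ξ
      _ ≤ _ := by
          rw [add_mul, mul_assoc, ← mul_pow]
          gcongr
          · exact h₂ G
          · refine (h₃ _).trans ?_
            gcongr
            exact h₄ G
  refine ⟨NNReal.sqrt (K * C₁ * (C₂ + C₃ * C₄ ^ 2)), fun F G => ?_⟩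
  refine (ENNReal.pow_le_pow_left_iff (n := 2) two_ne_zero).1 ?_
  rw [l2Norm, eLpNorm_two_sq, mul_pow, mul_pow, ← ENNReal.coe_pow, NNReal.sq_sqrt]
  refine (main (toSchw F) (toSchw G)).trans ?_
  refine (mul_le_mul' (mul_le_mul' le_rfl (e₁ F)) (e₂ G)).trans (le_of_eq ?_)
  push_cast
  ring

end ModuleRegularity

end

noncomputable section

namespace ModuleRegularity

open scoped ContDiff

variable {n : ℕ}

/-! ### Geometry of the lens map -/

/-- The time coordinate, real-valued. -/
def time (X : Spacetime n) : ℝ := X (Fin.last n)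

/-- The time coordinate as a functional. -/
def timeL : Spacetime n →L[ℝ] ℝ := EuclideanSpace.proj (Fin.last n)

@[simp] theorem timeL_apply (X : Spacetime n) : timeL X = time X := rfl

@[fun_prop]
theorem contDiff_time {m : WithTop ℕ∞} : ContDiff ℝ m (time (n := n)) := (timeL (n := n)).contDiff

theorem hasFDerivAt_time (X : Spacetime n) : HasFDerivAt time (timeL (n := n)) X :=
  (timeL (n := n)).hasFDerivAt

/-- The unit vector in the time direction. -/
def eT : Spacetime n := unitVec (Fin.last n)

@[simp] theorem time_eT : time (eT : Spacetime n) = 1 := by simp [time, eT, unitVec_apply]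

theorem time_add (X Y : Spacetime n) : time (X + Y) = time X + time Y := rfl

theorem time_sub (X Y : Spacetime n) : time (X - Y) = time X - time Y := rfl

theorem time_smul (a : ℝ) (X : Spacetime n) : time (a • X) = a * time X := rfl

@[simp] theorem eT_castSucc (j : Fin n) : (eT : Spacetime n) j.castSucc = 0 := by
  simp [eT, unitVec_apply, (Fin.castSucc_lt_last j).ne]

theorem norm_sq_eq_spSq_add (X : Spacetime n) : ‖X‖ ^ 2 = spSq X + time X ^ 2 := by
  rw [EuclideanSpace.norm_sq_eq, Fin.sum_univ_castSucc]
  simp [spSq, time]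

/-- The lens map `(y, s) ↦ (cosh s · y, sinh s)`. -/
def lensMap (X : Spacetime n) : Spacetime n :=
  Real.cosh (time X) • X + (Real.sinh (time X) - time X * Real.cosh (time X)) • eT

theorem time_lensMap (X : Spacetime n) : time (lensMap X) = Real.sinh (time X) := by
  simp only [lensMap, time_add, time_smul, time_eT]; ring

theorem lensMap_castSucc (X : Spacetime n) (j : Fin n) :
    lensMap X j.castSucc = Real.cosh (time X) * X j.castSucc := by
  simp [lensMap]

theorem spSq_lensMap (X : Spacetime n) :
    spSq (lensMap X) = Real.cosh (time X) ^ 2 * spSq X := by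
  simp only [spSq, lensMap_castSucc, mul_pow, Finset.mul_sum]

/-- The lens map turns the bracket into a product. -/
theorem one_add_norm_sq_lensMap (X : Spacetime n) :
    1 + ‖lensMap X‖ ^ 2 = Real.cosh (time X) ^ 2 * (1 + spSq X) := by
  rw [norm_sq_eq_spSq_add, spSq_lensMap, time_lensMap, Real.cosh_sq]; ring

theorem norm_le_norm_lensMap (X : Spacetime n) : ‖X‖ ≤ ‖lensMap X‖ := by
  refine (sq_le_sq₀ (norm_nonneg _) (norm_nonneg _)).1 ?_
  rw [norm_sq_eq_spSq_add, norm_sq_eq_spSq_add, spSq_lensMap, time_lensMap]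
  have h1 := spSq_nonneg X
  have h2 : 1 ≤ Real.cosh (time X) ^ 2 := one_le_pow₀ (Real.one_le_cosh _)
  have h3 : time X ^ 2 ≤ Real.sinh (time X) ^ 2 := by
    rw [sq_le_sq]
    rcases le_total 0 (time X) with h | h
    · rw [abs_of_nonneg h, abs_of_nonneg (Real.sinh_nonneg_iff.2 h)]
      exact Real.self_le_sinh_iff.2 h
    · rw [abs_of_nonpos h, abs_of_nonpos (Real.sinh_nonpos_iff.2 h)]
      linarith [Real.sinh_le_self_iff.2 h]
  nlinarith

theorem lensMap_injective : Function.Injective (lensMap (n := n)) := by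
  intro X Y h
  have h1 : time X = time Y := Real.sinh_injective (by rw [← time_lensMap, h, time_lensMap])
  simp only [lensMap, h1, add_left_inj] at h
  exact smul_right_injective _ (Real.cosh_pos _).ne' h

theorem lensMap_surjective : Function.Surjective (lensMap (n := n)) := by
  intro Z
  have hc := (Real.cosh_pos (Real.arsinh (time Z))).ne'
  refine ⟨(Real.cosh (Real.arsinh (time Z)))⁻¹ • (Z - time Z • eT) + Real.arsinh (time Z) • eT, ?_⟩
  have ht : time ((Real.cosh (Real.arsinh (time Z)))⁻¹ • (Z - time Z • eT) +
      Real.arsinh (time Z) • eT) = Real.arsinh (time Z) := by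
    simp [time_add, time_smul, time_sub]
  rw [lensMap, ht, smul_add, smul_smul, mul_inv_cancel₀ hc, Real.sinh_arsinh]
  module

theorem contDiff_lensMap : ContDiff ℝ ∞ (lensMap (n := n)) := by
  unfold lensMap
  have := contDiff_time (n := n) (m := ∞)
  fun_prop

/-- The derivative of the lens map: a homothety after a transvection. -/
theorem hasFDerivAt_lensMap (X : Spacetime n) :
    HasFDerivAt lensMap (Real.cosh (time X) • ContinuousLinearMap.id ℝ (Spacetime n) +
      timeL.smulRight (Real.sinh (time X) • (X - time X • eT))) X := by
  have ht := hasFDerivAt_time X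
  have h := (ht.cosh.smul (hasFDerivAt_id X)).add
    ((ht.sinh.sub (ht.mul ht.cosh)).smul (hasFDerivAt_const eT X))
  refine h.congr_fderiv ?_
  ext1 v
  simp
  module

theorem det_lensMap (X : Spacetime n) :
    (Real.cosh (time X) • ContinuousLinearMap.id ℝ (Spacetime n) +
      timeL.smulRight (Real.sinh (time X) • (X - time X • eT))).det =
      Real.cosh (time X) ^ (n + 1) := by
  have hc := (Real.cosh_pos (time X)).ne'
  have h : ((Real.cosh (time X) • ContinuousLinearMap.id ℝ (Spacetime n) +
      timeL.smulRight (Real.sinh (time X) • (X - time X • eT)) :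
        Spacetime n →L[ℝ] Spacetime n) : Spacetime n →ₗ[ℝ] Spacetime n) =
      Real.cosh (time X) • LinearMap.transvection (timeL (n := n)).toLinearMap
        ((Real.cosh (time X))⁻¹ • (Real.sinh (time X) • (X - time X • eT))) := by
    ext1 v
    simp only [LinearMap.smul_apply, LinearMap.transvection.apply]
    simp [smul_add, smul_smul]
    congr 1
    field_simp
  rw [ContinuousLinearMap.det, h, LinearMap.det_smul, LinearMap.transvection.det]
  simp [time_smul, time_sub]

theorem lintegral_lensMap (g : Spacetime n → ℝ≥0∞) :
    ∫⁻ Z, g Z = ∫⁻ X, ENNReal.ofReal (Real.cosh (time X) ^ (n + 1)) * g (lensMap X) := by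
  have h := lintegral_image_eq_lintegral_abs_det_fderiv_mul volume MeasurableSet.univ
    (fun X _ => (hasFDerivAt_lensMap (n := n) X).hasFDerivWithinAt) lensMap_injective.injOn g
  rw [Set.image_univ, lensMap_surjective.range_eq, setLIntegral_univ, setLIntegral_univ] at h
  rw [h]
  refine lintegral_congr fun X => ?_
  rw [det_lensMap, abs_of_nonneg (by have := Real.cosh_pos (time X); positivity)]

end ModuleRegularity

end

noncomputable section

namespace ModuleRegularity

open scoped ContDiff

variable {n : ℕ}

/-! ### The lens transform of functions -/

theorem hasFDerivAt_spSq (X : Spacetime n) : HasFDerivAt spSq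
    (∑ j : Fin n, (2 * X j.castSucc) •
      (EuclideanSpace.proj j.castSucc : Spacetime n →L[ℝ] ℝ)) X := by
  have h : ∀ j : Fin n, HasFDerivAt (fun X : Spacetime n => X j.castSucc ^ 2)
      ((2 * X j.castSucc) • (EuclideanSpace.proj j.castSucc : Spacetime n →L[ℝ] ℝ)) X := fun j => by
    have := ((EuclideanSpace.proj j.castSucc : Spacetime n →L[ℝ] ℝ).hasFDerivAt (x := X)).pow 2
    simpa using this
  exact HasFDerivAt.fun_sum fun j _ => h j

@[fun_prop]
theorem contDiff_spSq {m : WithTop ℕ∞} : ContDiff ℝ m (spSq (n := n)) := by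
  unfold spSq; fun_prop

/-- The amplitude `cosh(s)^q exp(-i (c/4) |y|² sinh s)` of the lens transform: a Jacobian factor and
the Galilean phase. -/
def lensAmp (c q : ℝ) (X : Spacetime n) : ℂ :=
  ((Real.cosh (time X) ^ q : ℝ) : ℂ) *
    Complex.exp (((-(c / 4) * (spSq X * Real.sinh (time X)) : ℝ) : ℂ) * Complex.I)

theorem contDiff_lensAmp (c q : ℝ) : ContDiff ℝ ∞ (lensAmp (n := n) c q) := by
  have h1 := contDiff_time (n := n) (m := ∞)
  have h2 := contDiff_spSq (n := n) (m := ∞)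
  have h3 : ContDiff ℝ ∞ fun X : Spacetime n => Real.cosh (time X) ^ q :=
    h1.cosh.rpow_const_of_ne fun X => (Real.cosh_pos _).ne'
  have h4 : ContDiff ℝ ∞ fun X : Spacetime n => -(c / 4) * (spSq X * Real.sinh (time X)) :=
    contDiff_const.mul (h2.mul h1.sinh)
  exact (Complex.ofRealCLM.contDiff.comp h3).mul
    (((Complex.ofRealCLM.contDiff.comp h4).mul contDiff_const).cexp)

theorem fderiv_lensAmp_apply (c q : ℝ) (X v : Spacetime n) :
    fderiv ℝ (lensAmp c q) X v = lensAmp c q X *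
      (q * ((Real.sinh (time X) : ℂ) / (Real.cosh (time X) : ℂ)) * (time v : ℂ) -
        Complex.I * (c / 4) * (2 * ((∑ j : Fin n, X j.castSucc * v j.castSucc : ℝ) : ℂ) *
          (Real.sinh (time X) : ℂ) + (spSq X : ℂ) * (Real.cosh (time X) : ℂ) * (time v : ℂ))) := by
  have hc := Real.cosh_pos (time X)
  have ht := hasFDerivAt_time X
  have h1 := Complex.ofRealCLM.hasFDerivAt.comp X (ht.cosh.rpow_const (p := q) (.inl hc.ne'))
  have h2 := ((Complex.ofRealCLM.hasFDerivAt.comp X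
    (((hasFDerivAt_spSq X).mul ht.sinh).const_mul (-(c / 4)))).mul_const Complex.I).cexp
  have h3 := h1.mul h2
  have h4 : fderiv ℝ (lensAmp c q) X v = _ := congrArg (fun L => L v) h3.fderiv
  rw [h4, lensAmp, Real.rpow_sub_one hc.ne']
  have hc' : (Real.cosh (time X) : ℂ) ≠ 0 := by exact_mod_cast hc.ne'
  simp only [add_apply, smul_apply, ContinuousLinearMap.comp_apply, Function.comp_apply,
    Complex.ofRealCLM_apply, timeL_apply, smul_eq_mul, sum_apply,
    PiLp.proj_apply, Pi.mul_apply]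
  have hs : ∑ j : Fin n, 2 * X j.castSucc * v j.castSucc =
      2 * ∑ j : Fin n, X j.castSucc * v j.castSucc := by
    rw [Finset.mul_sum]; exact Finset.sum_congr rfl fun _ _ => by ring
  rw [hs]
  generalize (∑ j : Fin n, X j.castSucc * v j.castSucc) = σ
  generalize Complex.exp _ = E
  generalize Real.cosh (time X) ^ q = Q
  generalize Real.cosh (time X) = C at *
  generalize Real.sinh (time X) = S at *
  push_cast
  field_simp
  ring

theorem norm_lensAmp (c q : ℝ) (X : Spacetime n) : ‖lensAmp c q X‖ = Real.cosh (time X) ^ q := by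
  rw [lensAmp, norm_mul, Complex.norm_exp_ofReal_mul_I, mul_one, Complex.norm_real,
    Real.norm_of_nonneg (Real.rpow_nonneg (Real.cosh_pos _).le _)]

/-- The lens transform of a test function. -/
def lensPull (c q : ℝ) : Test n →ₗ[ℂ] Test n where
  toFun f := ⟨fun X => lensAmp c q X * f.1 (lensMap X),
    (contDiff_lensAmp c q).mul (f.contDiff.comp contDiff_lensMap), by
      obtain ⟨R, hR⟩ := f.hasCompactSupport.isCompact.isBounded.subset_closedBall 0
      refine HasCompactSupport.intro (isCompact_closedBall 0 R) fun X hX => ?_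
      rw [image_eq_zero_of_notMem_tsupport (f := f.1), mul_zero]
      intro h
      have := hR h
      rw [mem_closedBall_zero_iff] at hX this
      exact hX ((norm_le_norm_lensMap X).trans this)⟩
  map_add' f g := Test.ext fun Z => by simp [mul_add]
  map_smul' c f := Test.ext fun Z => by simp [mul_left_comm]

theorem lensPull_apply (c q : ℝ) (f : Test n) (X : Spacetime n) :
    (lensPull c q f).1 X = lensAmp c q X * f.1 (lensMap X) := rfl

theorem pd_lensPull (c q : ℝ) (f : Test n) (a : Fin (n + 1)) (X : Spacetime n) :
    (pd a (lensPull c q f)).1 X = fderiv ℝ (lensAmp c q) X (unitVec a) * f.1 (lensMap X) +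
      lensAmp c q X * fderiv ℝ f.1 (lensMap X) (Real.cosh (time X) • unitVec a +
        time (unitVec a : Spacetime n) • Real.sinh (time X) • (X - time X • eT)) := by
  have h1 := ((contDiff_lensAmp (n := n) c q).differentiable (by simp) X).hasFDerivAt
  have h2 := (f.differentiable (lensMap X)).hasFDerivAt.comp X (hasFDerivAt_lensMap X)
  have h3 : (pd a (lensPull c q f)).1 X = _ := congrArg (fun L => L (unitVec a)) (h1.mul h2).fderiv
  rw [h3]
  simp [mul_comm]
  ring

theorem time_unitVec_castSucc (j : Fin n) : time (unitVec j.castSucc : Spacetime n) = 0 := by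
  simp [time, unitVec_apply, (Fin.castSucc_lt_last j).ne']

theorem sum_mul_unitVec_castSucc (j : Fin n) (X : Spacetime n) :
    ∑ i : Fin n, X i.castSucc * (unitVec j.castSucc : Spacetime n) i.castSucc = X j.castSucc := by
  simp [unitVec_apply]

theorem pd_lensPull_space (c q : ℝ) (f : Test n) (j : Fin n) (X : Spacetime n) :
    (pd j.castSucc (lensPull c q f)).1 X = lensAmp c q X *
      (-(Complex.I * (c / 2) * (X j.castSucc : ℂ) * (Real.sinh (time X) : ℂ)) * f.1 (lensMap X) +
        (Real.cosh (time X) : ℂ) * (pd j.castSucc f).1 (lensMap X)) := by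
  rw [pd_lensPull, fderiv_lensAmp_apply, time_unitVec_castSucc, sum_mul_unitVec_castSucc, zero_smul,
    add_zero, map_smul, ← pd_apply, Complex.real_smul]
  simp only [Complex.ofReal_zero, mul_zero]
  ring

theorem sub_time_smul_eT (X : Spacetime n) :
    X - time X • eT = ∑ j : Fin n, X j.castSucc • unitVec j.castSucc := by
  ext a
  induction a using Fin.lastCases with
  | last => simp [unitVec_apply, time, eT, (Fin.castSucc_lt_last _).ne']
  | cast i => simp [unitVec_apply]

theorem pd_lensPull_time (c q : ℝ) (f : Test n) (X : Spacetime n) :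
    (pd (Fin.last n) (lensPull c q f)).1 X = lensAmp c q X *
      ((q * ((Real.sinh (time X) : ℂ) / (Real.cosh (time X) : ℂ)) -
        Complex.I * (c / 4) * ((spSq X : ℂ) * (Real.cosh (time X) : ℂ))) * f.1 (lensMap X) +
        (Real.sinh (time X) : ℂ) * (∑ j : Fin n, (X j.castSucc : ℂ) *
          (pd j.castSucc f).1 (lensMap X)) +
        (Real.cosh (time X) : ℂ) * (pd (Fin.last n) f).1 (lensMap X)) := by
  rw [pd_lensPull, fderiv_lensAmp_apply]
  change _ * _ + _ * (fderiv ℝ f.1 (lensMap X)) (_ • eT + time (eT : Spacetime n) • _) = _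
  rw [show (unitVec (Fin.last n) : Spacetime n) = eT from rfl, time_eT, one_smul, sub_time_smul_eT,
    map_add, map_smul, map_smul, map_sum]
  simp only [map_smul, eT_castSucc, mul_zero, Finset.sum_const_zero, Complex.ofReal_zero,
    Complex.ofReal_one, Complex.real_smul, pd_apply]
  rw [show (unitVec (Fin.last n) : Spacetime n) = eT from rfl]
  ring

/-- Products of powers of `tanh s` and `sech s`. -/
def lensCoef (p : ℕ × ℕ) : Smooth n :=
  ⟨fun X => ((Real.sinh (time X) : ℂ) / (Real.cosh (time X) : ℂ)) ^ p.1 *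
      ((Real.cosh (time X) : ℂ)⁻¹) ^ p.2, by
    have h1 := contDiff_time (n := n) (m := ∞)
    have hc : ContDiff ℝ ∞ fun X : Spacetime n => (Real.cosh (time X) : ℂ) :=
      Complex.ofRealCLM.contDiff.comp h1.cosh
    have hs : ContDiff ℝ ∞ fun X : Spacetime n => (Real.sinh (time X) : ℂ) :=
      Complex.ofRealCLM.contDiff.comp h1.sinh
    have h0 : ∀ X : Spacetime n, (Real.cosh (time X) : ℂ) ≠ 0 := fun X => by
      exact_mod_cast (Real.cosh_pos _).ne'
    simp only [div_eq_mul_inv]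
    exact ((hs.mul (hc.inv h0)).pow _).mul ((hc.inv h0).pow _)⟩

theorem lensCoef_apply (p : ℕ × ℕ) (X : Spacetime n) :
    (lensCoef p).1 X = ((Real.sinh (time X) : ℂ) / (Real.cosh (time X) : ℂ)) ^ p.1 *
      ((Real.cosh (time X) : ℂ)⁻¹) ^ p.2 := rfl

theorem norm_lensCoef_le (p : ℕ × ℕ) (X : Spacetime n) : ‖(lensCoef p).1 X‖ ≤ 1 := by
  have h := Real.cosh_pos (time X)
  rw [lensCoef_apply, norm_mul, norm_pow, norm_pow, norm_div, norm_inv, Complex.norm_real,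
    Complex.norm_real, Real.norm_of_nonneg h.le]
  refine mul_le_one₀ (pow_le_one₀ (by positivity) ?_) (by positivity)
    (pow_le_one₀ (by positivity) (inv_le_one_of_one_le₀ (Real.one_le_cosh _)))
  rw [div_le_one h, Real.norm_eq_abs]
  exact (sq_le_sq₀ (abs_nonneg _) h.le).1 (by rw [sq_abs, Real.cosh_sq]; linarith)

theorem fderiv_lensCoef_apply (p : ℕ × ℕ) (X v : Spacetime n) :
    fderiv ℝ (lensCoef p).1 X v = (time v : ℂ) *
      (p.1 * (lensCoef (p.1 - 1, p.2 + 2)).1 X - p.2 * (lensCoef (p.1 + 1, p.2)).1 X) := by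
  obtain ⟨i, j⟩ := p
  have hc := Real.cosh_pos (time X)
  have hc' : (Real.cosh (time X) : ℂ) ≠ 0 := by exact_mod_cast hc.ne'
  have hcs : (Real.cosh (time X) : ℂ) ^ 2 = (Real.sinh (time X) : ℂ) ^ 2 + 1 := by
    exact_mod_cast Real.cosh_sq (time X)
  have dC : HasDerivAt (fun s : ℝ => (Real.cosh s : ℂ)) (Real.sinh (time X) : ℂ) (time X) :=
    (Real.hasDerivAt_cosh _).ofReal_comp
  have dS : HasDerivAt (fun s : ℝ => (Real.sinh s : ℂ)) (Real.cosh (time X) : ℂ) (time X) :=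
    (Real.hasDerivAt_sinh _).ofReal_comp
  have h := (((dS.div dC hc').pow i).mul ((dC.inv hc').pow j)).hasFDerivAt.comp X
    (hasFDerivAt_time X)
  have h2 : fderiv ℝ (lensCoef (i, j)).1 X v = _ := congrArg (fun L => L v) h.fderiv
  rw [h2]
  simp only [ContinuousLinearMap.comp_apply, timeL_apply, lensCoef_apply,
    ContinuousLinearMap.toSpanSingleton_apply, Complex.real_smul, Pi.pow_apply, Pi.div_apply,
    Pi.inv_apply]
  generalize (Real.cosh (time X) : ℂ) = C at *
  generalize (Real.sinh (time X) : ℂ) = S at *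
  have e1 : (C * C - S * S) / C ^ 2 = C⁻¹ ^ 2 := by
    rw [inv_pow, show C * C - S * S = 1 by linear_combination hcs, one_div]
  have e2 : (j : ℂ) * C⁻¹ ^ (j - 1) * (-S / C ^ 2) = -(j * (S / C) * C⁻¹ ^ j) := by
    rcases j with _ | j
    · simp
    · simp only [Nat.add_sub_cancel, pow_succ]; field_simp
  rw [e1, e2, pow_add _ i 1, pow_add _ j 2]
  ring

theorem pd_mulTest_apply (a : Fin (n + 1)) (m : Smooth n) (f : Test n) (Z : Spacetime n) :
    (pd a (mulTest m f)).1 Z = fderiv ℝ m.1 Z (unitVec a) * f.1 Z + m.1 Z * (pd a f).1 Z := by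
  have : (mulTest m f).1 = m.1 * f.1 := rfl
  simp only [pd_apply, this]
  rw [fderiv_mul (m.2.differentiable (by simp) Z) (f.differentiable Z)]
  simp [mul_comm, add_comm]

end ModuleRegularity

end

noncomputable section

namespace ModuleRegularity

open scoped ContDiff

variable {n : ℕ}

/-! ### The lens transform intertwines the modules -/

/-- Labels for the generators in lens coordinates `(y, s)`. -/
inductive LGen (n : ℕ) : Type
  | pos (j : Fin n)
  | deriv (j : Fin n)
  | rot (i j : Fin n)
  | time
  deriving Fintype

/-- The generators `y_j`, `∂_{y_j}`, `y_i ∂_{y_j} - y_j ∂_{y_i}` and `∂_s`. -/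
def LGen.op : LGen n → (Test n →ₗ[ℂ] Test n)
  | .pos j => posT j.castSucc
  | .deriv j => pd j.castSucc
  | .rot i j => posT i.castSucc ∘ₗ pd j.castSucc - posT j.castSucc ∘ₗ pd i.castSucc
  | .time => pd (Fin.last n)

/-- The orders of the generators in lens coordinates. -/
def LGen.order : LGen n → ℕ
  | .time => 2
  | _ => 1

theorem LGen.one_le_order (g : LGen n) : 1 ≤ g.order := by
  cases g <;> simp [LGen.order]

/-- The lens transform with a coefficient `tanh^i sech^j`. -/
def lensT (c q : ℝ) (p : ℕ × ℕ) : Test n →ₗ[ℂ] Test n := mulTest (lensCoef p) ∘ₗ lensPull c q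

theorem lensT_apply (c q : ℝ) (p : ℕ × ℕ) (f : Test n) (X : Spacetime n) :
    (lensT c q p f).1 X = (lensCoef p).1 X * (lensAmp c q X * f.1 (lensMap X)) := rfl

theorem lensCoef_succ_left (i j : ℕ) (X : Spacetime n) : (lensCoef (i + 1, j)).1 X =
    (lensCoef (i, j)).1 X * ((Real.sinh (time X) : ℂ) / (Real.cosh (time X) : ℂ)) := by
  simp only [lensCoef_apply, pow_succ]; ring

theorem lensCoef_succ_right (i j : ℕ) (X : Spacetime n) : (lensCoef (i, j + 1)).1 X =
    (lensCoef (i, j)).1 X * (Real.cosh (time X) : ℂ)⁻¹ := by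
  simp only [lensCoef_apply, pow_succ]; ring

theorem pd_lensT_space (c q : ℝ) (p : ℕ × ℕ) (f : Test n) (j : Fin n) (X : Spacetime n) :
    (pd j.castSucc (lensT c q p f)).1 X = (lensCoef p).1 X * (lensAmp c q X *
      (-(Complex.I * (c / 2) * (X j.castSucc : ℂ) * (Real.sinh (time X) : ℂ)) * f.1 (lensMap X) +
        (Real.cosh (time X) : ℂ) * (pd j.castSucc f).1 (lensMap X))) := by
  rw [lensT, LinearMap.comp_apply, pd_mulTest_apply, pd_lensPull_space, fderiv_lensCoef_apply,
    time_unitVec_castSucc]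
  simp

theorem cosh_ne_zero (X : Spacetime n) : (Real.cosh (time X) : ℂ) ≠ 0 := by
  exact_mod_cast (Real.cosh_pos _).ne'

theorem cosh_sq_eq (X : Spacetime n) :
    (Real.cosh (time X) : ℂ) ^ 2 = (Real.sinh (time X) : ℂ) ^ 2 + 1 := by
  exact_mod_cast Real.cosh_sq (time X)

theorem coord_lensMap_castSucc (X : Spacetime n) (j : Fin n) :
    coord j.castSucc (lensMap X) = (Real.cosh (time X) : ℂ) * (X j.castSucc : ℂ) := by
  simp only [coord, lensMap_castSucc, Complex.ofReal_mul]

theorem coord_lensMap_last (X : Spacetime n) :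
    coord (Fin.last n) (lensMap X) = (Real.sinh (time X) : ℂ) := by
  rw [← time_lensMap]; rfl

theorem testOp_dz (c : ℝ) (j : Fin n) (f : Test n) (Z : Spacetime n) :
    (testOp c (.dz j) f).1 Z = -Complex.I * (pd j.castSucc f).1 Z := rfl

theorem testOp_dt (c : ℝ) (f : Test n) (Z : Spacetime n) :
    (testOp c .dt f).1 Z = -Complex.I * (pd (Fin.last n) f).1 Z := rfl

theorem testOp_rot (c : ℝ) (i j : Fin n) (f : Test n) (Z : Spacetime n) :
    (testOp c (.rot i j) f).1 Z =
      -Complex.I * (coord i.castSucc Z * (pd j.castSucc f).1 Z -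
        coord j.castSucc Z * (pd i.castSucc f).1 Z) := by
  have : (testOp c (.rot i j) f).1 Z = coord i.castSucc Z * (-Complex.I * (pd j.castSucc f).1 Z) -
    coord j.castSucc Z * (-Complex.I * (pd i.castSucc f).1 Z) := rfl
  rw [this]; ring

theorem testOp_gal (c : ℝ) (j : Fin n) (f : Test n) (Z : Spacetime n) :
    (testOp c (.gal j) f).1 Z = -Complex.I * coord (Fin.last n) Z * (pd j.castSucc f).1 Z -
      c / 2 * (coord j.castSucc Z * f.1 Z) := by
  have : (testOp c (.gal j) f).1 Z = coord (Fin.last n) Z * (-Complex.I * (pd j.castSucc f).1 Z) -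
    c / 2 * (coord j.castSucc Z * f.1 Z) := rfl
  rw [this]; ring

theorem testOp_dil (c : ℝ) (f : Test n) (Z : Spacetime n) :
    (testOp c .dil f).1 Z = -Complex.I * (2 * coord (Fin.last n) Z * (pd (Fin.last n) f).1 Z +
      ∑ j : Fin n, coord j.castSucc Z * (pd j.castSucc f).1 Z) := by
  simp only [testOp, weylGen, LinearMap.add_apply, Module.End.mul_apply, LinearMap.smul_apply,
    LinearMap.sum_apply, Test.add_apply, Test.smul_apply, Test.sum_apply, posT_apply, momT_apply,
    mul_add, Finset.mul_sum]
  congr 1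
  · ring
  · exact Finset.sum_congr rfl fun _ _ => by ring

/-- The phase of the amplitude combines translations and Galilean boosts into `∂_{y_j}`. -/
theorem deriv_lensT (c q : ℝ) (i l : ℕ) (j : Fin n) (f : Test n) :
    pd j.castSucc (lensT c q (i, l) f) = Complex.I • (lensT c q (i + 1, l) (testOp c (.gal j) f) +
      lensT c q (i, l + 1) (testOp c (.dz j) f)) := by
  refine Test.ext fun X => ?_
  have h0 := cosh_ne_zero X
  have h1 := cosh_sq_eq X
  simp only [pd_lensT_space, Test.smul_apply, Test.add_apply, lensT_apply, lensCoef_succ_left,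
    lensCoef_succ_right, testOp_gal, testOp_dz, coord_lensMap_castSucc, coord_lensMap_last]
  generalize (Real.cosh (time X) : ℂ) = C at *
  generalize (Real.sinh (time X) : ℂ) = S at *
  generalize (pd j.castSucc f).1 (lensMap X) = P
  field_simp
  linear_combination ((lensCoef (i, l)).1 X * lensAmp c q X * P * 2) * h1 +
    ((lensCoef (i, l)).1 X * lensAmp c q X * P * 2) * (S ^ 2 + 1) * Complex.I_sq

/-- For `c ≠ 0` translations and Galilean boosts also generate the multiplication by `y_j`. -/
theorem pos_lensT {c : ℝ} (hc : c ≠ 0) (q : ℝ) (i l : ℕ) (j : Fin n) (f : Test n) :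
    posT j.castSucc (lensT c q (i, l) f) = (2 / c : ℂ) •
      (lensT c q (i + 1, l) (testOp c (.dz j) f) - lensT c q (i, l + 1) (testOp c (.gal j) f)) := by
  refine Test.ext fun X => ?_
  have h0 := cosh_ne_zero X
  have hc' : (c : ℂ) ≠ 0 := by exact_mod_cast hc
  simp only [posT_apply, Test.smul_apply, Test.sub_apply, lensT_apply, lensCoef_succ_left,
    lensCoef_succ_right, testOp_gal, testOp_dz, coord_lensMap_castSucc, coord_lensMap_last]
  simp only [coord]
  generalize (Real.cosh (time X) : ℂ) = C at *
  generalize (Real.sinh (time X) : ℂ) = S at *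
  generalize (pd j.castSucc f).1 (lensMap X) = P
  field_simp
  ring

theorem rot_lensT (c q : ℝ) (p : ℕ × ℕ) (i j : Fin n) (f : Test n) :
    (LGen.rot i j).op (lensT c q p f) = Complex.I • lensT c q p (testOp c (.rot i j) f) := by
  refine Test.ext fun X => ?_
  have h : ((LGen.rot i j).op (lensT c q p f)).1 X =
    (X i.castSucc : ℂ) * (pd j.castSucc (lensT c q p f)).1 X -
      (X j.castSucc : ℂ) * (pd i.castSucc (lensT c q p f)).1 X := rfl
  rw [h]
  simp only [pd_lensT_space, Test.smul_apply, lensT_apply, testOp_rot, coord_lensMap_castSucc]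
  linear_combination ((lensCoef p).1 X * lensAmp c q X * (Real.cosh (time X) : ℂ) *
    ((X i.castSucc : ℂ) * (pd j.castSucc f).1 (lensMap X) -
      (X j.castSucc : ℂ) * (pd i.castSucc f).1 (lensMap X))) * Complex.I_sq

/-- The time derivative is given by the dilation and by `D_t`, up to terms quadratic in `y_j` and
`∂_{y_j}`, which have order two as well. -/
theorem time_lensT (c q : ℝ) (i l : ℕ) (f : Test n) :
    pd (Fin.last n) (lensT c q (i, l) f) =
      ((q : ℂ) • lensT c q (i + 1, l) f + (Complex.I / 2) • lensT c q (i + 1, l) (testOp c .dil f) +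
      Complex.I • lensT c q (i, l + 1) (testOp c .dt f) +
      (1 / 2 : ℂ) • ∑ j : Fin n, posT j.castSucc (pd j.castSucc (lensT c q (i + 1, l) f)) -
      (Complex.I * (c / 4)) • ∑ j : Fin n, posT j.castSucc (posT j.castSucc
        (lensT c q (i, l + 1) f))) +
      ((i : ℂ) • lensT c q (i - 1, l + 2) f - (l : ℂ) • lensT c q (i + 1, l) f) := by
  refine Test.ext fun X => ?_
  have h0 := cosh_ne_zero X
  have h1 := cosh_sq_eq X
  have hsp : (spSq X : ℂ) = ∑ j : Fin n, (X j.castSucc : ℂ) ^ 2 := by simp [spSq]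
  have hL : (pd (Fin.last n) (lensT c q (i, l) f)).1 X = _ := pd_mulTest_apply _ _ _ X
  rw [hL, fderiv_lensCoef_apply, pd_lensPull_time, lensPull_apply]
  rw [show time (unitVec (Fin.last n) : Spacetime n) = 1 from time_eT, Complex.ofReal_one]
  simp only [Test.smul_apply, Test.add_apply, Test.sub_apply, Test.sum_apply, posT_apply,
    pd_lensT_space]
  simp only [lensT_apply, lensCoef_succ_left, lensCoef_succ_right, testOp_dil, testOp_dt,
    coord_lensMap_last, coord_lensMap_castSucc, hsp]
  generalize (Real.cosh (time X) : ℂ) = C at *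
  generalize (Real.sinh (time X) : ℂ) = S at *
  set P : Fin n → ℂ := fun j => (pd j.castSucc f).1 (lensMap X) with hP
  set K := (lensCoef (i, l)).1 X
  set A := lensAmp c q X
  set f₀ := f.1 (lensMap X)
  have s1 : ∑ j : Fin n, coord j.castSucc X * (K * (S / C) * (A *
      (-(Complex.I * (c / 2) * (X j.castSucc : ℂ) * S) * f₀ + C * (pd j.castSucc f).1 (lensMap X)))) =
      K * A * (-(S / C * (Complex.I * (c / 2)) * S * f₀) * (∑ j : Fin n, (X j.castSucc : ℂ) ^ 2) +
        S / C * C * ∑ j : Fin n, (X j.castSucc : ℂ) * P j) := by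
    rw [Finset.mul_sum, Finset.mul_sum, ← Finset.sum_add_distrib, Finset.mul_sum]
    refine Finset.sum_congr rfl fun j _ => ?_
    simp only [coord, hP]
    ring
  have s2 : ∑ j : Fin n, coord j.castSucc X * (coord j.castSucc X * (K * C⁻¹ * (A * f₀))) =
      K * C⁻¹ * (A * f₀) * ∑ j : Fin n, (X j.castSucc : ℂ) ^ 2 := by
    rw [Finset.mul_sum]
    refine Finset.sum_congr rfl fun j _ => ?_
    simp only [coord]
    ring
  have s3 : ∑ j : Fin n, C * (X j.castSucc : ℂ) * (pd j.castSucc f).1 (lensMap X) =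
      C * ∑ j : Fin n, (X j.castSucc : ℂ) * P j := by
    rw [Finset.mul_sum]
    exact Finset.sum_congr rfl fun j _ => by rw [mul_assoc]
  rw [s1, s2, s3]
  change _ * (A * f₀) + K * (A * (_ + S * (∑ j : Fin n, (X j.castSucc : ℂ) * P j) + _)) = _
  generalize (∑ j : Fin n, (X j.castSucc : ℂ) * P j) = σ₁
  generalize (∑ j : Fin n, (X j.castSucc : ℂ) ^ 2) = σ₂
  generalize (pd (Fin.last n) f).1 (lensMap X) = T
  field_simp
  linear_combination (A * C * K * (16 * T - 4 * Complex.I * c * σ₂ * f₀)) * h1 +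
    (A * C * K * (16 * T * (S ^ 2 + 1) + 8 * S * C * σ₁)) * Complex.I_sq

/-- The lens transform maps words in the generators to words in the lens generators: every lens
generator applied to a lens transform is a combination of lens transforms of equal order. -/
theorem op_lensT_mem {c : ℝ} (hc : c ≠ 0) (q : ℝ) (b : LGen n) (p : ℕ × ℕ) :
    (fun (_ : Unit) (f : Test n) => b.op (lensT c q p f)) ∈
      transfer Gen.regOrder (fun g f => testOp c g f)
        (fun p (_ : Unit) (f : Test n) => lensT c q p f) b.order := by
  have of1 : ∀ (p : ℕ × ℕ) (g : Gen n) (a : ℕ), g.regOrder ≤ a →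
      (fun (_ : Unit) (f : Test n) => lensT c q p (testOp c g f)) ∈
        transfer Gen.regOrder (fun g f => testOp c g f)
          (fun p (_ : Unit) (f : Test n) => lensT c q p f) a := fun p g a h =>
    transfer_of (τ := fun p (_ : Unit) (f : Test n) => lensT c q p f) p (w := [g]) (by simpa using h)
  have of0 : ∀ (p : ℕ × ℕ) (a : ℕ), (fun (_ : Unit) (f : Test n) => lensT c q p f) ∈
        transfer Gen.regOrder (fun g f => testOp c g f)
          (fun p (_ : Unit) (f : Test n) => lensT c q p f) a := fun p a =>
    transfer_of (τ := fun p (_ : Unit) (f : Test n) => lensT c q p f) p (w := []) (by simp)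
  have hpos : ∀ (j : Fin n) (p : ℕ × ℕ),
      (fun (_ : Unit) (f : Test n) => posT j.castSucc (lensT c q p f)) ∈
        transfer Gen.regOrder (fun g f => testOp c g f)
          (fun p (_ : Unit) (f : Test n) => lensT c q p f) 1 := fun j p => by
    obtain ⟨i, l⟩ := p
    simp only [pos_lensT hc]
    exact Submodule.smul_mem _ _ (Submodule.sub_mem _ (of1 _ _ _ le_rfl) (of1 _ _ _ le_rfl))
  have hder : ∀ (j : Fin n) (p : ℕ × ℕ),
      (fun (_ : Unit) (f : Test n) => pd j.castSucc (lensT c q p f)) ∈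
        transfer Gen.regOrder (fun g f => testOp c g f)
          (fun p (_ : Unit) (f : Test n) => lensT c q p f) 1 := fun j p => by
    obtain ⟨i, l⟩ := p
    simp only [deriv_lensT]
    exact Submodule.smul_mem _ _ (Submodule.add_mem _ (of1 _ _ _ le_rfl) (of1 _ _ _ le_rfl))
  cases b with
  | pos j => exact hpos j p
  | deriv j => exact hder j p
  | rot i j =>
    have h : (fun (_ : Unit) (f : Test n) => (LGen.rot i j).op (lensT c q p f)) =
        fun _ f => Complex.I • lensT c q p (testOp c (.rot i j) f) :=
      funext fun _ => funext fun f => rot_lensT c q p i j f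
    rw [h]
    exact Submodule.smul_mem _ _ (of1 _ _ _ le_rfl)
  | time =>
    have hsum : ∀ F : Fin n → Unit → Test n → Test n,
        (∀ j, F j ∈ transfer Gen.regOrder (fun g f => testOp c g f)
          (fun p (_ : Unit) (f : Test n) => lensT c q p f) 2) →
        (fun (u : Unit) (f : Test n) => ∑ j, F j u f) ∈ transfer Gen.regOrder (fun g f => testOp c g f)
          (fun p (_ : Unit) (f : Test n) => lensT c q p f) 2 := fun F hF => by
      have := Submodule.sum_mem _ (t := Finset.univ) fun j _ => hF j
      convert this using 1
      ext1 u
      ext1 f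
      simp only [Finset.sum_apply]
    obtain ⟨i, l⟩ := p
    change (fun (_ : Unit) (f : Test n) => pd (Fin.last n) (lensT c q (i, l) f)) ∈ _
    simp only [time_lensT]
    refine Submodule.add_mem _ (Submodule.sub_mem _ (Submodule.add_mem _ (Submodule.add_mem _
      (Submodule.add_mem _ ?_ ?_) ?_) ?_) ?_) (Submodule.sub_mem _ ?_ ?_)
    · exact Submodule.smul_mem _ _ (of0 _ _)
    · exact Submodule.smul_mem _ _ (of1 _ _ _ le_rfl)
    · exact Submodule.smul_mem _ _ (of1 _ _ _ le_rfl)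
    · exact Submodule.smul_mem _ _ (hsum _ fun j => transfer_comp (posT j.castSucc) (hpos j)
        (hder j _))
    · exact Submodule.smul_mem _ _ (hsum _ fun j => transfer_comp (posT j.castSucc) (hpos j)
        (hpos j _))
    · exact Submodule.smul_mem _ _ (of0 _ _)
    · exact Submodule.smul_mem _ _ (of0 _ _)

/-- The spatial bracket `⟨y⟩^r`, which is the weight in lens coordinates. -/
def bracket (n : ℕ) (r : ℝ) : Smooth n :=
  ⟨fun X => (((1 + spSq X) ^ (r / 2) : ℝ) : ℂ), Complex.ofRealCLM.contDiff.comp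
    ((contDiff_const.add contDiff_spSq).rpow_const_of_ne fun X => by
      have := spSq_nonneg X; positivity)⟩

/-- The weighted norm in lens coordinates. -/
def lensNorm (r : ℝ) (F : Test n) : ℝ≥0∞ :=
  eLpNorm (fun X => (bracket n r).1 X * F.1 X) 2 volume

theorem isGauge_lensNorm (r : ℝ) : IsGauge (lensNorm (n := n) r) := isGauge_eLpNorm (bracket n r)

theorem enorm_bracket (r : ℝ) (X : Spacetime n) :
    ‖(bracket n r).1 X‖ₑ = ENNReal.ofReal ((1 + spSq X) ^ (r / 2)) := by
  rw [← ofReal_norm, bracket, Complex.norm_real, Real.norm_of_nonneg]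
  have := spSq_nonneg X
  positivity

theorem enorm_weight (r : ℝ) (Z : Spacetime n) :
    ‖weight n r Z‖ₑ = ENNReal.ofReal ((1 + ‖Z‖ ^ 2) ^ (r / 2)) := by
  rw [← ofReal_norm, weight, Complex.norm_real, Real.norm_of_nonneg]
  positivity

/-- The weight in lens coordinates. -/
theorem enorm_weight_lensMap (r : ℝ) (X : Spacetime n) : ‖weight n r (lensMap X)‖ₑ =
    ENNReal.ofReal (Real.cosh (time X) ^ r) * ‖(bracket n r).1 X‖ₑ := by
  have hc := Real.cosh_pos (time X)
  have hs := spSq_nonneg X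
  rw [enorm_weight, enorm_bracket, one_add_norm_sq_lensMap, ← ENNReal.ofReal_mul (by positivity),
    Real.mul_rpow (by positivity) (by positivity), ← Real.rpow_natCast, ← Real.rpow_mul hc.le]
  congr 3
  push_cast
  ring

theorem ofReal_cosh_rpow_sq (X : Spacetime n) (q : ℝ) :
    ENNReal.ofReal (Real.cosh (time X) ^ q) ^ 2 = ENNReal.ofReal (Real.cosh (time X) ^ (2 * q)) := by
  have hc := Real.cosh_pos (time X)
  rw [← ENNReal.ofReal_pow (by positivity), ← Real.rpow_natCast, ← Real.rpow_mul hc.le]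
  congr 2
  push_cast
  ring

theorem enorm_lensAmp (c q : ℝ) (X : Spacetime n) :
    ‖lensAmp c q X‖ₑ = ENNReal.ofReal (Real.cosh (time X) ^ q) := by
  rw [← ofReal_norm, norm_lensAmp]

theorem testNorm_sq (r : ℝ) (f : Test n) : testNorm r f ^ 2 =
    ∫⁻ X, ENNReal.ofReal (Real.cosh (time X) ^ (2 * r + (n + 1))) *
      (‖(bracket n r).1 X‖ₑ * ‖f.1 (lensMap X)‖ₑ) ^ 2 := by
  rw [testNorm, eLpNorm_two_sq, lintegral_lensMap]
  refine lintegral_congr fun X => ?_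
  have hc := Real.cosh_pos (time X)
  rw [enorm_mul, enorm_weight_lensMap, mul_assoc, mul_pow, ofReal_cosh_rpow_sq, ← mul_assoc,
    ← ENNReal.ofReal_mul (by positivity), Real.rpow_add hc, mul_comm (_ ^ (n + 1))]
  congr 3
  exact_mod_cast (Real.rpow_natCast _ (n + 1)).symm

/-- The exponent `q = r + (n + 1) / 2` makes the lens transform unitary. -/
theorem lensNorm_lensT_le (c r : ℝ) (p : ℕ × ℕ) (f : Test n) :
    lensNorm r (lensT c (r + ((n : ℝ) + 1) / 2) p f) ≤ testNorm r f := by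
  refine (ENNReal.pow_le_pow_left_iff (n := 2) two_ne_zero).1 ?_
  rw [testNorm_sq, lensNorm, eLpNorm_two_sq]
  refine lintegral_mono fun X => ?_
  simp only [lensT_apply, enorm_mul, enorm_lensAmp]
  have h : ‖(lensCoef p).1 X‖ₑ ≤ 1 := by
    rw [← ofReal_norm]
    simpa using ENNReal.ofReal_le_ofReal (norm_lensCoef_le p X)
  calc _ ≤ (‖(bracket n r).1 X‖ₑ * (1 * (ENNReal.ofReal (Real.cosh (time X) ^
        (r + ((n : ℝ) + 1) / 2)) * ‖f.1 (lensMap X)‖ₑ))) ^ 2 := by gcongr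
    _ = _ := by
      rw [one_mul, mul_left_comm, mul_pow, ofReal_cosh_rpow_sq]
      congr 4
      ring

/-- The lens norms of a lens transform. -/
theorem wnorm_lensPull_le {c : ℝ} (hc : c ≠ 0) (r : ℝ) (a : ℕ) : ∃ C : ℝ≥0, ∀ f : Test n,
    wnorm LGen.order (fun b F => b.op F) (lensNorm r) a (lensPull c (r + ((n : ℝ) + 1) / 2) f) ≤
      C * wnorm Gen.regOrder (fun g f => testOp c g f) (testNorm r) a f := by
  obtain ⟨C, hC⟩ := wnorm_transfer_le one_le_regOrder (d := Gen.regOrder (n := n))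
    (A := fun g f => testOp c g f) (τ := fun p (_ : Unit) (f : Test n) =>
      lensT c (r + ((n : ℝ) + 1) / 2) p f) (B := LGen.op) (e := LGen.order)
    (op_lensT_mem hc _) (isGauge_lensNorm r) (SV := fun _ => testNorm r)
    (fun p => ⟨1, fun _ f => by simpa using lensNorm_lensT_le c r p f⟩) a (0, 0)
  refine ⟨C, fun f => ?_⟩
  have h : lensT c (r + ((n : ℝ) + 1) / 2) (0, 0) f = lensPull c (r + ((n : ℝ) + 1) / 2) f :=
    Test.ext fun X => by simp [lensT_apply, lensPull_apply, lensCoef_apply]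
  rw [← h]
  exact hC () f

/-- Under the lens transform the gain of weight `(n + 1) / 2` disappears. -/
theorem testNorm_mul_eq (c₁ c₂ r₁ r₂ : ℝ) (f g : Test n) :
    testNorm (r₁ + r₂ + ((n : ℝ) + 1) / 2) (f.mul g) =
      lensNorm (r₁ + r₂ + ((n : ℝ) + 1) / 2)
        ((lensPull c₁ (r₁ + ((n : ℝ) + 1) / 2) f).mul (lensPull c₂ (r₂ + ((n : ℝ) + 1) / 2) g)) := by
  refine (ENNReal.pow_right_strictMono two_ne_zero).injective ?_
  rw [testNorm_sq, lensNorm, eLpNorm_two_sq]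
  refine lintegral_congr fun X => ?_
  have hc := Real.cosh_pos (time X)
  simp only [Test.mul_apply, lensPull_apply, enorm_mul, enorm_lensAmp]
  have h : ENNReal.ofReal (Real.cosh (time X) ^ (2 * (r₁ + r₂ + ((n : ℝ) + 1) / 2) + (n + 1))) =
      (ENNReal.ofReal (Real.cosh (time X) ^ (r₁ + ((n : ℝ) + 1) / 2)) *
        ENNReal.ofReal (Real.cosh (time X) ^ (r₂ + ((n : ℝ) + 1) / 2))) ^ 2 := by
    rw [mul_pow, ofReal_cosh_rpow_sq, ofReal_cosh_rpow_sq, ← ENNReal.ofReal_mul (by positivity),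
      ← Real.rpow_add hc]
    congr 2
    ring
  rw [h]
  ring

end ModuleRegularity

end

noncomputable section

namespace ModuleRegularity

open scoped ContDiff Manifold

variable {n : ℕ}

/-! ### Localization in charts -/

/-- The test functions supported in `A`. -/
abbrev Cutoff (A : Set (Spacetime n)) : Type := {κ : Test n // tsupport κ.1 ⊆ A}

theorem exists_cutoff {K A : Set (Spacetime n)} (hK : IsCompact K) (hA : IsOpen A) (h : K ⊆ A) :
    ∃ κ : Cutoff A, ∀ X ∈ K, κ.1.1 X = 1 := by
  obtain ⟨V, hV, hKV, hVA, hVc⟩ := exists_open_between_and_isCompact_closure hK hA h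
  obtain ⟨f, hf, -, hs, h1⟩ := exists_contMDiff_support_eq_eq_one_iff 𝓘(ℝ, Spacetime n) (n := (⊤ : ℕ∞))
    hV hK.isClosed hKV
  have hsupp : Function.support (fun X => (f X : ℂ)) = V := by
    rw [← hs]; ext X; simp
  refine ⟨⟨⟨fun X => (f X : ℂ), Complex.ofRealCLM.contDiff.comp hf.contDiff, ?_⟩, ?_⟩, fun X hX => ?_⟩
  · rw [HasCompactSupport, tsupport, hsupp]; exact hVc
  · rw [tsupport, hsupp]; exact hVA
  · simp [(h1 X).1 hX]

theorem contDiff_mul_of_tsupport_subset {A : Set (Spacetime n)} (hA : IsOpen A) (κ : Cutoff A)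
    {a : Spacetime n → ℂ} (ha : ContDiffOn ℝ ∞ a A) : ContDiff ℝ ∞ fun X => κ.1.1 X * a X := by
  rw [contDiff_iff_contDiffAt]
  intro X
  by_cases hX : X ∈ A
  · exact κ.1.contDiff.contDiffAt.mul (ha.contDiffAt (hA.mem_nhds hX))
  · have h0 : κ.1.1 =ᶠ[nhds X] 0 := notMem_tsupport_iff_eventuallyEq.1 fun h => hX (κ.2 h)
    refine (contDiffAt_const (c := (0 : ℂ))).congr_of_eventuallyEq ?_
    filter_upwards [h0] with Y hY
    simp [hY]

/-- The product of a cutoff with a function smooth where it lives. -/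
def Cutoff.smul {A : Set (Spacetime n)} (hA : IsOpen A) (κ : Cutoff A)
    {a : Spacetime n → ℂ} (ha : ContDiffOn ℝ ∞ a A) : Cutoff A :=
  ⟨⟨fun X => κ.1.1 X * a X, contDiff_mul_of_tsupport_subset hA κ ha, κ.1.hasCompactSupport.mul_right⟩,
    (tsupport_mul_subset_left (f := κ.1.1) (g := a)).trans κ.2⟩

/-- The derivative of a cutoff. -/
def Cutoff.pd {A : Set (Spacetime n)} (i : Fin (n + 1)) (κ : Cutoff A) : Cutoff A :=
  ⟨ModuleRegularity.pd i κ.1, (tsupport_fderiv_apply_subset ℝ (unitVec i)).trans κ.2⟩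

theorem Cutoff.eq_zero {A : Set (Spacetime n)} (κ : Cutoff A) {X : Spacetime n} (hX : X ∉ A) :
    κ.1.1 X = 0 :=
  image_eq_zero_of_notMem_tsupport fun h => hX (κ.2 h)

/-- A family of parametrizations `Φ p : A → ℝⁿ⁺¹`, all with the same domain, by which the lens
generators control ordinary derivatives uniformly in the parameter. The chart `Φ p` covers a region
where `⟨y⟩` is comparable to `size p`, dilates the `n - 1` angular directions by a factor comparable
to `size p`, and the regions have bounded overlap. -/
structure ChartFamily (n : ℕ) (ι : Type) where
  /-- The common domain. -/
  A : Set (Spacetime n)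
  /-- The core of the domain. -/
  core : Set (Spacetime n)
  isOpen : IsOpen A
  isCompact : IsCompact core
  core_subset : core ⊆ A
  /-- The parametrizations. -/
  Φ : ι → Spacetime n → Spacetime n
  /-- The derivatives of the parametrizations. -/
  Φ' : ι → Spacetime n → (Spacetime n →L[ℝ] Spacetime n)
  contDiffOn : ∀ p, ContDiffOn ℝ ∞ (Φ p) A
  hasFDerivAt : ∀ p, ∀ X ∈ A, HasFDerivAt (Φ p) (Φ' p X) X
  injOn : ∀ p, Set.InjOn (Φ p) A
  /-- The order of magnitude of `⟨y⟩`. -/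
  size : ι → ℝ
  size_pos : ∀ p, 0 < size p
  /-- The angular dilation factor. -/
  dil : ι → Spacetime n → ℝ
  dil_pos : ∀ p, ∀ X ∈ A, 0 < dil p X
  det_eq : ∀ p, ∀ X ∈ A, (Φ' p X).det = dil p X ^ ((n : ℝ) - 1)
  /-- The constant in the comparisons. -/
  K : ℝ
  one_le_K : 1 ≤ K
  dil_le : ∀ p, ∀ X ∈ A, dil p X ≤ K * size p
  size_le : ∀ p, ∀ X ∈ A, size p ≤ K * dil p X
  bracket_le : ∀ p, ∀ X ∈ A, 1 + spSq (Φ p X) ≤ K * size p ^ 2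
  le_bracket : ∀ p, ∀ X ∈ A, size p ^ 2 ≤ K * (1 + spSq (Φ p X))
  /-- The bound on the overlap. -/
  M : ℝ≥0
  overlap : ∀ Y, ∑' p, (Φ p '' A).indicator (fun _ => (1 : ℝ≥0∞)) Y ≤ M
  chain : ∀ i : Fin (n + 1), ∃ (J : Type) (_ : Fintype J) (g : J → LGen n)
    (a : J → Spacetime n → ℂ), (∀ j, (g j).order ≤ pdOrder i) ∧ (∀ j, ContDiffOn ℝ ∞ (a j) A) ∧
      ∀ p, ∀ X ∈ A, ∀ F : Test n, fderiv ℝ F.1 (Φ p X) (Φ' p X (unitVec i)) =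
        ∑ j, a j X * ((g j).op F).1 (Φ p X)

variable {ι : Type}

namespace ChartFamily

variable (S : ChartFamily n ι)

/-- The localized pullback `κ · (F ∘ Φ p)`. -/
def cutoffPull (κ : Cutoff S.A) (p : ι) (F : Test n) : Cutoff S.A :=
  κ.smul S.isOpen (F.contDiff.comp_contDiffOn (S.contDiffOn p))

/-- The localized pullback as a test function. -/
def pull (κ : Cutoff S.A) (p : ι) (F : Test n) : Test n := (S.cutoffPull κ p F).1

theorem pull_apply (κ : Cutoff S.A) (p : ι) (F : Test n) (X : Spacetime n) :
    (S.pull κ p F).1 X = κ.1.1 X * F.1 (S.Φ p X) := rfl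

theorem pd_pull (i : Fin (n + 1)) (κ : Cutoff S.A) (p : ι) (F : Test n) {X : Spacetime n}
    (hX : X ∈ S.A) : (pd i (S.pull κ p F)).1 X = (pd i κ.1).1 X * F.1 (S.Φ p X) +
      κ.1.1 X * fderiv ℝ F.1 (S.Φ p X) (S.Φ' p X (unitVec i)) := by
  have h1 := (κ.1.differentiable X).hasFDerivAt
  have h2 := (F.differentiable (S.Φ p X)).hasFDerivAt.comp X (S.hasFDerivAt p X hX)
  have h3 : (pd i (S.pull κ p F)).1 X = _ := congrArg (fun L => L (unitVec i)) (h1.mul h2).fderiv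
  rw [h3]
  simp only [add_apply, smul_apply, smul_eq_mul, ContinuousLinearMap.comp_apply, pd_apply,
    Function.comp_apply]
  ring

theorem pd_pull_mem (i : Fin (n + 1)) (κ : Cutoff S.A) :
    (fun p F => pd i (S.pull κ p F)) ∈
      transfer LGen.order (fun b F => LGen.op b F) S.pull (pdOrder i) := by
  obtain ⟨J, _, g, a, hg, ha, h⟩ := S.chain i
  have e : (fun p F => pd i (S.pull κ p F)) = (fun p F => S.pull (κ.pd i) p F) +
      ∑ j, fun p F => S.pull (κ.smul S.isOpen (ha j)) p ((g j).op F) := by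
    ext1 p
    ext1 F
    refine Test.ext fun X => ?_
    simp only [Pi.add_apply, Finset.sum_apply, Test.add_apply, Test.sum_apply]
    by_cases hX : X ∈ S.A
    · rw [pd_pull S i κ p F hX, h p X hX F, Finset.mul_sum]
      congr 1
      refine Finset.sum_congr rfl fun j _ => ?_
      rw [← mul_assoc]
      rfl
    · refine (((S.cutoffPull κ p F).pd i).eq_zero hX).trans ?_
      simp only [pull_apply, Cutoff.eq_zero _ hX, zero_mul, Finset.sum_const_zero, add_zero]
  rw [e]
  refine Submodule.add_mem _ (transfer_of (τ := S.pull) (κ.pd i) (w := []) (by simp))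
    (Submodule.sum_mem _ fun j _ => ?_)
  exact transfer_of (τ := S.pull) (κ.smul S.isOpen (ha j)) (w := [g j]) (by simpa using hg j)

/-- The `L²` norm of `F ∘ Φ p` over the domain of the chart. -/
def locNorm (p : ι) (F : Test n) : ℝ≥0∞ :=
  eLpNorm (fun X => F.1 (S.Φ p X)) 2 (volume.restrict S.A)

theorem l2Norm_pull_le (κ : Cutoff S.A) :
    ∃ C : ℝ≥0, ∀ p F, l2Norm (S.pull κ p F) ≤ C * S.locNorm p F := by
  obtain ⟨C, hC⟩ := κ.1.hasCompactSupport.exists_bound_of_continuous κ.1.continuous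
  refine ⟨C.toNNReal, fun p F => ?_⟩
  have h : l2Norm (S.pull κ p F) = eLpNorm (S.pull κ p F).1 2 (volume.restrict S.A) := by
    refine (eLpNorm_restrict_eq_of_support_subset fun X hX => ?_).symm
    by_contra h
    exact hX (by rw [pull_apply, κ.eq_zero h, zero_mul])
  rw [h, locNorm]
  refine (eLpNorm_le_mul_eLpNorm_of_ae_le_mul (c := C) (.of_forall fun X => ?_) 2).trans (le_of_eq rfl)
  rw [pull_apply, norm_mul]
  gcongr
  exact hC X

/-- The graph norm of the lens generators over a chart. -/
abbrev locW (a : ℕ) (p : ι) (F : Test n) : ℝ≥0∞ :=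
  wnorm LGen.order (fun b F => LGen.op b F) (S.locNorm p) a F

theorem sobNorm_pull_le (κ : Cutoff S.A) (a : ℕ) :
    ∃ C : ℝ≥0, ∀ p F, sobNorm a (S.pull κ p F) ≤ C * S.locW a p F :=
  wnorm_transfer_le LGen.one_le_order (τ := S.pull) (B := fun i => pd i) (e := pdOrder)
    (fun i κ => S.pd_pull_mem i κ) isGauge_l2Norm (SV := S.locNorm) (S.l2Norm_pull_le) a κ

/-- The multiplication theorem in a chart. -/
theorem lintegral_core_le {a b : ℕ} (hb : 2 ≤ b) (hab : n < 2 * (a + (b - 1))) :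
    ∃ C : ℝ≥0, ∀ p, ∀ F G : Test n, ∫⁻ X in S.core, ‖F.1 (S.Φ p X) * G.1 (S.Φ p X)‖ₑ ^ 2 ≤
      (C * S.locW a p F * S.locW b p G) ^ 2 := by
  obtain ⟨κ, hκ⟩ := exists_cutoff S.isCompact S.isOpen S.core_subset
  obtain ⟨C₁, h₁⟩ := S.sobNorm_pull_le κ a
  obtain ⟨C₂, h₂⟩ := S.sobNorm_pull_le κ b
  obtain ⟨C₃, h₃⟩ := l2Norm_mul_le (n := n) hb hab
  refine ⟨C₃ * C₁ * C₂, fun p F G => ?_⟩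
  calc ∫⁻ X in S.core, ‖F.1 (S.Φ p X) * G.1 (S.Φ p X)‖ₑ ^ 2
      = ∫⁻ X in S.core, ‖((S.pull κ p F).mul (S.pull κ p G)).1 X‖ₑ ^ 2 := by
        refine setLIntegral_congr_fun S.isCompact.measurableSet fun X hX => ?_
        simp only [Test.mul_apply, pull_apply, hκ X hX, one_mul]
    _ ≤ l2Norm ((S.pull κ p F).mul (S.pull κ p G)) ^ 2 := by
        rw [l2Norm, eLpNorm_two_sq]
        exact setLIntegral_le_lintegral _ _
    _ ≤ (C₃ * (C₁ * S.locW a p F) * (C₂ * S.locW b p G)) ^ 2 := by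
        gcongr
        refine (h₃ _ _).trans ?_
        gcongr
        · exact h₁ p F
        · exact h₂ p G
    _ = _ := by push_cast; ring

end ChartFamily

end ModuleRegularity

end

noncomputable section

namespace ModuleRegularity

variable {n : ℕ}

/-! ### Summation over charts -/

theorem rpow_le_of_comparable {X Y K : ℝ} (hX : 0 < X) (hY : 0 < Y) (hK : 1 ≤ K)
    (h₁ : X ≤ K * Y) (h₂ : Y ≤ K * X) (s : ℝ) : X ^ s ≤ K ^ |s| * Y ^ s := by
  have hK0 : 0 < K := by linarith
  rcases le_total 0 s with hs | hs
  · rw [abs_of_nonneg hs, ← Real.mul_rpow hK0.le hY.le]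
    exact Real.rpow_le_rpow hX.le h₁ hs
  · rw [abs_of_nonpos hs]
    have h3 : K⁻¹ * Y ≤ X := by rwa [inv_mul_le_iff₀ hK0]
    have h4 : X ^ s ≤ (K⁻¹ * Y) ^ s := Real.rpow_le_rpow_of_nonpos (by positivity) h3 hs
    rwa [Real.mul_rpow (by positivity) hY.le, Real.inv_rpow hK0.le, ← Real.rpow_neg hK0.le] at h4

theorem sq_sum_le_card_mul {α : Type*} (s : Finset α) (f : α → ℝ≥0∞) :
    (∑ i ∈ s, f i) ^ 2 ≤ s.card * ∑ i ∈ s, f i ^ 2 := by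
  have := ENNReal.rpow_sum_le_const_mul_sum_rpow s f (p := 2) (by norm_num)
  norm_num at this
  exact this

theorem enorm_bracket_sq (s : ℝ) (X : Spacetime n) :
    ‖(bracket n s).1 X‖ₑ ^ 2 = ENNReal.ofReal ((1 + spSq X) ^ s) := by
  have := spSq_nonneg X
  rw [enorm_bracket, ← ENNReal.ofReal_pow (by positivity), ← Real.rpow_natCast, ← Real.rpow_mul
    (by positivity)]
  congr 2
  push_cast
  ring

namespace ChartFamily

variable {ι : Type} (S : ChartFamily n ι)

theorem one_add_spSq_pos (X : Spacetime n) : 0 < 1 + spSq X := by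
  have := spSq_nonneg X
  positivity

/-- The balance of weights in a chart: from the Jacobian and the weight of a product, each factor
receives half a Jacobian. -/
theorem det_mul_bracket_le (s₁ s₂ : ℝ) : ∃ C : ℝ≥0, ∀ p, ∀ X ∈ S.A,
    ENNReal.ofReal |(S.Φ' p X).det| *
      ‖(bracket n (s₁ + s₂ + ((n : ℝ) - 1) / 2)).1 (S.Φ p X)‖ₑ ^ 2 ≤
      C * (ENNReal.ofReal (S.size p ^ (s₁ + ((n : ℝ) - 1) / 2)) *
        ENNReal.ofReal (S.size p ^ (s₂ + ((n : ℝ) - 1) / 2))) ^ 2 := by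
  have hK : 0 < S.K := by linarith [S.one_le_K]
  set σ := s₁ + s₂ + ((n : ℝ) - 1) / 2 with hσ
  refine ⟨(S.K ^ |(n : ℝ) - 1| * S.K ^ |σ|).toNNReal, fun p X hX => ?_⟩
  have hs := S.size_pos p
  have hd := S.dil_pos p X hX
  have h1 := rpow_le_of_comparable hd hs S.one_le_K (S.dil_le p X hX) (S.size_le p X hX)
    ((n : ℝ) - 1)
  have h2 := rpow_le_of_comparable (one_add_spSq_pos (S.Φ p X)) (by positivity) S.one_le_K
    (S.bracket_le p X hX) (S.le_bracket p X hX) σ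
  have hb := one_add_spSq_pos (S.Φ p X)
  rw [S.det_eq p X hX, enorm_bracket_sq, abs_of_nonneg (Real.rpow_nonneg hd.le _),
    ← ENNReal.ofReal_mul (by positivity), ← ENNReal.ofReal_mul (by positivity),
    ← ENNReal.ofReal_pow (by positivity), ← ENNReal.ofReal_coe_nnreal (p := Real.toNNReal _),
    Real.coe_toNNReal _ (by positivity), ← ENNReal.ofReal_mul (by positivity)]
  refine ENNReal.ofReal_le_ofReal ?_
  calc S.dil p X ^ ((n : ℝ) - 1) * (1 + spSq (S.Φ p X)) ^ σ
      ≤ (S.K ^ |(n : ℝ) - 1| * S.size p ^ ((n : ℝ) - 1)) * (S.K ^ |σ| * (S.size p ^ 2) ^ σ) := by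
        gcongr
    _ = _ := by
        rw [← Real.rpow_natCast _ 2, ← Real.rpow_mul hs.le, ← Real.rpow_add hs,
          ← Real.rpow_natCast _ 2, ← Real.rpow_mul hs.le, mul_mul_mul_comm, ← Real.rpow_add hs]
        congr 2
        rw [hσ]
        push_cast
        ring

theorem size_le_det_mul_bracket (s : ℝ) : ∃ C : ℝ≥0, ∀ p, ∀ X ∈ S.A,
    ENNReal.ofReal (S.size p ^ (s + ((n : ℝ) - 1) / 2)) ^ 2 ≤
      C * (ENNReal.ofReal |(S.Φ' p X).det| * ‖(bracket n s).1 (S.Φ p X)‖ₑ ^ 2) := by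
  have hK : 0 < S.K := by linarith [S.one_le_K]
  refine ⟨(S.K ^ |(n : ℝ) - 1| * S.K ^ |s|).toNNReal, fun p X hX => ?_⟩
  have hs := S.size_pos p
  have hd := S.dil_pos p X hX
  have h1 := rpow_le_of_comparable hs hd S.one_le_K (S.size_le p X hX) (S.dil_le p X hX)
    ((n : ℝ) - 1)
  have h2 := rpow_le_of_comparable (by positivity) (one_add_spSq_pos (S.Φ p X)) S.one_le_K
    (S.le_bracket p X hX) (S.bracket_le p X hX) s
  have hb := one_add_spSq_pos (S.Φ p X)
  rw [S.det_eq p X hX, enorm_bracket_sq, abs_of_nonneg (Real.rpow_nonneg hd.le _),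
    ← ENNReal.ofReal_mul (by positivity),
    ← ENNReal.ofReal_pow (by positivity), ← ENNReal.ofReal_coe_nnreal (p := Real.toNNReal _),
    Real.coe_toNNReal _ (by positivity), ← ENNReal.ofReal_mul (by positivity)]
  refine ENNReal.ofReal_le_ofReal ?_
  calc (S.size p ^ (s + ((n : ℝ) - 1) / 2)) ^ 2
      = S.size p ^ ((n : ℝ) - 1) * (S.size p ^ 2) ^ s := by
        rw [← Real.rpow_natCast _ 2, ← Real.rpow_mul hs.le, ← Real.rpow_natCast _ 2,
          ← Real.rpow_mul hs.le, ← Real.rpow_add hs]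
        congr 1
        push_cast
        ring
    _ ≤ (S.K ^ |(n : ℝ) - 1| * S.dil p X ^ ((n : ℝ) - 1)) *
        (S.K ^ |s| * (1 + spSq (S.Φ p X)) ^ s) := by gcongr
    _ = _ := by ring

/-- The weighted norm over the region covered by a chart. -/
def regNorm (s : ℝ) (p : ι) (F : Test n) : ℝ≥0∞ :=
  eLpNorm (fun X => (bracket n s).1 X * F.1 X) 2 (volume.restrict (S.Φ p '' S.A))

theorem lintegral_image {B : Set (Spacetime n)} (hB : MeasurableSet B) (hBA : B ⊆ S.A) (p : ι)
    (g : Spacetime n → ℝ≥0∞) : ∫⁻ Y in S.Φ p '' B, g Y =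
      ∫⁻ X in B, ENNReal.ofReal |(S.Φ' p X).det| * g (S.Φ p X) :=
  lintegral_image_eq_lintegral_abs_det_fderiv_mul volume hB
    (fun X hX => (S.hasFDerivAt p X (hBA hX)).hasFDerivWithinAt) ((S.injOn p).mono hBA) g

theorem measurable_comp_Φ (p : ι) {F : Spacetime n → ℂ} (hF : Continuous F) :
    AEMeasurable (fun X => ‖F (S.Φ p X)‖ₑ ^ 2) (volume.restrict S.A) :=
  ((hF.comp_continuousOn (S.contDiffOn p).continuousOn).enorm.aemeasurable
    S.isOpen.measurableSet).pow_const 2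

theorem size_mul_locNorm_le (s : ℝ) : ∃ C : ℝ≥0, ∀ p (F : Test n),
    ENNReal.ofReal (S.size p ^ (s + ((n : ℝ) - 1) / 2)) * S.locNorm p F ≤ C * S.regNorm s p F := by
  obtain ⟨C, hC⟩ := S.size_le_det_mul_bracket s
  refine ⟨NNReal.sqrt C, fun p F => ?_⟩
  refine (ENNReal.pow_le_pow_left_iff (n := 2) two_ne_zero).1 ?_
  rw [mul_pow, mul_pow, ← ENNReal.coe_pow, NNReal.sq_sqrt, locNorm, regNorm, eLpNorm_two_sq,
    eLpNorm_two_sq, S.lintegral_image S.isOpen.measurableSet le_rfl,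
    ← lintegral_const_mul'' _ (S.measurable_comp_Φ p F.continuous),
    ← lintegral_const_mul' _ _ ENNReal.coe_ne_top]
  refine setLIntegral_mono_ae' S.isOpen.measurableSet (.of_forall fun X hX => ?_)
  rw [enorm_mul, mul_pow, ← mul_assoc (ENNReal.ofReal _), ← mul_assoc]
  gcongr
  exact hC p X hX

/-- The graph norm of the lens generators over the region covered by a chart. -/
abbrev regW (s : ℝ) (a : ℕ) (p : ι) (F : Test n) : ℝ≥0∞ :=
  wnorm LGen.order (fun b F => LGen.op b F) (S.regNorm s p) a F

theorem size_mul_locW_le (s : ℝ) (a : ℕ) : ∃ C : ℝ≥0, ∀ p (F : Test n),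
    ENNReal.ofReal (S.size p ^ (s + ((n : ℝ) - 1) / 2)) * S.locW a p F ≤ C * S.regW s a p F := by
  obtain ⟨C, hC⟩ := S.size_mul_locNorm_le s
  refine ⟨C, fun p F => ?_⟩
  simp only [wnorm, Finset.mul_sum]
  exact Finset.sum_le_sum fun w _ => hC p _

theorem regNorm_le (s : ℝ) (p : ι) (F : Test n) : S.regNorm s p F ≤ lensNorm s F :=
  eLpNorm_mono_measure _ Measure.restrict_le_self

theorem tsum_regNorm_sq_le [Countable ι] (s : ℝ) (F : Test n) :
    ∑' p, S.regNorm s p F ^ 2 ≤ S.M * lensNorm s F ^ 2 := by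
  have hm : ∀ p, MeasurableSet (S.Φ p '' S.A) := fun p =>
    measurable_image_of_fderivWithin S.isOpen.measurableSet
      (fun X hX => (S.hasFDerivAt p X hX).hasFDerivWithinAt) (S.injOn p)
  have hc : Measurable fun X => ‖(bracket n s).1 X * F.1 X‖ₑ ^ 2 :=
    ((bracket n s).2.continuous.mul F.continuous).enorm.measurable.pow_const 2
  simp only [regNorm, lensNorm, eLpNorm_two_sq]
  calc ∑' p, ∫⁻ X in S.Φ p '' S.A, ‖(bracket n s).1 X * F.1 X‖ₑ ^ 2
      = ∫⁻ X, ∑' p, (S.Φ p '' S.A).indicator (fun _ => (1 : ℝ≥0∞)) X *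
          ‖(bracket n s).1 X * F.1 X‖ₑ ^ 2 := by
        rw [lintegral_tsum fun p => show AEMeasurable (fun X => (S.Φ p '' S.A).indicator
          (fun _ => (1 : ℝ≥0∞)) X * ‖(bracket n s).1 X * F.1 X‖ₑ ^ 2) volume from
          ((measurable_const.indicator (hm p)).mul hc).aemeasurable]
        refine tsum_congr fun p => ?_
        rw [← lintegral_indicator (hm p)]
        refine lintegral_congr fun X => ?_
        by_cases hX : X ∈ S.Φ p '' S.A <;> simp [hX]
    _ ≤ ∫⁻ X, S.M * ‖(bracket n s).1 X * F.1 X‖ₑ ^ 2 := by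
        refine lintegral_mono fun X => ?_
        rw [ENNReal.tsum_mul_right]
        gcongr
        exact S.overlap X
    _ = _ := lintegral_const_mul' _ _ ENNReal.coe_ne_top

/-- The weighted multiplication estimate on the union of the chart cores. -/
theorem lintegral_iUnion_core_le [Countable ι] {a b : ℕ} (hb : 2 ≤ b) (hab : n < 2 * (a + (b - 1)))
    (s₁ s₂ : ℝ) : ∃ C : ℝ≥0, ∀ F G : Test n,
    ∫⁻ Y in ⋃ p, S.Φ p '' S.core,
        ‖(bracket n (s₁ + s₂ + ((n : ℝ) - 1) / 2)).1 Y * (F.mul G).1 Y‖ₑ ^ 2 ≤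
      C * (wnorm LGen.order (fun b F => LGen.op b F) (lensNorm s₁) a F *
        wnorm LGen.order (fun b F => LGen.op b F) (lensNorm s₂) b G) ^ 2 := by
  obtain ⟨C, hC⟩ := S.lintegral_core_le hb hab
  obtain ⟨C₁, h₁⟩ := S.size_mul_locW_le s₁ a
  obtain ⟨C₂, h₂⟩ := S.size_mul_locW_le s₂ b
  obtain ⟨C₃, h₃⟩ := S.det_mul_bracket_le s₁ s₂
  set N := (wordsLE (LGen.order (n := n)) b).card
  have hloc : ∀ p, ∀ F G : Test n, ∫⁻ Y in S.Φ p '' S.core,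
      ‖(bracket n (s₁ + s₂ + ((n : ℝ) - 1) / 2)).1 Y * (F.mul G).1 Y‖ₑ ^ 2 ≤
      C₃ * (C * (C₁ * S.regW s₁ a p F) * (C₂ * S.regW s₂ b p G)) ^ 2 := by
    intro p F G
    set m₁ := ENNReal.ofReal (S.size p ^ (s₁ + ((n : ℝ) - 1) / 2))
    set m₂ := ENNReal.ofReal (S.size p ^ (s₂ + ((n : ℝ) - 1) / 2))
    rw [S.lintegral_image S.isCompact.measurableSet S.core_subset]
    calc _ ≤ ∫⁻ X in S.core, (C₃ * (m₁ * m₂) ^ 2) * ‖F.1 (S.Φ p X) * G.1 (S.Φ p X)‖ₑ ^ 2 := by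
          refine setLIntegral_mono_ae' S.isCompact.measurableSet (.of_forall fun X hX => ?_)
          rw [enorm_mul, mul_pow, ← mul_assoc]
          exact mul_le_mul' (h₃ p X (S.core_subset hX)) le_rfl
      _ = (C₃ * (m₁ * m₂) ^ 2) * ∫⁻ X in S.core, ‖F.1 (S.Φ p X) * G.1 (S.Φ p X)‖ₑ ^ 2 :=
          lintegral_const_mul' _ _ (by finiteness)
      _ ≤ (C₃ * (m₁ * m₂) ^ 2) * (C * S.locW a p F * S.locW b p G) ^ 2 := by
          gcongr; exact hC p F G
      _ = C₃ * (C * (m₁ * S.locW a p F) * (m₂ * S.locW b p G)) ^ 2 := by ring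
      _ ≤ _ := by
          exact mul_le_mul' le_rfl (pow_le_pow_left' (mul_le_mul' (mul_le_mul' le_rfl (h₁ p F))
            (h₂ p G)) 2)
  refine ⟨C₃ * (C * C₁ * C₂) ^ 2 * (N * S.M), fun F G => ?_⟩
  set WF := wnorm LGen.order (fun b F => LGen.op b F) (lensNorm s₁) a F
  set WG := wnorm LGen.order (fun b F => LGen.op b F) (lensNorm s₂) b G with hWG
  -- one factor is bounded uniformly in the charts, the other one is summed over them
  have hF : ∀ p, S.regW s₁ a p F ≤ WF := fun p => Finset.sum_le_sum fun w _ => S.regNorm_le _ _ _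
  have hG : ∑' p, S.regW s₂ b p G ^ 2 ≤ N * S.M * WG ^ 2 := by
    calc ∑' p, S.regW s₂ b p G ^ 2
        ≤ ∑' p, N * ∑ w ∈ wordsLE LGen.order b,
            S.regNorm s₂ p (act (fun b F => LGen.op b F) w G) ^ 2 :=
          ENNReal.tsum_le_tsum fun p => sq_sum_le_card_mul _ _
      _ = N * ∑ w ∈ wordsLE LGen.order b,
            ∑' p, S.regNorm s₂ p (act (fun b F => LGen.op b F) w G) ^ 2 := by
          rw [ENNReal.tsum_mul_left, Summable.tsum_finsetSum fun _ _ => ENNReal.summable]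
      _ ≤ N * ∑ w ∈ wordsLE LGen.order b,
            S.M * lensNorm s₂ (act (fun b F => LGen.op b F) w G) ^ 2 := by
          gcongr; exact S.tsum_regNorm_sq_le _ _
      _ ≤ _ := by
          rw [← Finset.mul_sum, mul_assoc]
          gcongr
          rw [hWG, wnorm, sq, Finset.sum_mul]
          refine Finset.sum_le_sum fun w hw => ?_
          rw [sq]
          gcongr
          exact Finset.single_le_sum (f := fun w => lensNorm s₂ (act (fun b F => LGen.op b F) w G))
            (fun _ _ => zero_le) hw
  calc _ ≤ ∑' p, ∫⁻ Y in S.Φ p '' S.core,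
        ‖(bracket n (s₁ + s₂ + ((n : ℝ) - 1) / 2)).1 Y * (F.mul G).1 Y‖ₑ ^ 2 :=
        lintegral_iUnion_le _ _
    _ ≤ ∑' p, (C₃ * (C * C₁ * C₂ * WF) ^ 2) * S.regW s₂ b p G ^ 2 := by
        refine ENNReal.tsum_le_tsum fun p => (hloc p F G).trans ?_
        calc _ = (C₃ * (C * C₁ * C₂ * S.regW s₁ a p F) ^ 2) * S.regW s₂ b p G ^ 2 := by ring
          _ ≤ _ := by gcongr; exact hF p
    _ = (C₃ * (C * C₁ * C₂ * WF) ^ 2) * ∑' p, S.regW s₂ b p G ^ 2 := ENNReal.tsum_mul_left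
    _ ≤ (C₃ * (C * C₁ * C₂ * WF) ^ 2) * (N * S.M * WG ^ 2) := by gcongr
    _ = _ := by push_cast; ring

end ChartFamily

end ModuleRegularity

end

noncomputable section

namespace ModuleRegularity

open scoped ContDiff

variable {n : ℕ}

/-! ### The two chart families -/

theorem tsum_le_card {ι : Type*} (s : Finset ι) {f : ι → ℝ≥0∞} (h₁ : ∀ i, f i ≤ 1)
    (h₀ : ∀ i ∉ s, f i = 0) : ∑' i, f i ≤ s.card := by
  rw [tsum_eq_sum h₀, ← mul_one (s.card : ℝ≥0∞), ← nsmul_eq_mul]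
  exact Finset.sum_le_card_nsmul _ _ _ fun i _ => h₁ i

/-- The integers at distance less than `3` from `x`, with some slack. -/
def nearInt (x : ℝ) : Finset ℤ := Finset.Icc (⌊x⌋ - 2) (⌊x⌋ + 3)

theorem card_nearInt (x : ℝ) : (nearInt x).card = 6 := by
  rw [nearInt, Int.card_Icc]; ring_nf; rfl

theorem mem_nearInt {x : ℝ} {m : ℤ} (h : |x - m| < 3) : m ∈ nearInt x := by
  rw [abs_lt] at h
  rw [nearInt, Finset.mem_Icc]
  have h1 := Int.floor_le x
  have h2 := Int.lt_floor_add_one x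
  constructor
  · have : (⌊x⌋ : ℝ) < ((m + 3 : ℤ) : ℝ) := by push_cast; linarith
    have := Int.cast_lt.1 this
    omega
  · have : (m : ℝ) < ((⌊x⌋ + 4 : ℤ) : ℝ) := by push_cast; linarith
    have := Int.cast_lt.1 this
    omega

theorem indicator_one_le (s : Set (Spacetime n)) (Y : Spacetime n) :
    s.indicator (fun _ => (1 : ℝ≥0∞)) Y ≤ 1 := by
  by_cases h : Y ∈ s <;> simp [h]

theorem continuous_time : Continuous (time (n := n)) := (timeL (n := n)).continuous

theorem isCompact_of_spSq_le {K : Set (Spacetime n)} (hK : IsClosed K)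
    (h : ∀ X ∈ K, spSq X ≤ 4 ∧ |time X| ≤ 1) : IsCompact K := by
  refine (isCompact_closedBall (0 : Spacetime n) 3).of_isClosed_subset hK fun X hX => ?_
  rw [mem_closedBall_zero_iff]
  obtain ⟨h1, h2⟩ := h X hX
  refine (sq_le_sq₀ (norm_nonneg _) (by norm_num)).1 ?_
  rw [norm_sq_eq_spSq_add, ← sq_abs (time X)]
  nlinarith [abs_nonneg (time X)]

theorem spSq_add_smul_eT (X : Spacetime n) (a : ℝ) : spSq (X + a • eT) = spSq X := by
  simp [spSq]

/-- Time translates of a ball around the origin in space. -/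
def ballCharts (n : ℕ) : ChartFamily n ℤ where
  A := {X | spSq X < 4 ∧ |time X| < 1}
  core := {X | spSq X ≤ 1 ∧ |time X| ≤ 1 / 2}
  isOpen := (isOpen_lt continuous_spSq continuous_const).inter
    (isOpen_lt continuous_time.abs continuous_const)
  isCompact := isCompact_of_spSq_le ((isClosed_le continuous_spSq continuous_const).inter
    (isClosed_le continuous_time.abs continuous_const))
    fun X (hX : spSq X ≤ 1 ∧ |time X| ≤ 1 / 2) => ⟨by linarith, by linarith⟩
  core_subset := fun X (hX : spSq X ≤ 1 ∧ |time X| ≤ 1 / 2) =>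
    show spSq X < 4 ∧ |time X| < 1 from ⟨by linarith, by linarith⟩
  Φ m X := X + (m : ℝ) • eT
  Φ' _ _ := ContinuousLinearMap.id ℝ _
  contDiffOn m := (contDiff_id.add contDiff_const).contDiffOn
  hasFDerivAt m X _ := (hasFDerivAt_id X).add_const _
  injOn m := (add_left_injective _).injOn
  size _ := 1
  size_pos _ := one_pos
  dil _ _ := 1
  dil_pos _ _ _ := one_pos
  det_eq _ _ _ := by
    rw [Real.one_rpow, ContinuousLinearMap.det, ContinuousLinearMap.coe_id, LinearMap.det_id]
  K := 5
  one_le_K := by norm_num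
  dil_le _ _ _ := by norm_num
  size_le _ _ _ := by norm_num
  bracket_le m X hX := by
    have h : spSq X < 4 := hX.1
    rw [spSq_add_smul_eT]
    linarith
  le_bracket m X _ := by
    have := spSq_nonneg (X + (m : ℝ) • eT)
    nlinarith
  M := 6
  overlap Y := by
    refine (tsum_le_card (nearInt (time Y)) (fun _ => indicator_one_le _ _) fun m hm => ?_).trans
      (by rw [card_nearInt]; norm_num)
    refine Set.indicator_of_notMem ?_ _
    rintro ⟨X, hX, rfl⟩
    have hX2 : |time X| < 1 := hX.2
    refine hm (mem_nearInt ?_)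
    simp only [time_add, time_smul, time_eT, mul_one, add_sub_cancel_right]
    linarith
  chain i := by
    refine Fin.lastCases ?_ (fun j => ?_) i
    · refine ⟨Unit, inferInstance, fun _ => .time, fun _ _ => 1, fun _ => ?_,
        fun _ => contDiffOn_const, fun m X _ F => ?_⟩
      · simp [LGen.order, pdOrder]
      · simp [LGen.op, pd_apply]
    · refine ⟨Unit, inferInstance, fun _ => .deriv j, fun _ _ => 1, fun _ => ?_,
        fun _ => contDiffOn_const, fun m X _ F => ?_⟩
      · simp [LGen.order, pdOrder, (Fin.castSucc_lt_last j).ne]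
      · simp [LGen.op, pd_apply]

/-- The spatial radius. -/
def rad (X : Spacetime n) : ℝ := √(spSq X)

theorem rad_sq (X : Spacetime n) : rad X ^ 2 = spSq X := Real.sq_sqrt (spSq_nonneg X)

/-- The spatial part of a point. -/
def spPart (X : Spacetime n) : Spacetime n := X - time X • eT

@[simp] theorem time_spPart (X : Spacetime n) : time (spPart X) = 0 := by
  simp [spPart, time_sub, time_smul]

@[simp] theorem spPart_castSucc (X : Spacetime n) (j : Fin n) :
    spPart X j.castSucc = X j.castSucc := by
  simp [spPart]

/-- The spatial inner product with `X`. -/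
def spInner (X : Spacetime n) : Spacetime n →L[ℝ] ℝ :=
  ∑ j : Fin n, X j.castSucc • (EuclideanSpace.proj j.castSucc : Spacetime n →L[ℝ] ℝ)

theorem spInner_apply (X v : Spacetime n) :
    spInner X v = ∑ j : Fin n, X j.castSucc * v j.castSucc := by
  simp [spInner, sum_apply]

theorem spInner_spPart (X : Spacetime n) : spInner X (spPart X) = spSq X := by
  simp [spInner_apply, spSq, sq]

/-- The radial shift by `j` combined with the time shift by `m`. -/
def shellMap (p : ℕ × ℤ) (X : Spacetime n) : Spacetime n :=
  X + (p.1 * (rad X)⁻¹) • spPart X + (p.2 : ℝ) • eT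

theorem shellMap_castSucc (p : ℕ × ℤ) (X : Spacetime n) (j : Fin n) :
    shellMap p X j.castSucc = (1 + p.1 * (rad X)⁻¹) * X j.castSucc := by
  have : shellMap p X j.castSucc = X j.castSucc + (p.1 * (rad X)⁻¹) * spPart X j.castSucc +
    (p.2 : ℝ) * (eT : Spacetime n) j.castSucc := rfl
  rw [this, spPart_castSucc, eT_castSucc]
  ring

theorem time_shellMap (p : ℕ × ℤ) (X : Spacetime n) : time (shellMap p X) = time X + p.2 := by
  simp [shellMap, time_add, time_smul]

theorem spSq_shellMap (p : ℕ × ℤ) {X : Spacetime n} (hX : 0 < rad X) :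
    spSq (shellMap p X) = (rad X + p.1) ^ 2 := by
  have : spSq (shellMap p X) = (1 + p.1 * (rad X)⁻¹) ^ 2 * spSq X := by
    simp only [spSq, shellMap_castSucc, mul_pow, Finset.mul_sum]
  rw [this, ← rad_sq]
  field_simp

theorem ext_castSucc_time {X Y : Spacetime n} (h : ∀ j : Fin n, X j.castSucc = Y j.castSucc)
    (ht : time X = time Y) : X = Y := by
  ext a
  induction a using Fin.lastCases with
  | last => exact ht
  | cast j => exact h j

theorem shellMap_injOn (p : ℕ × ℤ) : Set.InjOn (shellMap p) {X : Spacetime n | 0 < rad X} := by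
  intro X (hX : 0 < rad X) Y (hY : 0 < rad Y) h
  have h1 : (rad X + p.1) ^ 2 = (rad Y + p.1) ^ 2 := by
    rw [← spSq_shellMap p hX, ← spSq_shellMap p hY, h]
  have h2 : rad X = rad Y := by
    have := (pow_left_inj₀ (by positivity) (by positivity) two_ne_zero).1 h1
    linarith
  refine ext_castSucc_time (fun j => ?_) ?_
  · have h3 : shellMap p X j.castSucc = shellMap p Y j.castSucc := by rw [h]
    rw [shellMap_castSucc, shellMap_castSucc, h2] at h3
    exact mul_left_cancel₀ (by positivity) h3
  · have h3 : time (shellMap p X) = time (shellMap p Y) := by rw [h]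
    rw [time_shellMap, time_shellMap] at h3
    linarith

/-- The derivative of the shell map. -/
def shellDeriv (p : ℕ × ℤ) (X : Spacetime n) : Spacetime n →L[ℝ] Spacetime n :=
  ContinuousLinearMap.id ℝ _ +
    (p.1 * (rad X)⁻¹) • (ContinuousLinearMap.id ℝ _ - timeL.smulRight eT) -
    (p.1 * (rad X)⁻¹ ^ 3) • (spInner X).smulRight (spPart X)

theorem shellDeriv_apply (p : ℕ × ℤ) (X v : Spacetime n) : shellDeriv p X v =
    v + (p.1 * (rad X)⁻¹) • spPart v - (p.1 * (rad X)⁻¹ ^ 3) • spInner X v • spPart X := rfl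

theorem hasFDerivAt_shellMap (p : ℕ × ℤ) {X : Spacetime n} (hX : 0 < rad X) :
    HasFDerivAt (shellMap p) (shellDeriv p X) X := by
  have hs : spSq X ≠ 0 := by rw [← rad_sq]; positivity
  have h1 : HasFDerivAt (fun Y : Spacetime n => (rad Y)⁻¹) (-((rad X)⁻¹ ^ 3) • spInner X) X := by
    have h2 := (hasDerivAt_inv hX.ne').comp_hasFDerivAt X ((hasFDerivAt_spSq X).sqrt hs)
    refine h2.congr_fderiv ?_
    ext1 v
    simp only [smul_apply, spInner_apply, sum_apply, PiLp.proj_apply, smul_eq_mul]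
    change -(rad X ^ 2)⁻¹ * (1 / (2 * rad X) * _) = _
    rw [show ∑ j : Fin n, 2 * X j.castSucc * v j.castSucc =
      2 * ∑ j : Fin n, X j.castSucc * v j.castSucc by
        rw [Finset.mul_sum]; exact Finset.sum_congr rfl fun _ _ => by ring]
    field_simp
  have h3 : HasFDerivAt (spPart (n := n)) (ContinuousLinearMap.id ℝ _ - timeL.smulRight eT) X :=
    (ContinuousLinearMap.id ℝ (Spacetime n) - timeL.smulRight eT).hasFDerivAt
  have h4 := ((hasFDerivAt_id X).add ((h1.const_mul (p.1 : ℝ)).smul h3)).add_const ((p.2 : ℝ) • eT)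
  refine h4.congr_fderiv ?_
  ext1 v
  simp only [shellDeriv, add_apply, sub_apply, smul_apply, ContinuousLinearMap.smulRight_apply,
    ContinuousLinearMap.id_apply, smul_eq_mul]
  module

/-- The shell map dilates by `1 + j / |y|`, except in the radial and in the time direction. -/
theorem det_shellDeriv (p : ℕ × ℤ) {X : Spacetime n} (hX : 0 < rad X) :
    (shellDeriv p X).det = (1 + p.1 * (rad X)⁻¹) ^ ((n : ℝ) - 1) := by
  set d := 1 + p.1 * (rad X)⁻¹ with hd
  have hd0 : 0 < d := by positivity
  set β : ℝ := 1 - d⁻¹ with hβ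
  -- a homothety, with the time direction and the radial direction restored by transvections
  have h : ((shellDeriv p X : Spacetime n →L[ℝ] Spacetime n) : Spacetime n →ₗ[ℝ] Spacetime n) =
      d • ((LinearMap.transvection (timeL (n := n)).toLinearMap (-β • eT)) *
        (LinearMap.transvection (spInner X).toLinearMap ((-β * (rad X)⁻¹ ^ 2) • spPart X))) := by
    ext1 v
    simp only [LinearMap.smul_apply, Module.End.mul_apply, LinearMap.transvection.apply,
      ContinuousLinearMap.coe_coe, shellDeriv_apply, timeL_apply, time_add, time_smul, time_spPart,
      mul_zero, add_zero]
    have e : d * β = p.1 * (rad X)⁻¹ := by rw [hβ, mul_sub, mul_inv_cancel₀ hd0.ne', hd]; ring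
    have e3 : (p.1 : ℝ) * (rad X)⁻¹ ^ 3 = d * β * (rad X)⁻¹ ^ 2 := by rw [e]; ring
    rw [e3, ← e]
    have e2 : d * β = d - 1 := by rw [hβ, mul_sub, mul_inv_cancel₀ hd0.ne', mul_one]
    rw [show spPart v = v - time v • eT from rfl]
    have hdec : d • v = v + (d * β) • v := by rw [e2]; module
    rw [smul_add, smul_add, hdec]
    module
  have h2 : (spInner X).toLinearMap ((-β * (rad X)⁻¹ ^ 2) • spPart X) = -β := by
    rw [ContinuousLinearMap.coe_coe, map_smul, spInner_spPart, ← rad_sq, smul_eq_mul]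
    field_simp
  have h3 : (timeL (n := n)).toLinearMap (-β • eT) = -β := by
    rw [ContinuousLinearMap.coe_coe, timeL_apply, time_smul, time_eT, mul_one]
  rw [ContinuousLinearMap.det, h, LinearMap.det_smul, map_mul, LinearMap.transvection.det,
    LinearMap.transvection.det, h2, h3, finrank_euclideanSpace_fin, hβ, Real.rpow_sub_one hd0.ne',
    Real.rpow_natCast, pow_succ]
  field_simp
  ring

end ModuleRegularity

end

noncomputable section

namespace ModuleRegularity

open scoped ContDiff

variable {n : ℕ}

theorem rad_pos_of_spSq {X : Spacetime n} (h : 1 / 4 < spSq X) : 1 / 2 < rad X :=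
  Real.lt_sqrt_of_sq_lt (by linarith)

theorem rad_lt_of_spSq {X : Spacetime n} (h : spSq X < 9) : rad X < 3 :=
  (Real.sqrt_lt' (by norm_num)).2 (by linarith)

theorem contDiffOn_rad_inv {A : Set (Spacetime n)} (hA : ∀ X ∈ A, spSq X ≠ 0) :
    ContDiffOn ℝ ∞ (fun X : Spacetime n => (rad X)⁻¹) A := by
  have h : ContDiffOn ℝ ∞ (fun X : Spacetime n => √(spSq X)) A :=
    contDiff_spSq.contDiffOn.sqrt hA
  exact h.inv fun X hX h0 => hA X hX (by
    have := rad_sq X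
    rw [show rad X = 0 from h0] at this
    simpa using this.symm)

/-- The chain rule for the shell map: the spatial derivatives are radial derivatives, unaffected by
the shift, plus angular derivatives, which are rotations with bounded coefficients. -/
theorem fderiv_shellDeriv (p : ℕ × ℤ) {X : Spacetime n} (hX : 0 < rad X) (i : Fin n)
    (F : Test n) : fderiv ℝ F.1 (shellMap p X) (shellDeriv p X (unitVec i.castSucc)) =
      ∑ l : Fin n, ((X l.castSucc / spSq X : ℝ) : ℂ) * ((LGen.rot l i).op F).1 (shellMap p X) +
      ∑ l : Fin n, ((X i.castSucc * X l.castSucc / spSq X : ℝ) : ℂ) *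
        ((LGen.deriv l).op F).1 (shellMap p X) := by
  set D : Fin n → ℂ := fun l => (pd l.castSucc F).1 (shellMap p X) with hD
  set d : ℝ := 1 + p.1 * (rad X)⁻¹ with hd
  have e1 : spInner X (unitVec i.castSucc) = X i.castSucc := by
    rw [spInner_apply, sum_mul_unitVec_castSucc]
  have e2 : fderiv ℝ F.1 (shellMap p X) (spPart X) = ∑ l : Fin n, (X l.castSucc : ℂ) * D l := by
    rw [spPart, sub_time_smul_eT, map_sum]
    refine Finset.sum_congr rfl fun l _ => ?_
    rw [map_smul, Complex.real_smul]
    rfl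
  have e3 : spPart (unitVec i.castSucc : Spacetime n) = unitVec i.castSucc := by
    rw [spPart, time_unitVec_castSucc, zero_smul, sub_zero]
  have e4 : ∀ l, ((LGen.rot l i).op F).1 (shellMap p X) =
      (d : ℂ) * ((X l.castSucc : ℂ) * D i - (X i.castSucc : ℂ) * D l) := by
    intro l
    have : ((LGen.rot l i).op F).1 (shellMap p X) = coord l.castSucc (shellMap p X) * D i -
      coord i.castSucc (shellMap p X) * D l := rfl
    rw [this, coord, coord, shellMap_castSucc, shellMap_castSucc, hd]
    push_cast
    ring
  have e5 : ∀ l, ((LGen.deriv l).op F).1 (shellMap p X) = D l := fun _ => rfl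
  have hsp : (spSq X : ℂ) = ∑ l : Fin n, (X l.castSucc : ℂ) * (X l.castSucc : ℂ) := by
    simp [spSq, sq]
  have hs : (spSq X : ℂ) ≠ 0 := by
    rw [← rad_sq]; exact_mod_cast (pow_pos hX 2).ne'
  have s1 : ∑ l : Fin n, ((X l.castSucc / spSq X : ℝ) : ℂ) *
      ((d : ℂ) * ((X l.castSucc : ℂ) * D i - (X i.castSucc : ℂ) * D l)) =
      (d : ℂ) * D i - (d : ℂ) * (X i.castSucc : ℂ) / (spSq X : ℂ) *
        ∑ l : Fin n, (X l.castSucc : ℂ) * D l := by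
    have : (d : ℂ) * D i = ∑ l : Fin n, (d : ℂ) * D i / (spSq X : ℂ) *
        ((X l.castSucc : ℂ) * (X l.castSucc : ℂ)) := by
      rw [← Finset.mul_sum, ← hsp, div_mul_cancel₀ _ hs]
    rw [this, Finset.mul_sum, ← Finset.sum_sub_distrib]
    refine Finset.sum_congr rfl fun l _ => ?_
    push_cast
    ring
  have s2 : ∑ l : Fin n, ((X i.castSucc * X l.castSucc / spSq X : ℝ) : ℂ) * D l =
      (X i.castSucc : ℂ) / (spSq X : ℂ) * ∑ l : Fin n, (X l.castSucc : ℂ) * D l := by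
    rw [Finset.mul_sum]
    refine Finset.sum_congr rfl fun l _ => ?_
    push_cast
    ring
  simp only [e4, e5, s1, s2]
  rw [shellDeriv_apply, e1, e3, map_sub, map_add, map_smul, map_smul, map_smul, e2]
  simp only [Complex.real_smul]
  change D i + _ * D i - _ = _
  have hr : (rad X : ℂ) ≠ 0 := by exact_mod_cast hX.ne'
  rw [← rad_sq, hd]
  push_cast
  field_simp
  ring

/-- Annuli in space, shifted radially and in time. -/
def shellCharts (n : ℕ) : ChartFamily n (ℕ × ℤ) where
  A := {X | (1 / 4 < spSq X ∧ spSq X < 9) ∧ |time X| < 1}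
  core := {X | (1 ≤ spSq X ∧ spSq X ≤ 4) ∧ |time X| ≤ 1 / 2}
  isOpen := ((isOpen_lt continuous_const continuous_spSq).inter
    (isOpen_lt continuous_spSq continuous_const)).inter
    (isOpen_lt continuous_time.abs continuous_const)
  isCompact := isCompact_of_spSq_le (((isClosed_le continuous_const continuous_spSq).inter
    (isClosed_le continuous_spSq continuous_const)).inter
    (isClosed_le continuous_time.abs continuous_const))
    fun X (hX : (1 ≤ spSq X ∧ spSq X ≤ 4) ∧ |time X| ≤ 1 / 2) => ⟨hX.1.2, by linarith⟩
  core_subset := fun X (hX : (1 ≤ spSq X ∧ spSq X ≤ 4) ∧ |time X| ≤ 1 / 2) =>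
    show (1 / 4 < spSq X ∧ spSq X < 9) ∧ |time X| < 1 from
      ⟨⟨by linarith, by linarith⟩, by linarith⟩
  Φ := shellMap
  Φ' := shellDeriv
  contDiffOn p := by
    have h1 := contDiffOn_rad_inv (n := n)
      (A := {X | (1 / 4 < spSq X ∧ spSq X < 9) ∧ |time X| < 1})
      fun X (hX : (1 / 4 < spSq X ∧ spSq X < 9) ∧ |time X| < 1) => by linarith
    have h2 : ContDiff ℝ ∞ (spPart (n := n)) :=
      (ContinuousLinearMap.id ℝ (Spacetime n) - timeL.smulRight eT).contDiff
    exact (contDiff_id.contDiffOn.add ((contDiffOn_const.mul h1).smul h2.contDiffOn)).add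
      contDiffOn_const
  hasFDerivAt p X hX := hasFDerivAt_shellMap p (by linarith [rad_pos_of_spSq hX.1.1])
  injOn p := (shellMap_injOn p).mono fun X hX =>
    show 0 < rad X by linarith [rad_pos_of_spSq hX.1.1]
  size p := 1 + p.1
  size_pos p := by positivity
  dil p X := 1 + p.1 * (rad X)⁻¹
  dil_pos p X hX := by
    have := rad_pos_of_spSq hX.1.1
    positivity
  det_eq p X hX := det_shellDeriv p (by linarith [rad_pos_of_spSq hX.1.1])
  K := 10
  one_le_K := by norm_num
  dil_le p X hX := by
    have h1 := rad_pos_of_spSq hX.1.1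
    have h2 : (rad X)⁻¹ ≤ 2 := by
      rw [inv_le_comm₀ (by linarith) (by norm_num)]; linarith
    have h3 : (0 : ℝ) ≤ p.1 := by positivity
    nlinarith
  size_le p X hX := by
    have h1 := rad_pos_of_spSq hX.1.1
    have h1' := rad_lt_of_spSq hX.1.2
    have h2 : 1 / 3 ≤ (rad X)⁻¹ := by
      rw [le_inv_comm₀ (by norm_num) (by linarith)]; linarith
    have h3 : (0 : ℝ) ≤ p.1 := by positivity
    nlinarith
  bracket_le p X hX := by
    have h1 := rad_pos_of_spSq hX.1.1
    have h1' := rad_lt_of_spSq hX.1.2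
    have h3 : (0 : ℝ) ≤ p.1 := by positivity
    rw [spSq_shellMap p (by linarith)]
    nlinarith
  le_bracket p X hX := by
    have h1 := rad_pos_of_spSq hX.1.1
    have h3 : (0 : ℝ) ≤ p.1 := by positivity
    rw [spSq_shellMap p (by linarith)]
    nlinarith
  M := 36
  overlap Y := by
    refine (tsum_le_card (((nearInt (rad Y)).image Int.toNat) ×ˢ nearInt (time Y))
      (fun _ => indicator_one_le _ _) fun p hp => ?_).trans ?_
    · refine Set.indicator_of_notMem ?_ _
      rintro ⟨X, hX, rfl⟩
      have h1 := rad_pos_of_spSq hX.1.1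
      have h1' := rad_lt_of_spSq hX.1.2
      have h2 : |time X| < 1 := hX.2
      refine hp (Finset.mem_product.2 ⟨Finset.mem_image.2 ⟨p.1, mem_nearInt ?_, by simp⟩,
        mem_nearInt ?_⟩)
      · rw [rad, spSq_shellMap p (by linarith), Real.sqrt_sq (by positivity)]
        simp only [Int.cast_natCast, add_sub_cancel_right]
        rw [abs_of_pos (by linarith)]
        exact h1'
      · rw [time_shellMap, add_sub_cancel_right]
        linarith
    · rw [Finset.card_product, card_nearInt]
      have : ((nearInt (rad Y)).image Int.toNat).card ≤ 6 :=
        Finset.card_image_le.trans (card_nearInt _).le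
      have h2 : ((nearInt (rad Y)).image Int.toNat).card * 6 ≤ 36 := by omega
      exact_mod_cast h2
  chain i := by
    have hs : ContDiffOn ℝ ∞ (fun X : Spacetime n => spSq X)
        {X | (1 / 4 < spSq X ∧ spSq X < 9) ∧ |time X| < 1} := contDiff_spSq.contDiffOn
    have hs0 : ∀ X ∈ {X : Spacetime n | (1 / 4 < spSq X ∧ spSq X < 9) ∧ |time X| < 1},
        spSq X ≠ 0 :=
      fun X (hX : (1 / 4 < spSq X ∧ spSq X < 9) ∧ |time X| < 1) => by linarith
    refine Fin.lastCases ?_ (fun i => ?_) i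
    · refine ⟨Unit, inferInstance, fun _ => .time, fun _ _ => 1, fun _ => ?_,
        fun _ => contDiffOn_const, fun m X _ F => ?_⟩
      · simp [LGen.order, pdOrder]
      · have h : shellDeriv m X (eT : Spacetime n) = eT := by
          rw [shellDeriv_apply, spInner_apply]
          simp [spPart]
        change fderiv ℝ F.1 _ (shellDeriv m X eT) = _
        rw [h]
        simp [LGen.op, pd_apply, eT]
    · refine ⟨Fin n ⊕ Fin n, inferInstance, Sum.elim (fun l => .rot l i) (fun l => .deriv l),
        Sum.elim (fun l X => ((X l.castSucc / spSq X : ℝ) : ℂ))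
          (fun l X => ((X i.castSucc * X l.castSucc / spSq X : ℝ) : ℂ)), ?_, ?_,
        fun p X hX F => ?_⟩
      · rintro (l | l) <;> simp [LGen.order, pdOrder, (Fin.castSucc_lt_last i).ne]
      · have hp : ∀ l : Fin n, ContDiff ℝ ∞ fun X : Spacetime n => X l.castSucc := fun l =>
          (EuclideanSpace.proj l.castSucc : Spacetime n →L[ℝ] ℝ).contDiff
        rintro (l | l)
        · exact Complex.ofRealCLM.contDiff.comp_contDiffOn ((hp l).contDiffOn.div hs hs0)
        · exact Complex.ofRealCLM.contDiff.comp_contDiffOn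
            (((hp i).mul (hp l)).contDiffOn.div hs hs0)
      · rw [fderiv_shellDeriv p (by linarith [rad_pos_of_spSq hX.1.1]) i F, Fintype.sum_sum_type]
        rfl

/-- The cores of the two families cover spacetime: outside the unit ball in space, a point of radius
`ρ` is the shift by `⌊ρ - 1⌋` of a point of radius between `1` and `2`. -/
theorem exists_chart (Y : Spacetime n) : Y ∈ (⋃ m, (ballCharts n).Φ m '' (ballCharts n).core) ∪
    ⋃ p, (shellCharts n).Φ p '' (shellCharts n).core := by
  set m : ℤ := round (time Y)
  have hm : |time Y - m| ≤ 1 / 2 := abs_sub_round (time Y)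
  by_cases h : spSq Y ≤ 1
  · left
    refine Set.mem_iUnion.2 ⟨m, Y + (-(m : ℝ)) • eT, ?_, ?_⟩
    · change spSq (Y + (-(m : ℝ)) • eT) ≤ 1 ∧ |time (Y + (-(m : ℝ)) • eT)| ≤ 1 / 2
      rw [spSq_add_smul_eT, time_add, time_smul, time_eT, mul_one]
      exact ⟨h, hm⟩
    · change Y + (-(m : ℝ)) • eT + (m : ℝ) • eT = Y
      module
  · right
    push Not at h
    have hr : 1 < rad Y := Real.lt_sqrt_of_sq_lt (by linarith)
    set j : ℕ := ⌊rad Y - 1⌋₊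
    have hj1 : (j : ℝ) ≤ rad Y - 1 := Nat.floor_le (by linarith)
    have hj2 : rad Y - 1 < j + 1 := Nat.lt_floor_add_one _
    set a : ℝ := (rad Y - j) / rad Y with ha
    have ha0 : 0 < a := by
      have : 0 < rad Y - j := by linarith
      positivity
    let X : Spacetime n := a • spPart Y + (time Y - m) • eT
    have hXj : ∀ l : Fin n, X l.castSucc = a * Y l.castSucc := fun l => by
      have : X l.castSucc = a * spPart Y l.castSucc + (time Y - m) * (eT : Spacetime n) l.castSucc :=
        rfl
      rw [this, spPart_castSucc, eT_castSucc]; ring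
    have hXt : time X = time Y - m := by
      simp [X, time_add, time_smul]
    have hXs : spSq X = (rad Y - j) ^ 2 := by
      have : spSq X = a ^ 2 * spSq Y := by simp only [spSq, hXj, mul_pow, Finset.mul_sum]
      rw [this, ← rad_sq, ha]
      field_simp
    have hXr : rad X = rad Y - j := by
      rw [rad, hXs, Real.sqrt_sq (by linarith)]
    refine Set.mem_iUnion.2 ⟨(j, m), X, ?_, ext_castSucc_time (fun l => ?_) ?_⟩
    · change (1 ≤ spSq X ∧ spSq X ≤ 4) ∧ |time X| ≤ 1 / 2
      rw [hXs, hXt]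
      exact ⟨⟨by nlinarith, by nlinarith⟩, hm⟩
    · change shellMap (j, m) X l.castSucc = _
      rw [shellMap_castSucc, hXr, hXj, ha]
      have : rad Y - j ≠ 0 := by linarith
      field_simp
      ring
    · change time (shellMap (j, m) X) = _
      rw [time_shellMap, hXt]
      ring

/-- The weighted multiplication theorem in lens coordinates. -/
theorem lensNorm_mul_le {a b : ℕ} (hb : 2 ≤ b) (hab : n < 2 * (a + (b - 1))) (s₁ s₂ : ℝ) :
    ∃ C : ℝ≥0, ∀ F G : Test n, lensNorm (s₁ + s₂ + ((n : ℝ) - 1) / 2) (F.mul G) ≤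
      C * (wnorm LGen.order (fun b F => LGen.op b F) (lensNorm s₁) a F *
        wnorm LGen.order (fun b F => LGen.op b F) (lensNorm s₂) b G) := by
  obtain ⟨C₁, h₁⟩ := (ballCharts n).lintegral_iUnion_core_le hb hab s₁ s₂
  obtain ⟨C₂, h₂⟩ := (shellCharts n).lintegral_iUnion_core_le hb hab s₁ s₂
  refine ⟨NNReal.sqrt (C₁ + C₂), fun F G => ?_⟩
  refine (ENNReal.pow_le_pow_left_iff (n := 2) two_ne_zero).1 ?_
  rw [mul_pow, ← ENNReal.coe_pow, NNReal.sq_sqrt, lensNorm, eLpNorm_two_sq, ← setLIntegral_univ,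
    ← Set.eq_univ_of_forall (exists_chart (n := n)), ENNReal.coe_add, add_mul]
  exact (lintegral_union_le _ _ _).trans (add_le_add (h₁ F G) (h₂ F G))

end ModuleRegularity

end

noncomputable section

namespace ModuleRegularity

variable {n : ℕ}

/-! ### The product estimate for test functions -/

/-- The graph norms of the lens generators. -/
abbrev lensW (r : ℝ) (a : ℕ) (F : Test n) : ℝ≥0∞ :=
  wnorm LGen.order (fun b F => LGen.op b F) (lensNorm r) a F

/-- The graph norms of the generators on test functions. -/
abbrev testW (c r : ℝ) (a : ℕ) (f : Test n) : ℝ≥0∞ :=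
  wnorm Gen.regOrder (fun g f => testOp c g f) (testNorm r) a f

theorem sqrt_one_add_spSq_le (X : Spacetime n) :
    (1 + spSq X) ^ (1 / 2 : ℝ) ≤ 1 + ∑ j : Fin n, |X j.castSucc| := by
  rw [← Real.sqrt_eq_rpow]
  have h0 : 0 ≤ ∑ j : Fin n, |X j.castSucc| := Finset.sum_nonneg fun _ _ => abs_nonneg _
  refine Real.sqrt_le_iff.2 ⟨by positivity, ?_⟩
  have h : spSq X ≤ (∑ j : Fin n, |X j.castSucc|) * ∑ j : Fin n, |X j.castSucc| := by
    rw [spSq, Finset.sum_mul]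
    refine Finset.sum_le_sum fun j hj => ?_
    rw [← sq_abs, sq]
    exact mul_le_mul_of_nonneg_left (Finset.single_le_sum (f := fun j : Fin n => |X j.castSucc|)
      (fun _ _ => abs_nonneg _) hj) (abs_nonneg _)
  nlinarith

theorem lensNorm_add_one_le (r : ℝ) (F : Test n) :
    lensNorm (r + 1) F ≤ lensNorm r F + ∑ j : Fin n, lensNorm r (posT j.castSucc F) := by
  have hc : ∀ F : Test n, AEStronglyMeasurable (fun X => (bracket n r).1 X * F.1 X) volume :=
    fun F => ((bracket n r).2.continuous.mul F.continuous).aestronglyMeasurable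
  calc lensNorm (r + 1) F
      ≤ eLpNorm ((fun X => ‖(bracket n r).1 X * F.1 X‖) +
          ∑ j : Fin n, fun X => ‖(bracket n r).1 X * (posT j.castSucc F).1 X‖) 2 volume := by
        refine eLpNorm_mono fun X => ?_
        have h0 := ChartFamily.one_add_spSq_pos X
        have hb : ∀ s : ℝ, ‖(bracket n s).1 X‖ = (1 + spSq X) ^ (s / 2) := fun s => by
          rw [bracket, Complex.norm_real, Real.norm_of_nonneg (by positivity)]
        have h1 : ∑ j : Fin n, ‖(bracket n r).1 X * (posT j.castSucc F).1 X‖ =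
            ‖(bracket n r).1 X * F.1 X‖ * ∑ j : Fin n, |X j.castSucc| := by
          rw [Finset.mul_sum]
          refine Finset.sum_congr rfl fun j _ => ?_
          rw [posT_apply, coord, norm_mul, norm_mul, norm_mul, Complex.norm_real, Real.norm_eq_abs]
          ring
        simp only [Pi.add_apply, Finset.sum_apply]
        rw [h1, Real.norm_of_nonneg (by positivity), norm_mul, norm_mul, hb, hb, add_div,
          Real.rpow_add h0, mul_right_comm]
        refine (mul_le_mul_of_nonneg_left (sqrt_one_add_spSq_le X) (by positivity)).trans
          (le_of_eq ?_)
        ring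
    _ ≤ _ := by
        refine (eLpNorm_add_le (hc F).norm (Finset.aestronglyMeasurable_sum _ fun j _ =>
          (hc _).norm) (by norm_num)).trans (add_le_add (eLpNorm_norm _).le ?_)
        refine (eLpNorm_sum_le (fun j _ => (hc _).norm) (by norm_num)).trans
          (Finset.sum_le_sum fun j _ => (eLpNorm_norm _).le)

/-- A power of the weight costs one generator. -/
theorem lensW_add_one_le (r : ℝ) (a : ℕ) :
    ∃ C : ℝ≥0, ∀ F : Test n, lensW (r + 1) a F ≤ C * lensW r (a + 1) F := by
  refine ⟨(wordsLE (LGen.order (n := n)) a).card * (1 + n), fun F => ?_⟩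
  rw [ENNReal.coe_mul, mul_assoc, ENNReal.coe_natCast, ← nsmul_eq_mul]
  refine Finset.sum_le_card_nsmul _ _ _ fun w hw => (lensNorm_add_one_le r _).trans ?_
  have hw' := wt_le_of_mem_wordsLE hw
  push_cast
  rw [add_mul, one_mul]
  refine add_le_add (le_wnorm LGen.one_le_order _ _ (by omega) F) ?_
  calc _ ≤ ∑ _j : Fin n, lensW r (a + 1) F := Finset.sum_le_sum fun j _ =>
        le_wnorm LGen.one_le_order (fun b F => LGen.op b F) (lensNorm r) (w := .pos j :: w)
          (by rw [wt_cons]; simp only [LGen.order]; omega) F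
    _ = _ := by simp

theorem Test.mul_comm (f g : Test n) : f.mul g = g.mul f :=
  Test.ext fun Z => by simp [_root_.mul_comm]

/-- The product estimate in lens coordinates. One factor is multiplied by `⟨y⟩` at the cost of one
derivative; this pays for the Jacobian of the charts. -/
theorem lensNorm_mul_le_of_add_eq {k a b : ℕ} (hk : 4 ≤ k) (hnk : n + 4 < 2 * k) (hab : a + b = k)
    (r₁ r₂ : ℝ) : ∃ C : ℝ≥0, ∀ F G : Test n,
      lensNorm (r₁ + r₂ + ((n : ℝ) + 1) / 2) (F.mul G) ≤ C * (lensW r₁ a F * lensW r₂ b G) := by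
  wlog h : a ≤ b generalizing a b r₁ r₂
  · obtain ⟨C, hC⟩ := this (a := b) (b := a) (by omega) r₂ r₁ (by omega)
    refine ⟨C, fun F G => ?_⟩
    rw [Test.mul_comm, add_comm r₁, mul_comm (lensW r₁ a F)]
    exact hC G F
  rcases Nat.eq_zero_or_pos a with rfl | ha
  -- with no derivative to spend on `F`, the power of `⟨y⟩` is put on `G`
  · obtain ⟨b, rfl⟩ : ∃ b', b = b' + 1 := ⟨b - 1, by omega⟩
    obtain ⟨C₁, h₁⟩ := lensNorm_mul_le (n := n) (a := 0) (b := b) (by omega) (by omega) r₁ (r₂ + 1)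
    obtain ⟨C₂, h₂⟩ := lensW_add_one_le (n := n) r₂ b
    refine ⟨C₁ * C₂, fun F G => ?_⟩
    rw [show r₁ + r₂ + ((n : ℝ) + 1) / 2 = r₁ + (r₂ + 1) + ((n : ℝ) - 1) / 2 by ring]
    refine (h₁ F G).trans ?_
    calc _ ≤ C₁ * (lensW r₁ 0 F * (C₂ * lensW r₂ (b + 1) G)) :=
          mul_le_mul' le_rfl (mul_le_mul' le_rfl (h₂ G))
      _ = _ := by push_cast; ring
  -- otherwise it is put on `F`, so that `G` keeps its `b ≥ 2` orders
  · obtain ⟨a, rfl⟩ : ∃ a', a = a' + 1 := ⟨a - 1, by omega⟩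
    obtain ⟨C₁, h₁⟩ := lensNorm_mul_le (n := n) (a := a) (b := b) (by omega) (by omega) (r₁ + 1) r₂
    obtain ⟨C₂, h₂⟩ := lensW_add_one_le (n := n) r₁ a
    refine ⟨C₁ * C₂, fun F G => ?_⟩
    rw [show r₁ + r₂ + ((n : ℝ) + 1) / 2 = (r₁ + 1) + r₂ + ((n : ℝ) - 1) / 2 by ring]
    refine (h₁ F G).trans ?_
    calc _ ≤ C₁ * ((C₂ * lensW r₁ (a + 1) F) * lensW r₂ b G) :=
          mul_le_mul' le_rfl (mul_le_mul' (h₂ F) le_rfl)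
      _ = _ := by push_cast; ring

theorem testNorm_mul_le {k a b : ℕ} (hk : 4 ≤ k) (hnk : n + 4 < 2 * k) (hab : a + b = k)
    {c₁ c₂ : ℝ} (hc₁ : c₁ ≠ 0) (hc₂ : c₂ ≠ 0) (r₁ r₂ : ℝ) : ∃ C : ℝ≥0, ∀ f g : Test n,
      testNorm (r₁ + r₂ + ((n : ℝ) + 1) / 2) (f.mul g) ≤
        C * (testW c₁ r₁ a f * testW c₂ r₂ b g) := by
  obtain ⟨C, hC⟩ := lensNorm_mul_le_of_add_eq (n := n) hk hnk hab r₁ r₂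
  obtain ⟨C₁, h₁⟩ := wnorm_lensPull_le (n := n) hc₁ r₁ a
  obtain ⟨C₂, h₂⟩ := wnorm_lensPull_le (n := n) hc₂ r₂ b
  refine ⟨C * C₁ * C₂, fun f g => ?_⟩
  rw [testNorm_mul_eq c₁ c₂]
  refine (hC _ _).trans ((mul_le_mul' le_rfl (mul_le_mul' (h₁ f) (h₂ g))).trans (le_of_eq ?_))
  push_cast
  ring

/-- The full product estimate: by the Leibniz rule, the generators of order `k` are distributed over
the two factors. -/
theorem testW_mul_le {k : ℕ} (hk : 4 ≤ k) (hnk : n + 4 < 2 * k) {c₁ c₂ : ℝ} (hc₁ : c₁ ≠ 0)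
    (hc₂ : c₂ ≠ 0) (r₁ r₂ : ℝ) : ∃ C : ℝ≥0, ∀ f g : Test n,
      testW (c₁ + c₂) (r₁ + r₂ + ((n : ℝ) + 1) / 2) k (f.mul g) ≤
        C * (testW c₁ r₁ k f * testW c₂ r₂ k g) := by
  set r := r₁ + r₂ + ((n : ℝ) + 1) / 2
  -- The statement for words applied to a product in which each factor has orders to spare.
  have key : ∀ (w : List (Gen n)) (a b : ℕ), a + b + wt Gen.regOrder w = k → ∃ C : ℝ≥0,
      ∀ f g : Test n, testNorm r (act (fun g f => testOp (c₁ + c₂) g f) w (f.mul g)) ≤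
        C * (testW c₁ r₁ (a + wt Gen.regOrder w) f * testW c₂ r₂ (b + wt Gen.regOrder w) g) := by
    intro w
    induction w using List.reverseRecOn with
    | nil => exact fun a b h => testNorm_mul_le hk hnk (by simpa using h) hc₁ hc₂ r₁ r₂
    | append_singleton w x ih =>
      intro a b h
      simp only [wt_append, wt_cons, wt_nil, add_zero] at h ⊢
      obtain ⟨C₁, h₁⟩ := ih a (b + x.regOrder) (by omega)
      obtain ⟨C₂, h₂⟩ := ih (a + x.regOrder) b (by omega)
      set v := wt Gen.regOrder w with hv
      refine ⟨C₁ * (wordsLE (Gen.regOrder (n := n)) (a + v)).card +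
        C₂ * (wordsLE (Gen.regOrder (n := n)) (b + v)).card, fun f g => ?_⟩
      have e : act (fun g f => testOp (c₁ + c₂) g f) (w ++ [x]) (f.mul g) =
          act (fun g f => testOp (c₁ + c₂) g f) w ((testOp c₁ x f).mul g) +
          act (fun g f => testOp (c₁ + c₂) g f) w (f.mul (testOp c₂ x g)) := by
        rw [act_append, act_cons, act_nil, testOp_mul]
        clear * -
        induction w with
        | nil => rfl
        | cons y w ih => rw [act_cons, act_cons, act_cons, ih, map_add]
      have e₁ : testW c₁ r₁ (a + v) (testOp c₁ x f) ≤
          (wordsLE (Gen.regOrder (n := n)) (a + v)).card * testW c₁ r₁ (a + (v + x.regOrder)) f :=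
        wnorm_act_le one_le_regOrder (fun g f => testOp c₁ g f) (testNorm r₁) (w := [x])
          (by simp; omega) f
      have e₂ : testW c₂ r₂ (b + v) (testOp c₂ x g) ≤
          (wordsLE (Gen.regOrder (n := n)) (b + v)).card * testW c₂ r₂ (b + (v + x.regOrder)) g :=
        wnorm_act_le one_le_regOrder (fun g f => testOp c₂ g f) (testNorm r₂) (w := [x])
          (by simp; omega) g
      rw [e]
      refine ((isGauge_testNorm r).add_le _ _).trans ((add_le_add (h₁ _ g) (h₂ f _)).trans ?_)
      rw [show b + x.regOrder + v = b + (v + x.regOrder) by ring,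
        show a + x.regOrder + v = a + (v + x.regOrder) by ring, ENNReal.coe_add, add_mul]
      refine add_le_add ?_ ?_
      · refine (mul_le_mul' le_rfl (mul_le_mul' e₁ le_rfl)).trans (le_of_eq ?_)
        push_cast; ring
      · refine (mul_le_mul' le_rfl (mul_le_mul' le_rfl e₂)).trans (le_of_eq ?_)
        push_cast; ring
  have key2 : ∀ w : List (Gen n), ∃ C : ℝ≥0, wt Gen.regOrder w ≤ k → ∀ f g : Test n,
      testNorm r (act (fun g f => testOp (c₁ + c₂) g f) w (f.mul g)) ≤
        C * (testW c₁ r₁ k f * testW c₂ r₂ k g) := by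
    intro w
    by_cases hw : wt Gen.regOrder w ≤ k
    · obtain ⟨C, hC⟩ := key w (k - wt Gen.regOrder w) 0 (by omega)
      refine ⟨C, fun _ f g => (hC f g).trans ?_⟩
      exact mul_le_mul' le_rfl (mul_le_mul' (wnorm_mono one_le_regOrder _ _ (by omega) f)
        (wnorm_mono one_le_regOrder _ _ (by omega) g))
    · exact ⟨0, fun h => absurd h hw⟩
  choose C hC using key2
  refine ⟨∑ w ∈ wordsLE Gen.regOrder k, C w, fun f g => ?_⟩
  rw [ENNReal.ofNNReal_finsetSum, Finset.sum_mul]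
  exact Finset.sum_le_sum fun w hw => hC w (wt_le_of_mem_wordsLE hw) f g

end ModuleRegularity

end

noncomputable section

namespace ModuleRegularity

open scoped ContDiff LineDeriv Topology
open Filter

variable {n : ℕ}

/-! ### Multiplication of distributions by bounded functions -/

theorem Test.hasTemperateGrowth (f : Test n) : f.1.HasTemperateGrowth :=
  (toSchw f).hasTemperateGrowth

theorem Test.exists_bound (f : Test n) : ∃ C : ℝ, 0 < C ∧ ∀ Z, ‖f.1 Z‖ ≤ C := by
  obtain ⟨C, hC⟩ := f.hasCompactSupport.exists_bound_of_continuous f.continuous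
  exact ⟨max C 1, by positivity, fun Z => (hC Z).trans (le_max_left _ _)⟩

theorem weightedNorm_of_mulWeight_eq {r r' : ℝ} {u v : 𝓢'(Spacetime n, ℂ)} {a : Spacetime n → ℂ}
    (ha : a.HasTemperateGrowth) {C : ℝ} (hC : ∀ Z, ‖a Z‖ ≤ C)
    (h : mulWeight n r' v = TemperedDistribution.smulLeftCLM ℂ a (mulWeight n r u))
    {g : Lp ℂ 2 (volume : Measure (Spacetime n))} (hg : mulWeight n r u = (g : 𝓢'(Spacetime n, ℂ))) :
    weightedNorm r' v = eLpNorm (fun Z => a Z * g Z) 2 volume := by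
  have ham : MemLp a ⊤ (volume : Measure (Spacetime n)) :=
    memLp_top_of_bound ha.1.continuous.aestronglyMeasurable C (.of_forall hC)
  rw [hg, ← Lp.toTemperedDistribution_smul_eq (r := 2) ha ham g] at h
  rw [weightedNorm_eq h, Lp.enorm_def]
  refine eLpNorm_congr_ae ?_
  filter_upwards [Lp.coeFn_lpSMul (r := 2) (ham.toLp a) g, ham.coeFn_toLp] with Z h1 h2
  rw [h1, Pi.smul_apply', h2, smul_eq_mul]

theorem weightedNorm_le_of_mulWeight_eq {r r' : ℝ} {u v : 𝓢'(Spacetime n, ℂ)} {a : Spacetime n → ℂ}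
    (ha : a.HasTemperateGrowth) {C : ℝ} (hC0 : 0 < C) (hC : ∀ Z, ‖a Z‖ ≤ C)
    (h : mulWeight n r' v = TemperedDistribution.smulLeftCLM ℂ a (mulWeight n r u)) :
    weightedNorm r' v ≤ ENNReal.ofReal C * weightedNorm r u := by
  by_cases hu : MemWeightedL2 r u
  · obtain ⟨g, hg⟩ := hu
    rw [weightedNorm_of_mulWeight_eq ha hC h hg, weightedNorm_eq hg, Lp.enorm_def]
    refine (eLpNorm_le_mul_eLpNorm_of_ae_le_mul (c := C) (.of_forall fun Z => ?_) 2)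
    rw [norm_mul]
    exact mul_le_mul_of_nonneg_right (hC Z) (norm_nonneg _)
  · rw [weightedNorm_eq_top hu, ENNReal.mul_top (by simpa using hC0)]
    exact le_top

theorem mulWeight_smulLeftCLM {a : Spacetime n → ℂ} (ha : a.HasTemperateGrowth) (r : ℝ)
    (u : 𝓢'(Spacetime n, ℂ)) : mulWeight n r (TemperedDistribution.smulLeftCLM ℂ a u) =
      TemperedDistribution.smulLeftCLM ℂ a (mulWeight n r u) := by
  have hw := weight_hasTemperateGrowth n r
  rw [mulWeight, TemperedDistribution.smulLeftCLM_smulLeftCLM_apply ha hw,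
    TemperedDistribution.smulLeftCLM_smulLeftCLM_apply hw ha, mul_comm]

/-- Dominated convergence for multipliers. -/
theorem tendsto_weightedNorm_smulLeftCLM {r : ℝ} {u : 𝓢'(Spacetime n, ℂ)} (hu : MemWeightedL2 r u)
    {a : ℕ → Spacetime n → ℂ} (ha : ∀ R, (a R).HasTemperateGrowth) {C : ℝ}
    (hC : ∀ R Z, ‖a R Z‖ ≤ C) (h0 : ∀ Z, Tendsto (fun R => a R Z) atTop (𝓝 0)) :
    Tendsto (fun R => weightedNorm r (TemperedDistribution.smulLeftCLM ℂ (a R) u)) atTop (𝓝 0) := by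
  obtain ⟨g, hg⟩ := hu
  have hgm : MemLp g 2 volume := Lp.memLp g
  have h1 : ∀ R, weightedNorm r (TemperedDistribution.smulLeftCLM ℂ (a R) u) =
      (∫⁻ Z, ‖a R Z * g Z‖ₑ ^ 2) ^ (1 / 2 : ℝ) := fun R => by
    rw [weightedNorm_of_mulWeight_eq (ha R) (hC R) (mulWeight_smulLeftCLM (ha R) r u) hg,
      ← eLpNorm_two_sq, ← ENNReal.rpow_natCast, ← ENNReal.rpow_mul]
    norm_num
  have h2 : Tendsto (fun R => ∫⁻ Z, ‖a R Z * g Z‖ₑ ^ 2) atTop (𝓝 (∫⁻ _ : Spacetime n, 0)) := by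
    refine tendsto_lintegral_of_dominated_convergence' (fun Z => (ENNReal.ofReal C * ‖g Z‖ₑ) ^ 2)
      (fun R => (((ha R).1.continuous.aestronglyMeasurable.mul hgm.1).enorm.pow_const 2))
      (fun R => .of_forall fun Z => ?_) ?_ (.of_forall fun Z => ?_)
    · simp only [enorm_mul]
      gcongr
      rw [← ofReal_norm]
      exact ENNReal.ofReal_le_ofReal (hC R Z)
    · simp only [mul_pow]
      rw [lintegral_const_mul' _ _ (by finiteness), ← eLpNorm_two_sq]
      have := hgm.2.ne
      finiteness
    · have h3 : Tendsto (fun R => ‖a R Z * g Z‖ₑ ^ 2) atTop (𝓝 (‖(0 : ℂ) * g Z‖ₑ ^ 2)) :=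
        ((ENNReal.continuous_pow 2).tendsto _).comp
          ((continuous_enorm.tendsto _).comp ((h0 Z).mul_const (g Z)))
      simpa using h3
  simp only [lintegral_zero] at h2
  have h4 := ((ENNReal.continuous_rpow_const (y := 1 / 2)).tendsto _).comp h2
  rw [ENNReal.zero_rpow_of_pos (by norm_num)] at h4
  exact h4.congr fun R => (h1 R).symm

/-- Multiplication of distributions by test functions. -/
def mulDist (φ : Test n) (u : 𝓢'(Spacetime n, ℂ)) : 𝓢'(Spacetime n, ℂ) :=
  TemperedDistribution.smulLeftCLM ℂ φ.1 u

theorem mulDist_add_left (φ ψ : Test n) (u : 𝓢'(Spacetime n, ℂ)) :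
    mulDist (φ + ψ) u = mulDist φ u + mulDist ψ u := by
  have h : (φ + ψ).1 = φ.1 + ψ.1 := rfl
  rw [mulDist, h, TemperedDistribution.smulLeftCLM_add φ.hasTemperateGrowth ψ.hasTemperateGrowth]
  rfl

theorem mulDist_smul_left (c : ℂ) (φ : Test n) (u : 𝓢'(Spacetime n, ℂ)) :
    mulDist (c • φ) u = c • mulDist φ u := by
  have h : (c • φ).1 = c • φ.1 := rfl
  rw [mulDist, h, TemperedDistribution.smulLeftCLM_smul φ.hasTemperateGrowth]
  rfl

/-- Multiplication of distributions by test functions, as a bilinear map. -/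
def mulDistL : Test n →ₗ[ℂ] 𝓢'(Spacetime n, ℂ) →ₗ[ℂ] 𝓢'(Spacetime n, ℂ) :=
  LinearMap.mk₂ ℂ mulDist mulDist_add_left mulDist_smul_left
    (fun φ u v => map_add (TemperedDistribution.smulLeftCLM ℂ φ.1) u v)
    (fun c φ u => map_smul (TemperedDistribution.smulLeftCLM ℂ φ.1) c u)

theorem mulDistL_apply (φ : Test n) (u : 𝓢'(Spacetime n, ℂ)) : mulDistL φ u = mulDist φ u := rfl

theorem mulDist_mulDist (φ ψ : Test n) (u : 𝓢'(Spacetime n, ℂ)) :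
    mulDist φ (mulDist ψ u) = mulDist (φ.mul ψ) u := by
  rw [mulDist, mulDist, TemperedDistribution.smulLeftCLM_smulLeftCLM_apply ψ.hasTemperateGrowth
    φ.hasTemperateGrowth, mul_comm]
  rfl

theorem posD_mulDist (a : Fin (n + 1)) (φ : Test n) (u : 𝓢'(Spacetime n, ℂ)) :
    posD a (mulDist φ u) = mulDist (posT a φ) u := by
  rw [posD, mulDist, TemperedDistribution.smulLeftCLM_smulLeftCLM_apply φ.hasTemperateGrowth
    (coord_hasTemperateGrowth a), mul_comm]
  rfl

theorem mulDist_posD (a : Fin (n + 1)) (φ : Test n) (u : 𝓢'(Spacetime n, ℂ)) :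
    mulDist φ (posD a u) = mulDist (posT a φ) u := by
  rw [posD, mulDist, TemperedDistribution.smulLeftCLM_smulLeftCLM_apply
    (coord_hasTemperateGrowth a) φ.hasTemperateGrowth]
  rfl

theorem momD_mulDist (a : Fin (n + 1)) (φ : Test n) (u : 𝓢'(Spacetime n, ℂ)) :
    momD a (mulDist φ u) = mulDist φ (momD a u) + mulDist (momT a φ) u := by
  ext f
  have key : SchwartzMap.smulLeftCLM ℂ φ.1 (∂_{unitVec a} f) =
      ∂_{unitVec a} (SchwartzMap.smulLeftCLM ℂ φ.1 f) - SchwartzMap.smulLeftCLM ℂ (pd a φ).1 f := by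
    ext Z
    have h1 : (SchwartzMap.smulLeftCLM ℂ φ.1 f : Spacetime n → ℂ) = φ.1 * f := by
      ext Z; simp [SchwartzMap.smulLeftCLM_apply_apply φ.hasTemperateGrowth]
    simp only [SchwartzMap.smulLeftCLM_apply_apply φ.hasTemperateGrowth, sub_apply,
      SchwartzMap.smulLeftCLM_apply_apply (pd a φ).hasTemperateGrowth,
      SchwartzMap.lineDerivOp_apply_eq_fderiv, h1, pd_apply]
    rw [fderiv_mul (φ.differentiable Z) f.differentiableAt]
    simp only [smul_eq_mul, add_apply, smul_apply]
    ring
  have h2 : momD a (mulDist φ u) f =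
      -Complex.I * u (SchwartzMap.smulLeftCLM ℂ φ.1 (-∂_{unitVec a} f)) := rfl
  have h3 : mulDist φ (momD a u) f =
      -Complex.I * u (-∂_{unitVec a} (SchwartzMap.smulLeftCLM ℂ φ.1 f)) := rfl
  have h4 : mulDist (momT a φ) u f =
      -Complex.I * u (SchwartzMap.smulLeftCLM ℂ (pd a φ).1 f) := by
    rw [momT, LinearMap.smul_apply, mulDist_smul_left]
    rfl
  rw [add_apply, h2, h3, h4, map_neg, key, map_neg, map_neg, map_sub]
  ring

/-- The generators are derivations up to the action on the coefficient by the generators with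
vanishing parameter, which are vector fields. -/
theorem op_mulDist (c : ℝ) (g : Gen n) (φ : Test n) (u : 𝓢'(Spacetime n, ℂ)) :
    g.op c (mulDist φ u) = mulDist φ (g.op c u) + mulDist (testOp 0 g φ) u := by
  have hpp : ∀ a b : Fin (n + 1), posD a (momD b (mulDist φ u)) =
      mulDist φ (posD a (momD b u)) + mulDist (posT a (momT b φ)) u := fun a b => by
    rw [momD_mulDist, map_add, posD_mulDist, posD_mulDist, mulDist_posD]
  have hq : ∀ a : Fin (n + 1), posD a (mulDist φ u) = mulDist φ (posD a u) := fun a => by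
    rw [posD_mulDist, mulDist_posD]
  rw [op_eq_weylGen]
  simp only [← mulDistL_apply] at *
  cases g with
  | dz j => exact momD_mulDist _ φ u
  | dt => exact momD_mulDist _ φ u
  | rot i j =>
    change posD _ (momD _ (mulDistL φ u)) - posD _ (momD _ (mulDistL φ u)) =
      mulDistL φ (posD _ (momD _ u) - posD _ (momD _ u)) + mulDistL (posT _ (momT _ φ) -
        posT _ (momT _ φ)) u
    rw [hpp, hpp, map_sub, map_sub, LinearMap.sub_apply]
    abel
  | gal j =>
    change posD _ (momD _ (mulDistL φ u)) - ((c : ℂ) / 2) • posD _ (mulDistL φ u) =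
      mulDistL φ (posD _ (momD _ u) - ((c : ℂ) / 2) • posD _ u) +
        mulDistL (posT _ (momT _ φ) - (((0 : ℝ) : ℂ) / 2) • posT _ φ) u
    rw [hpp, hq, map_sub, map_smul, Complex.ofReal_zero, zero_div, zero_smul, sub_zero]
    abel
  | dil =>
    simp only [weylGen, testOp, add_apply, smul_apply, sum_apply, LinearMap.add_apply,
      LinearMap.smul_apply, LinearMap.sum_apply, Module.End.mul_apply, map_add, map_smul, map_sum]
    change (2 : ℂ) • posD _ (momD _ (mulDistL φ u)) + ∑ j, posD _ (momD _ (mulDistL φ u)) =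
      (2 : ℂ) • mulDistL φ (posD _ (momD _ u)) + ∑ j, mulDistL φ (posD _ (momD _ u)) + _
    simp only [hpp, smul_add, Finset.sum_add_distrib]
    abel

end ModuleRegularity

end

noncomputable section

namespace ModuleRegularity

open scoped ContDiff LineDeriv Topology
open Filter

variable {n : ℕ}

/-! ### Cutting off in spacetime -/

/-- The scale `1 / (R + 1)`. -/
def scale (R : ℕ) : ℝ := ((R : ℝ) + 1)⁻¹

theorem scale_pos (R : ℕ) : 0 < scale R := by unfold scale; positivity

theorem scale_le_one (R : ℕ) : scale R ≤ 1 :=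
  inv_le_one_of_one_le₀ (by linarith [(Nat.cast_nonneg R : (0 : ℝ) ≤ R)])

theorem tendsto_scale : Tendsto scale atTop (𝓝 0) := by
  exact (tendsto_one_div_add_atTop_nhds_zero_nat (𝕜 := ℝ)).congr fun R => by
    rw [scale, one_div]

/-- Dilation of test functions. -/
def dilT (R : ℕ) : Test n →ₗ[ℂ] Test n where
  toFun f := ⟨fun Z => f.1 (scale R • Z),
    f.contDiff.comp (scale R • ContinuousLinearMap.id ℝ (Spacetime n)).contDiff,
    f.hasCompactSupport.comp_smul (scale_pos R).ne'⟩
  map_add' _ _ := rfl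
  map_smul' _ _ := rfl

theorem dilT_apply (R : ℕ) (f : Test n) (Z : Spacetime n) : (dilT R f).1 Z = f.1 (scale R • Z) := rfl

theorem pd_dilT (R : ℕ) (a : Fin (n + 1)) (f : Test n) (Z : Spacetime n) :
    (pd a (dilT R f)).1 Z = scale R * (pd a f).1 (scale R • Z) := by
  have h1 : HasFDerivAt (fun Z : Spacetime n => scale R • Z)
      (scale R • ContinuousLinearMap.id ℝ (Spacetime n)) Z :=
    (scale R • ContinuousLinearMap.id ℝ (Spacetime n)).hasFDerivAt
  have h2 := (f.differentiable (scale R • Z)).hasFDerivAt.comp Z h1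
  have h3 : (pd a (dilT R f)).1 Z = _ := congrArg (fun L => L (unitVec a)) h2.fderiv
  rw [h3]
  simp [pd_apply]

/-- The homogeneity of the generators under dilations. -/
def homDeg : Gen n → ℕ
  | .dz _ => 1
  | .dt => 1
  | .rot _ _ => 0
  | .gal _ => 0
  | .dil => 0

theorem testOp_dilT (R : ℕ) (g : Gen n) (f : Test n) :
    testOp 0 g (dilT R f) = ((scale R : ℂ) ^ homDeg g) • dilT R (testOp 0 g f) := by
  have hc : ∀ (a : Fin (n + 1)) (Z : Spacetime n),
      coord a (scale R • Z) = scale R * coord a Z := fun a Z => by simp [coord]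
  refine Test.ext fun Z => ?_
  rw [Test.smul_apply, dilT_apply]
  cases g with
  | dz j => rw [testOp_dz, testOp_dz, pd_dilT, homDeg]; ring
  | dt => rw [testOp_dt, testOp_dt, pd_dilT, homDeg]; ring
  | rot i j => rw [testOp_rot, testOp_rot, pd_dilT, pd_dilT, homDeg, hc, hc]; ring
  | gal j =>
    rw [testOp_gal, testOp_gal, pd_dilT, homDeg, hc]
    simp only [Complex.ofReal_zero]
    ring
  | dil =>
    rw [testOp_dil, testOp_dil, pd_dilT, homDeg, hc]
    simp only [hc, pd_dilT]
    rw [Finset.sum_congr rfl fun j _ => show coord j.castSucc Z * (scale R *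
      (pd j.castSucc f).1 (scale R • Z)) = scale R * coord j.castSucc Z *
        (pd j.castSucc f).1 (scale R • Z) by ring]
    ring

theorem testOp_zero_eventuallyEq {f : Test n} {α : ℂ} (h : ∀ᶠ Z in 𝓝 0, α + f.1 Z = 0) (g : Gen n) :
    ∀ᶠ Z in 𝓝 (0 : Spacetime n), (testOp 0 g f).1 Z = 0 := by
  have h1 : f.1 =ᶠ[𝓝 0] fun _ => -α := h.mono fun Z hZ => by linear_combination hZ
  have h2 : ∀ᶠ Z in 𝓝 (0 : Spacetime n), ∀ a, (pd a f).1 Z = 0 := by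
    filter_upwards [h1.fderiv (𝕜 := ℝ)] with Z hZ a
    rw [pd_apply, hZ]
    simp
  filter_upwards [h2] with Z hZ
  cases g with
  | dz j => rw [testOp_dz, hZ, mul_zero]
  | dt => rw [testOp_dt, hZ, mul_zero]
  | rot i j => rw [testOp_rot, hZ, hZ]; ring
  | gal j => rw [testOp_gal, hZ, Complex.ofReal_zero]; ring
  | dil => rw [testOp_dil]; simp [hZ]

/-- Multiplication by `R^{-e} (α + φ(· / R))`, with `R + 1` in place of `R`. When `α + φ` vanishes
near the origin, this tends strongly to zero. -/
def farMul (α : ℂ) (φ : Test n) (e R : ℕ) (u : 𝓢'(Spacetime n, ℂ)) : 𝓢'(Spacetime n, ℂ) :=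
  ((scale R : ℂ) ^ e) • (α • u + mulDist (dilT R φ) u)

theorem op_farMul (c : ℝ) (g : Gen n) (α : ℂ) (φ : Test n) (e R : ℕ) (u : 𝓢'(Spacetime n, ℂ)) :
    g.op c (farMul α φ e R u) =
      farMul α φ e R (g.op c u) + farMul 0 (testOp 0 g φ) (e + homDeg g) R u := by
  have h0 : (0 : ℂ) • u = 0 := zero_smul ℂ u
  simp only [farMul, h0, map_smul, map_add, op_mulDist, testOp_dilT, mulDist_smul_left,
    zero_add, pow_add, mul_smul, smul_add, smul_zero]
  abel

theorem tendsto_farMul {r : ℝ} {u : 𝓢'(Spacetime n, ℂ)} (hu : MemWeightedL2 r u) {α : ℂ} {φ : Test n}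
    (h : ∀ᶠ Z in 𝓝 0, α + φ.1 Z = 0) (e : ℕ) :
    Tendsto (fun R => weightedNorm r (farMul α φ e R u)) atTop (𝓝 0) := by
  obtain ⟨C, hC0, hC⟩ := φ.exists_bound
  let a : ℕ → Spacetime n → ℂ := fun R =>
    ((scale R : ℂ) ^ e) • ((fun _ => α) + (dilT R φ).1)
  have hat : ∀ R, ((fun _ => α) + (dilT R φ).1).HasTemperateGrowth := fun R =>
    (Function.HasTemperateGrowth.const α).add (dilT R φ).hasTemperateGrowth
  have ha : ∀ R, (a R).HasTemperateGrowth := fun R =>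
    (Function.HasTemperateGrowth.const ((scale R : ℂ) ^ e)).mul (hat R)
  have e1 : ∀ R, farMul α φ e R u = TemperedDistribution.smulLeftCLM ℂ (a R) u := fun R => by
    simp only [a]
    rw [TemperedDistribution.smulLeftCLM_smul (hat R), TemperedDistribution.smulLeftCLM_add
      (Function.HasTemperateGrowth.const α) (dilT R φ).hasTemperateGrowth, smul_apply, add_apply,
      TemperedDistribution.smulLeftCLM_const]
    rfl
  simp only [e1]
  have hn : ∀ R Z, ‖a R Z‖ ≤ ‖α‖ + C := fun R Z => by
    have h1 : a R Z = (scale R : ℂ) ^ e * (α + φ.1 (scale R • Z)) := rfl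
    rw [h1, norm_mul, norm_pow, Complex.norm_real, Real.norm_of_nonneg (scale_pos R).le]
    exact (mul_le_of_le_one_left (norm_nonneg _) (pow_le_one₀ (scale_pos R).le (scale_le_one R))).trans
      ((norm_add_le _ _).trans (add_le_add le_rfl (hC _)))
  refine tendsto_weightedNorm_smulLeftCLM hu ha hn fun Z => ?_
  have h2 : Tendsto (fun R => scale R • Z) atTop (𝓝 0) := by
    simpa using tendsto_scale.smul_const Z
  refine tendsto_const_nhds.congr' ?_
  filter_upwards [h2.eventually h] with R hR
  have h1 : a R Z = (scale R : ℂ) ^ e * (α + φ.1 (scale R • Z)) := rfl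
  rw [h1, hR, mul_zero]

/-- By induction on the last letter: commuting a generator with a multiplier gives a multiplier of the
same kind, as the derivatives of `φ` vanish near the origin and dilations contribute nonnegative powers
of the scale. -/
theorem tendsto_act_farMul (c : ℝ) {r : ℝ} (w : List (Gen n)) : ∀ {u : 𝓢'(Spacetime n, ℂ)},
    (∀ v : List (Gen n), wt Gen.regOrder v ≤ wt Gen.regOrder w →
      MemWeightedL2 r (act (fun g => Gen.op c g) v u)) →
    ∀ {α : ℂ} {φ : Test n}, (∀ᶠ Z in 𝓝 0, α + φ.1 Z = 0) → ∀ e : ℕ,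
    Tendsto (fun R => weightedNorm r (act (fun g => Gen.op c g) w (farMul α φ e R u)))
      atTop (𝓝 0) := by
  induction w using List.reverseRecOn with
  | nil => exact fun hu _ _ h e => tendsto_farMul (hu [] le_rfl) h e
  | append_singleton w g ih =>
    intro u hu α φ h e
    have hadd : ∀ v v' : 𝓢'(Spacetime n, ℂ), act (fun g => Gen.op c g) w (v + v') =
        act (fun g => Gen.op c g) w v + act (fun g => Gen.op c g) w v' := fun v v' => by
      simp only [act_op_eq_prod, map_add]
    have h1 := ih (u := g.op c u) (fun v hv => by
      have := hu (v ++ [g]) (by simp only [wt_append]; omega)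
      rwa [act_append] at this) h e
    have h2 := ih (u := u) (fun v hv => hu v (by rw [wt_append]; omega)) (α := 0)
      (φ := testOp 0 g φ) (by simpa using testOp_zero_eventuallyEq h g) (e + homDeg g)
    have h3 := h1.add h2
    rw [add_zero] at h3
    refine tendsto_of_tendsto_of_tendsto_of_le_of_le tendsto_const_nhds h3
      (fun _ => zero_le) fun R => ?_
    dsimp only
    rw [act_append, act_cons, act_nil, op_farMul, hadd]
    exact (isGauge_weightedNorm r).add_le _ _

/-- The graph norms of the generators on distributions. -/
abbrev distW (c r : ℝ) (k : ℕ) (u : 𝓢'(Spacetime n, ℂ)) : ℝ≥0∞ :=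
  wnorm Gen.regOrder (fun g => Gen.op c g) (weightedNorm r) k u

theorem memWeightedL2_of_distW {c r : ℝ} {k : ℕ} {u : 𝓢'(Spacetime n, ℂ)} (h : distW c r k u ≠ ⊤)
    {w : List (Gen n)} (hw : wt Gen.regOrder w ≤ k) :
    MemWeightedL2 r (act (fun g => Gen.op c g) w u) :=
  memWeightedL2_iff.2 (ne_top_of_le_ne_top h (le_wnorm one_le_regOrder _ _ hw u))

theorem sub_mulDist_eq_farMul (φ : Test n) (R : ℕ) (u : 𝓢'(Spacetime n, ℂ)) :
    u - mulDist (dilT R φ) u = farMul 1 (-φ) 0 R u := by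
  rw [farMul, pow_zero, one_smul, one_smul, map_neg, ← mulDistL_apply _ u, ← mulDistL_apply _ u,
    map_neg, LinearMap.neg_apply, sub_eq_add_neg]

theorem exists_cutoff_near_zero (n : ℕ) :
    ∃ κ : Test n, ∀ᶠ Z in 𝓝 (0 : Spacetime n), 1 + (-κ).1 Z = 0 := by
  obtain ⟨κ, hκ⟩ := exists_cutoff (isCompact_closedBall (0 : Spacetime n) 1) isOpen_univ
    (Set.subset_univ _)
  refine ⟨κ.1, ?_⟩
  filter_upwards [Metric.closedBall_mem_nhds (0 : Spacetime n) one_pos] with Z hZ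
  rw [Test.neg_apply, hκ Z hZ]
  ring

/-- Functions of compact support are dense in the module regularity spaces. -/
theorem exists_mulDist_close {c r : ℝ} {k : ℕ} {u : 𝓢'(Spacetime n, ℂ)} (h : distW c r k u ≠ ⊤)
    {ε : ℝ≥0∞} (hε : 0 < ε) : ∃ φ : Test n, distW c r k (u - mulDist φ u) ≤ ε := by
  obtain ⟨κ, hκ⟩ := exists_cutoff_near_zero n
  have h1 : Tendsto (fun R => distW c r k (farMul 1 (-κ) 0 R u)) atTop (𝓝 0) := by
    have := tendsto_finsetSum (wordsLE (Gen.regOrder (n := n)) k) fun w hw =>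
      tendsto_act_farMul c (r := r) w (u := u) (fun v hv => memWeightedL2_of_distW h
        (hv.trans (wt_le_of_mem_wordsLE hw))) hκ 0
    simp only [Finset.sum_const_zero] at this
    exact this
  obtain ⟨R, hR⟩ := (h1.eventually_le_const hε).exists
  exact ⟨dilT R κ, by rwa [sub_mulDist_eq_farMul]⟩

end ModuleRegularity

end

noncomputable section

namespace ModuleRegularity

open scoped ContDiff LineDeriv Topology FourierTransform
open Filter

variable {n : ℕ}

/-! ### Multipliers and weighted norms -/

theorem isGauge_wnorm {Γ W : Type*} [Finite Γ] [AddCommGroup W] [Module ℂ W] (d : Γ → ℕ)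
    (B : Γ → W →ₗ[ℂ] W) {S : W → ℝ≥0∞} (hS : IsGauge S) (a : ℕ) :
    IsGauge (wnorm d (fun g => B g) S a) := by
  have hact : ∀ w : List Γ, ∃ L : W →ₗ[ℂ] W, ∀ f, act (fun g => B g) w f = L f := fun w => by
    induction w with
    | nil => exact ⟨LinearMap.id, fun _ => rfl⟩
    | cons g w ih => obtain ⟨L, hL⟩ := ih; exact ⟨B g ∘ₗ L, fun f => by simp [hL]⟩
  choose L hL using hact
  constructor
  · intro f g
    simp only [wnorm, hL, map_add, ← Finset.sum_add_distrib]
    exact Finset.sum_le_sum fun w _ => hS.add_le _ _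
  · intro c f
    simp only [wnorm, hL, map_smul, Finset.mul_sum]
    exact Finset.sum_le_sum fun w _ => hS.smul_le _ _

theorem isGauge_distW (c r : ℝ) (k : ℕ) : IsGauge (distW (n := n) c r k) :=
  isGauge_wnorm Gen.regOrder (fun g => (Gen.op c g).toLinearMap) (isGauge_weightedNorm r) k

theorem mulWeight_zero (u : 𝓢'(Spacetime n, ℂ)) : mulWeight n 0 u = u := by
  have h : weight n 0 = fun _ => 1 := by ext Z; simp [weight]
  rw [mulWeight, h, TemperedDistribution.smulLeftCLM_const, one_smul]

theorem weightedNorm_mulDist_le (r r' : ℝ) (φ : Test n) :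
    ∃ C : ℝ≥0, ∀ u, weightedNorm r' (mulDist φ u) ≤ C * weightedNorm r u := by
  obtain ⟨C, hC0, hC⟩ := (mulTest (weightS n (r' - r)) φ).exists_bound
  refine ⟨C.toNNReal, fun u => weightedNorm_le_of_mulWeight_eq
    (mulTest (weightS n (r' - r)) φ).hasTemperateGrowth hC0 hC ?_⟩
  have hw := weight_hasTemperateGrowth n
  rw [mulWeight, mulWeight, mulDist, TemperedDistribution.smulLeftCLM_smulLeftCLM_apply
    φ.hasTemperateGrowth (hw r'), TemperedDistribution.smulLeftCLM_smulLeftCLM_apply (hw r)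
      (mulTest (weightS n (r' - r)) φ).hasTemperateGrowth]
  congr 1
  congr 1
  ext Z
  have h1 : weight n r' Z = weight n (r' - r) Z * weight n r Z := by
    have h2 : (0 : ℝ) < 1 + ‖Z‖ ^ 2 := by positivity
    rw [weight, weight, weight, ← Complex.ofReal_mul, ← Real.rpow_add h2]
    congr 2
    ring
  change φ.1 Z * weight n r' Z = weight n r Z * (weight n (r' - r) Z * φ.1 Z)
  rw [h1]
  ring

theorem exists_test_weightedNorm_sub_le {u : 𝓢'(Spacetime n, ℂ)} (hu : MemWeightedL2 0 u) {ε : ℝ}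
    (hε : 0 < ε) : ∃ f : Test n, weightedNorm 0 (u - toDist f) ≤ ENNReal.ofReal ε := by
  obtain ⟨g, hg⟩ := hu
  obtain ⟨f, hf1, hf2, hf3⟩ := MemLp.exist_eLpNorm_sub_le (p := 2) (by simp) (by simp)
    (Lp.memLp g) hε
  let F : Test n := ⟨f, hf2, hf1⟩
  refine ⟨F, ?_⟩
  have h : mulWeight n 0 (u - toDist F) = ((g - (toSchw F).toLp 2 volume :
      Lp ℂ 2 (volume : Measure (Spacetime n))) : 𝓢'(Spacetime n, ℂ)) := by
    rw [map_sub, hg, mulWeight_zero, toDist_eq_coe_toLp]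
    exact (map_sub (Lp.toTemperedDistributionCLM ℂ (volume : Measure (Spacetime n)) 2) g _).symm
  rw [weightedNorm_eq h, Lp.enorm_def]
  refine (eLpNorm_congr_ae ?_).trans_le hf3
  filter_upwards [Lp.coeFn_sub g ((toSchw F).toLp 2 volume), (toSchw F).coeFn_toLp 2 volume]
    with Z h1 h2
  rw [h1, Pi.sub_apply, h2]
  rfl

/-! ### Density on the Fourier side -/

theorem weightedNorm_fourier_le (u : 𝓢'(Spacetime n, ℂ)) :
    weightedNorm 0 (𝓕 u) ≤ weightedNorm 0 u := by
  by_cases hu : MemWeightedL2 0 u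
  · obtain ⟨g, hg⟩ := hu
    have h : mulWeight n 0 (𝓕 u) = ((𝓕 g : Lp ℂ 2 (volume : Measure (Spacetime n))) :
        𝓢'(Spacetime n, ℂ)) := by
      rw [mulWeight_zero] at hg ⊢
      rw [hg, Lp.fourier_toTemperedDistribution_eq]
    rw [weightedNorm_eq h, weightedNorm_eq hg, ← ofReal_norm, ← ofReal_norm, Lp.norm_fourier_eq]
  · rw [weightedNorm_eq_top hu]
    exact le_top

theorem weightedNorm_fourierInv_le (u : 𝓢'(Spacetime n, ℂ)) :
    weightedNorm 0 (𝓕⁻ u) ≤ weightedNorm 0 u := by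
  by_cases hu : MemWeightedL2 0 u
  · obtain ⟨g, hg⟩ := hu
    have h : mulWeight n 0 (𝓕⁻ u) = ((𝓕⁻ g : Lp ℂ 2 (volume : Measure (Spacetime n))) :
        𝓢'(Spacetime n, ℂ)) := by
      rw [mulWeight_zero] at hg ⊢
      rw [hg, Lp.fourierInv_toTemperedDistribution_eq]
    rw [weightedNorm_eq h, weightedNorm_eq hg, ← ofReal_norm, ← ofReal_norm,
      ← Lp.norm_fourier_eq (𝓕⁻ g), FourierTransform.fourier_fourierInv_eq]
  · rw [weightedNorm_eq_top hu]
    exact le_top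

theorem momD_fourierInv (a : Fin (n + 1)) (u : 𝓢'(Spacetime n, ℂ)) :
    momD a (𝓕⁻ u) = (2 * Real.pi : ℂ) • 𝓕⁻ (posD a u) := by
  have h : posD a u = TemperedDistribution.smulLeftCLM ℂ (fun Z => ((inner ℝ Z (unitVec a) : ℝ) : ℂ)) u := by
    rw [posD]
    congr 2
    ext Z
    rw [unitVec, EuclideanSpace.inner_single_right]
    simp [coord]
  have h2 : momD a (𝓕⁻ u) = -Complex.I • ∂_{unitVec a} (𝓕⁻ u) := rfl
  rw [h2, TemperedDistribution.lineDerivOp_fourierInv_eq, FourierTransform.fourierInv_smul,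
    smul_smul, h]
  congr 1
  linear_combination (-2 * Real.pi : ℂ) * Complex.I_mul_I

theorem posD_fourier (a : Fin (n + 1)) (u : 𝓢'(Spacetime n, ℂ)) :
    posD a (𝓕 u) = (2 * Real.pi : ℂ)⁻¹ • 𝓕 (momD a u) := by
  have h := momD_fourierInv a (𝓕 u)
  rw [FourierTransform.fourierInv_fourier_eq] at h
  rw [h, FourierTransform.fourier_smul, FourierTransform.fourier_fourierInv_eq, smul_smul,
    inv_mul_cancel₀ (by simp [Real.pi_ne_zero]), one_smul]

/-- The graph norms of the momenta, i.e. the anisotropic Sobolev norms. -/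
abbrev momW (r : ℝ) (k : ℕ) (u : 𝓢'(Spacetime n, ℂ)) : ℝ≥0∞ :=
  wnorm pdOrder (fun a => momD a) (weightedNorm r) k u

/-- The graph norms of the coordinates, i.e. the Fourier transforms of Sobolev norms. -/
abbrev posW (k : ℕ) (u : 𝓢'(Spacetime n, ℂ)) : ℝ≥0∞ :=
  wnorm pdOrder (fun a => posD a) (weightedNorm 0) k u

theorem isGauge_posW (k : ℕ) : IsGauge (posW (n := n) k) :=
  isGauge_wnorm pdOrder (fun a => (posD a).toLinearMap) (isGauge_weightedNorm 0) k

theorem momW_fourierInv_le (k : ℕ) : ∃ C : ℝ≥0, ∀ u : 𝓢'(Spacetime n, ℂ),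
    momW 0 k (𝓕⁻ u) ≤ C * posW k u := by
  obtain ⟨C, hC⟩ := wnorm_transfer_le (d := pdOrder (n := n)) (A := fun a => posD a)
    (τ := fun (_ : Unit) (_ : Unit) (u : 𝓢'(Spacetime n, ℂ)) => 𝓕⁻ u) one_le_pdOrder
    (e := pdOrder) (B := fun a => (momD a).toLinearMap) (fun a _ => by
      have h : (fun (_ : Unit) (u : 𝓢'(Spacetime n, ℂ)) => (momD a).toLinearMap (𝓕⁻ u)) =
          (2 * Real.pi : ℂ) • fun (_ : Unit) u => 𝓕⁻ (act (fun a => posD a) [a] u) := by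
        ext1 _
        ext1 u
        exact momD_fourierInv a u
      rw [h]
      exact Submodule.smul_mem _ _ (transfer_of () (by simp)))
    (isGauge_weightedNorm 0) (SV := fun _ => weightedNorm 0)
    (fun _ => ⟨1, fun _ u => by simpa using weightedNorm_fourierInv_le u⟩) k ()
  exact ⟨C, fun u => hC () u⟩

theorem posW_fourier_le (k : ℕ) : ∃ C : ℝ≥0, ∀ u : 𝓢'(Spacetime n, ℂ),
    posW k (𝓕 u) ≤ C * momW 0 k u := by
  obtain ⟨C, hC⟩ := wnorm_transfer_le (d := pdOrder (n := n)) (A := fun a => momD a)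
    (τ := fun (_ : Unit) (_ : Unit) (u : 𝓢'(Spacetime n, ℂ)) => 𝓕 u) one_le_pdOrder
    (e := pdOrder) (B := fun a => (posD a).toLinearMap) (fun a _ => by
      have h : (fun (_ : Unit) (u : 𝓢'(Spacetime n, ℂ)) => (posD a).toLinearMap (𝓕 u)) =
          (2 * Real.pi : ℂ)⁻¹ • fun (_ : Unit) u => 𝓕 (act (fun a => momD a) [a] u) := by
        ext1 _
        ext1 u
        exact posD_fourier a u
      rw [h]
      exact Submodule.smul_mem _ _ (transfer_of () (by simp)))
    (isGauge_weightedNorm 0) (SV := fun _ => weightedNorm 0)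
    (fun _ => ⟨1, fun _ u => by simpa using weightedNorm_fourier_le u⟩) k ()
  exact ⟨C, fun u => hC () u⟩

theorem act_posD_mulDist (w : List (Fin (n + 1))) (φ : Test n) (u : 𝓢'(Spacetime n, ℂ)) :
    act (fun a => posD a) w (mulDist φ u) = mulDist (act (fun a => posT a) w φ) u := by
  induction w with
  | nil => rfl
  | cons a w ih => rw [act_cons, act_cons, ih, posD_mulDist]

theorem act_posD_farMul (w : List (Fin (n + 1))) (α : ℂ) (φ : Test n) (R : ℕ)
    (u : 𝓢'(Spacetime n, ℂ)) : act (fun a => posD a) w (farMul α φ 0 R u) =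
      farMul α φ 0 R (act (fun a => posD a) w u) := by
  induction w with
  | nil => rfl
  | cons a w ih =>
    rw [act_cons, act_cons, ih, farMul, farMul, map_smul, map_add, map_smul, posD_mulDist,
      ← mulDist_posD]

theorem mulDist_toDist (φ f : Test n) : mulDist φ (toDist f) = toDist (φ.mul f) :=
  (toDist_mulTest ⟨φ.1, φ.contDiff⟩ φ.hasTemperateGrowth f).symm

/-- On the Fourier side smooth functions of compact support are dense: after a cutoff, the coordinates
are bounded and the density in `L²` applies. -/
theorem exists_posW_sub_le {k : ℕ} {u : 𝓢'(Spacetime n, ℂ)} (h : posW k u ≠ ⊤)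
    {ε : ℝ≥0∞} (hε : 0 < ε) : ∃ f : Test n, posW k (u - toDist f) ≤ ε := by
  have hε2 : 0 < ε / 2 := ENNReal.half_pos hε.ne'
  obtain ⟨κ, hκ⟩ := exists_cutoff_near_zero n
  have h1 : Tendsto (fun R => posW k (farMul 1 (-κ) 0 R u)) atTop (𝓝 0) := by
    have := tendsto_finsetSum (wordsLE (pdOrder (n := n)) k) fun w hw =>
      tendsto_farMul (memWeightedL2_iff.2 (ne_top_of_le_ne_top h (le_wnorm one_le_pdOrder _ _
        (wt_le_of_mem_wordsLE hw) u))) hκ 0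
    simp only [Finset.sum_const_zero] at this
    simpa only [posW, wnorm, act_posD_farMul] using this
  obtain ⟨R, hR⟩ := (h1.eventually_le_const hε2).exists
  have h2 : ∃ C : ℝ≥0, ∀ v, posW k (mulDist (dilT R κ) v) ≤ C * weightedNorm 0 v := by
    choose C hC using fun w => weightedNorm_mulDist_le 0 0 (act (fun a => posT a) w (dilT R κ))
    refine ⟨∑ w ∈ wordsLE (pdOrder (n := n)) k, C w, fun v => ?_⟩
    rw [posW, wnorm, ENNReal.ofNNReal_finsetSum, Finset.sum_mul]
    refine Finset.sum_le_sum fun w _ => ?_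
    rw [act_posD_mulDist]
    exact hC w v
  obtain ⟨C, hC⟩ := h2
  obtain ⟨δ, hδ0, hδ⟩ : ∃ δ : ℝ, 0 < δ ∧ C * ENNReal.ofReal δ ≤ ε / 2 := by
    obtain ⟨δ, hδ0, hδ⟩ := ENNReal.exists_nnreal_pos_mul_lt (a := C) ENNReal.coe_ne_top hε2.ne'
    refine ⟨δ, hδ0, ?_⟩
    rw [ENNReal.ofReal_coe_nnreal, mul_comm]
    exact hδ.le
  obtain ⟨f, hf⟩ := exists_test_weightedNorm_sub_le (u := u) (memWeightedL2_iff.2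
    (ne_top_of_le_ne_top h (le_wnorm one_le_pdOrder _ _ (w := []) (Nat.zero_le k) u))) hδ0
  refine ⟨(dilT R κ).mul f, ?_⟩
  have e : u - toDist ((dilT R κ).mul f) =
      farMul 1 (-κ) 0 R u + mulDist (dilT R κ) (u - toDist f) := by
    rw [← sub_mulDist_eq_farMul, ← mulDist_toDist, ← mulDistL_apply, ← mulDistL_apply,
      ← mulDistL_apply, map_sub]
    abel
  rw [e, ← ENNReal.add_halves ε]
  exact ((isGauge_posW k).add_le _ _).trans (add_le_add hR ((hC _).trans (le_trans (by gcongr) hδ)))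

theorem exists_schwartz_momW_sub_le {k : ℕ} {u : 𝓢'(Spacetime n, ℂ)} (h : momW 0 k u ≠ ⊤)
    {ε : ℝ≥0∞} (hε : 0 < ε) : ∃ f : 𝓢(Spacetime n, ℂ), momW 0 k (u - (f : 𝓢'(Spacetime n, ℂ))) ≤ ε := by
  obtain ⟨C, hC⟩ := posW_fourier_le (n := n) k
  obtain ⟨D, hD⟩ := momW_fourierInv_le (n := n) k
  obtain ⟨δ, hδ0, hδ⟩ := ENNReal.exists_nnreal_pos_mul_lt (a := D) ENNReal.coe_ne_top hε.ne'
  obtain ⟨G, hG⟩ := exists_posW_sub_le (k := k) (u := 𝓕 u)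
    (ne_top_of_le_ne_top (ENNReal.mul_ne_top ENNReal.coe_ne_top h) (hC u))
    (ENNReal.coe_pos.2 hδ0)
  refine ⟨𝓕⁻ (toSchw G), ?_⟩
  have e : u - ((𝓕⁻ (toSchw G) : 𝓢(Spacetime n, ℂ)) : 𝓢'(Spacetime n, ℂ)) =
      𝓕⁻ (𝓕 u - toDist G) := by
    have h1 : 𝓕⁻ (toDist G) = ((𝓕⁻ (toSchw G) : 𝓢(Spacetime n, ℂ)) : 𝓢'(Spacetime n, ℂ)) :=
      TemperedDistribution.fourierInv_toTemperedDistributionCLM_eq (toSchw G)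
    rw [sub_eq_add_neg, sub_eq_add_neg, FourierTransform.fourierInv_add, ← neg_one_smul ℂ (toDist G),
      FourierTransform.fourierInv_smul, FourierTransform.fourierInv_fourier_eq, h1]
    exact congrArg (u + ·) (neg_one_smul ℂ _).symm
  rw [e]
  refine (hD _).trans (le_trans ?_ hδ.le)
  rw [mul_comm]
  gcongr

/-! ### Density of test functions -/

/-- On functions with a fixed compact support the module regularity is Sobolev regularity. -/
theorem distW_mulDist_le (c r : ℝ) (k : ℕ) (φ : Test n) :
    ∃ C : ℝ≥0, ∀ u, distW c r k (mulDist φ u) ≤ C * momW 0 k u := by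
  have hq : ∀ (a : Fin (n + 1)) (κ : Test n),
      (fun (_ : Unit) u => (posD a).toLinearMap (mulDist κ u)) ∈ transfer pdOrder
        (fun a => momD a) (fun (κ : Test n) (_ : Unit) u => mulDist κ u) 0 := fun a κ => by
    have h : (fun (_ : Unit) u => (posD a).toLinearMap (mulDist κ u)) =
        fun (_ : Unit) u => mulDist (posT a κ) (act (fun a => momD a) [] u) := by
      ext1 _
      ext1 u
      exact posD_mulDist a κ u
    rw [h]
    exact transfer_of (τ := fun (κ : Test n) (_ : Unit) u => mulDist κ u) _ le_rfl
  have hp : ∀ (a : Fin (n + 1)) (κ : Test n),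
      (fun (_ : Unit) u => (momD a).toLinearMap (mulDist κ u)) ∈ transfer pdOrder
        (fun a => momD a) (fun (κ : Test n) (_ : Unit) u => mulDist κ u) (pdOrder a) := fun a κ => by
    have h : (fun (_ : Unit) u => (momD a).toLinearMap (mulDist κ u)) =
        (fun (_ : Unit) u => mulDist κ (act (fun a => momD a) [a] u)) +
        fun (_ : Unit) u => mulDist (momT a κ) (act (fun a => momD a) [] u) := by
      ext1 _
      ext1 u
      exact momD_mulDist a κ u
    rw [h]
    exact Submodule.add_mem _
      (transfer_of (τ := fun (κ : Test n) (_ : Unit) u => mulDist κ u) _ (by simp))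
      (transfer_of (τ := fun (κ : Test n) (_ : Unit) u => mulDist κ u) _ (Nat.zero_le _))
  have hqp : ∀ (a b : Fin (n + 1)) (κ : Test n),
      (fun (_ : Unit) u => (posD a).toLinearMap ((momD b).toLinearMap (mulDist κ u))) ∈
        transfer pdOrder (fun a => momD a) (fun (κ : Test n) (_ : Unit) u => mulDist κ u)
          (pdOrder b) := fun a b κ => transfer_comp (posD a).toLinearMap (hq a) (hp b κ)
  have hz : ∀ j : Fin n, pdOrder j.castSucc = 1 := fun j => by
    simp [pdOrder, (Fin.castSucc_lt_last j).ne]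
  have ht : pdOrder (Fin.last n) = 2 := by simp [pdOrder]
  have hop : ∀ (g : Gen n) (κ : Test n),
      (fun (_ : Unit) u => (Gen.op c g).toLinearMap (mulDist κ u)) ∈ transfer pdOrder
        (fun a => momD a) (fun (κ : Test n) (_ : Unit) u => mulDist κ u) g.regOrder := fun g κ => by
    rw [op_eq_weylGen]
    cases g with
    | dz j =>
      have := hp j.castSucc κ
      rwa [hz] at this
    | dt =>
      have := hp (Fin.last n) κ
      rwa [ht] at this
    | rot i j =>
      have h1 := hqp i.castSucc j.castSucc κ
      have h2 := hqp j.castSucc i.castSucc κ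
      rw [hz] at h1 h2
      exact Submodule.sub_mem _ h1 h2
    | gal j =>
      have h1 := hqp (Fin.last n) j.castSucc κ
      rw [hz] at h1
      exact Submodule.sub_mem _ h1
        (Submodule.smul_mem _ ((c : ℂ) / 2) (transfer_mono zero_le_one (hq j.castSucc κ)))
    | dil =>
      have h : (fun (_ : Unit) u =>
          (weylGen posD momD c (Gen.dil (n := n))).toLinearMap (mulDist κ u)) =
          (2 : ℂ) • (fun (_ : Unit) u => (posD (Fin.last n)).toLinearMap
            ((momD (Fin.last n)).toLinearMap (mulDist κ u))) +
          ∑ j : Fin n, fun (_ : Unit) u => (posD j.castSucc).toLinearMap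
            ((momD j.castSucc).toLinearMap (mulDist κ u)) := by
        ext1 _
        ext1 u
        simp only [Pi.add_apply, Pi.smul_apply, Finset.sum_apply]
        simp [weylGen]
      have h1 := hqp (Fin.last n) (Fin.last n) κ
      rw [ht] at h1
      rw [h]
      refine Submodule.add_mem _ (Submodule.smul_mem _ 2 h1) (Submodule.sum_mem _ fun j _ => ?_)
      exact transfer_mono ((hz j).le.trans one_le_two) (hqp j.castSucc j.castSucc κ)
  obtain ⟨C, hC⟩ := wnorm_transfer_le (d := pdOrder (n := n)) (A := fun a => momD a)
    (τ := fun (κ : Test n) (_ : Unit) u => mulDist κ u) one_le_pdOrder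
    (e := Gen.regOrder) (B := fun g => (Gen.op c g).toLinearMap) hop
    (isGauge_weightedNorm r) (SV := fun _ => weightedNorm 0)
    (fun κ => (weightedNorm_mulDist_le 0 r κ).imp fun C hC _ u => hC u) k φ
  exact ⟨C, fun u => hC () u⟩

theorem momW_mulDist_le (c r : ℝ) (k : ℕ) (φ : Test n) :
    ∃ C : ℝ≥0, ∀ u, momW 0 k (mulDist φ u) ≤ C * distW c r k u := by
  have key : ∀ (a : Fin (n + 1)), ∃ g : Gen n, g.regOrder = pdOrder a ∧ g.op c = momD a := by
    refine Fin.lastCases ⟨Gen.dt, by simp [Gen.regOrder, pdOrder], rfl⟩ fun j => ⟨Gen.dz j, ?_, rfl⟩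
    simp [Gen.regOrder, pdOrder, (Fin.castSucc_lt_last j).ne]
  obtain ⟨C, hC⟩ := wnorm_transfer_le (d := Gen.regOrder (n := n)) (A := fun g => Gen.op c g)
    (τ := fun (κ : Test n) (_ : Unit) u => mulDist κ u) one_le_regOrder
    (e := pdOrder) (B := fun a => (momD a).toLinearMap) (fun a κ => by
      obtain ⟨g, hg1, hg2⟩ := key a
      have h : (fun (_ : Unit) u => (momD a).toLinearMap (mulDist κ u)) =
          (fun (_ : Unit) u => mulDist κ (act (fun g => Gen.op c g) [g] u)) +
          fun (_ : Unit) u => mulDist (momT a κ) (act (fun g => Gen.op c g) [] u) := by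
        ext1 _
        ext1 u
        simp only [act_cons, act_nil, hg2]
        exact momD_mulDist a κ u
      rw [h]
      exact Submodule.add_mem _
        (transfer_of (τ := fun (κ : Test n) (_ : Unit) u => mulDist κ u) _ (by simp [hg1]))
        (transfer_of (τ := fun (κ : Test n) (_ : Unit) u => mulDist κ u) _ (Nat.zero_le _)))
    (isGauge_weightedNorm 0) (SV := fun _ => weightedNorm r)
    (fun κ => (weightedNorm_mulDist_le r 0 κ).imp fun C hC _ u => hC u) k φ
  exact ⟨C, fun u => hC () u⟩

theorem mulDist_schwartz (φ : Test n) (f : 𝓢(Spacetime n, ℂ)) :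
    mulDist φ (f : 𝓢'(Spacetime n, ℂ)) = toDist (mulTest ⟨f, f.smooth _⟩ φ) := by
  ext ψ
  rw [toDist_apply, mulDist, TemperedDistribution.smulLeftCLM_apply_apply]
  simp only [SchwartzMap.coe_apply]
  refine integral_congr_ae (.of_forall fun Z => ?_)
  simp only [mulTest_apply, SchwartzMap.smulLeftCLM_apply_apply φ.hasTemperateGrowth, smul_eq_mul]
  ring

/-- Test functions are dense in the module regularity spaces. -/
theorem exists_distW_sub_le {c r : ℝ} {k : ℕ} {u : 𝓢'(Spacetime n, ℂ)} (h : distW c r k u ≠ ⊤)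
    {ε : ℝ≥0∞} (hε : 0 < ε) : ∃ f : Test n, distW c r k (u - toDist f) ≤ ε := by
  have hε2 : 0 < ε / 2 := ENNReal.half_pos hε.ne'
  obtain ⟨κ, hκ⟩ := exists_mulDist_close h hε2
  obtain ⟨ψ, hψ⟩ := exists_cutoff κ.hasCompactSupport isOpen_univ (Set.subset_univ _)
  have hψκ : ψ.1.mul κ = κ := Test.ext fun Z => by
    by_cases hZ : Z ∈ tsupport κ.1
    · rw [Test.mul_apply, hψ Z hZ, one_mul]
    · rw [Test.mul_apply, image_eq_zero_of_notMem_tsupport hZ, mul_zero]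
  obtain ⟨C, hC⟩ := momW_mulDist_le c r k κ
  obtain ⟨D, hD⟩ := distW_mulDist_le c r k ψ.1
  obtain ⟨δ, hδ0, hδ⟩ := ENNReal.exists_nnreal_pos_mul_lt (a := D) ENNReal.coe_ne_top hε2.ne'
  obtain ⟨f, hf⟩ := exists_schwartz_momW_sub_le (k := k) (u := mulDist κ u)
    (ne_top_of_le_ne_top (ENNReal.mul_ne_top ENNReal.coe_ne_top h) (hC u)) (ENNReal.coe_pos.2 hδ0)
  refine ⟨mulTest ⟨f, f.smooth _⟩ ψ.1, ?_⟩
  have e : u - toDist (mulTest ⟨f, f.smooth _⟩ ψ.1) =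
      (u - mulDist κ u) + mulDist ψ.1 (mulDist κ u - (f : 𝓢'(Spacetime n, ℂ))) := by
    have h1 : mulDist ψ.1 (mulDist κ u - (f : 𝓢'(Spacetime n, ℂ))) =
        mulDist ψ.1 (mulDist κ u) - mulDist ψ.1 (f : 𝓢'(Spacetime n, ℂ)) :=
      map_sub (mulDistL ψ.1) _ _
    rw [h1, mulDist_mulDist, hψκ, mulDist_schwartz]
    abel
  rw [e, ← ENNReal.add_halves ε]
  refine ((isGauge_distW c r k).add_le _ _).trans (add_le_add hκ ((hD _).trans ?_))
  refine le_trans ?_ hδ.le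
  rw [mul_comm]
  gcongr

end ModuleRegularity

end

noncomputable section

namespace ModuleRegularity

open scoped ContDiff Topology
open Filter

variable {n : ℕ}

/-! ### Completeness and products -/

theorem mulWeight_mulWeight (r s : ℝ) (u : 𝓢'(Spacetime n, ℂ)) :
    mulWeight n r (mulWeight n s u) = mulWeight n (r + s) u := by
  rw [mulWeight, mulWeight, TemperedDistribution.smulLeftCLM_smulLeftCLM_apply
    (weight_hasTemperateGrowth n s) (weight_hasTemperateGrowth n r), mulWeight]
  congr 2
  ext Z
  have h2 : (0 : ℝ) < 1 + ‖Z‖ ^ 2 := by positivity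
  rw [Pi.mul_apply, weight, weight, weight, ← Complex.ofReal_mul, ← Real.rpow_add h2]
  congr 2
  ring

theorem mulWeight_neg_mulWeight (r : ℝ) (u : 𝓢'(Spacetime n, ℂ)) :
    mulWeight n (-r) (mulWeight n r u) = u := by
  rw [mulWeight_mulWeight, neg_add_cancel, mulWeight_zero]

theorem coe_lp_sub (g h : Lp ℂ 2 (volume : Measure (Spacetime n))) :
    ((g - h : Lp ℂ 2 (volume : Measure (Spacetime n))) : 𝓢'(Spacetime n, ℂ)) = g - h :=
  map_sub (Lp.toTemperedDistributionCLM ℂ (volume : Measure (Spacetime n)) 2) g h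

theorem tendsto_coe_lp {G : ℕ → Lp ℂ 2 (volume : Measure (Spacetime n))}
    {H : Lp ℂ 2 (volume : Measure (Spacetime n))} (h : Tendsto G atTop (𝓝 H)) :
    Tendsto (fun m => (G m : 𝓢'(Spacetime n, ℂ))) atTop (𝓝 (H : 𝓢'(Spacetime n, ℂ))) :=
  ((Lp.toTemperedDistributionCLM ℂ (volume : Measure (Spacetime n)) 2).continuous.tendsto H).comp h

theorem weightedNorm_sub_eq {r : ℝ} {u v : 𝓢'(Spacetime n, ℂ)}
    {g h : Lp ℂ 2 (volume : Measure (Spacetime n))} (hg : mulWeight n r u = (g : 𝓢'(Spacetime n, ℂ)))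
    (hh : mulWeight n r v = (h : 𝓢'(Spacetime n, ℂ))) :
    weightedNorm r (u - v) = edist g h := by
  rw [weightedNorm_eq (g := g - h) (by rw [map_sub, hg, hh, coe_lp_sub]), edist_eq_enorm_sub]

theorem act_op_sub (c : ℝ) (v : List (Gen n)) (x y : 𝓢'(Spacetime n, ℂ)) :
    act (fun g => Gen.op c g) v (x - y) =
      act (fun g => Gen.op c g) v x - act (fun g => Gen.op c g) v y := by
  simp only [act_op_eq_prod, map_sub]

/-- The module regularity spaces are complete. -/
theorem exists_tendsto_distW {c r : ℝ} {k : ℕ} {x : ℕ → 𝓢'(Spacetime n, ℂ)}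
    (hx : ∀ m, distW c r k (x m) ≠ ⊤)
    (hc : ∀ ε > 0, ∃ N, ∀ m ≥ N, ∀ l ≥ N, distW c r k (x m - x l) < ε) :
    ∃ w, Tendsto (fun m => distW c r k (w - x m)) atTop (𝓝 0) := by
  have key : ∀ v : List (Gen n), wt Gen.regOrder v ≤ k →
      ∃ (G : ℕ → Lp ℂ 2 (volume : Measure (Spacetime n))) (H : Lp ℂ 2 volume),
        (∀ m, mulWeight n r (act (fun g => Gen.op c g) v (x m)) = (G m : 𝓢'(Spacetime n, ℂ))) ∧
        Tendsto G atTop (𝓝 H) := by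
    intro v hv
    choose G hG using fun m => memWeightedL2_of_distW (hx m) hv
    have h1 : CauchySeq G := by
      refine EMetric.cauchySeq_iff.2 fun ε hε => ?_
      obtain ⟨N, hN⟩ := hc ε hε
      refine ⟨N, fun m hm l hl => lt_of_le_of_lt ?_ (hN m hm l hl)⟩
      rw [← weightedNorm_sub_eq (hG m) (hG l), ← act_op_sub]
      exact le_wnorm one_le_regOrder _ _ hv _
    obtain ⟨H, hH⟩ := cauchySeq_tendsto_of_complete h1
    exact ⟨G, H, hG, hH⟩
  obtain ⟨G, H, hG, hH⟩ := key [] (Nat.zero_le k)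
  have hw : Tendsto x atTop (𝓝 (mulWeight n (-r) H)) := by
    have h1 := ((mulWeight n (-r)).continuous.tendsto _).comp (tendsto_coe_lp hH)
    refine h1.congr fun m => ?_
    rw [Function.comp_apply, ← hG m, mulWeight_neg_mulWeight]
    rfl
  refine ⟨mulWeight n (-r) H, ?_⟩
  rw [← Finset.sum_const_zero (M := ℝ≥0∞) (s := wordsLE (Gen.regOrder (n := n)) k)]
  refine tendsto_finsetSum _ fun v hv => ?_
  obtain ⟨G', H', hG', hH'⟩ := key v (wt_le_of_mem_wordsLE hv)
  have h2 : mulWeight n r (act (fun g => Gen.op c g) v (mulWeight n (-r) H)) = H' := by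
    have h3 := (((mulWeight n r).comp (v.map (Gen.op c)).prod).continuous.tendsto _).comp hw
    have h4 := tendsto_nhds_unique h3 ((tendsto_coe_lp hH').congr fun m => by
      rw [← hG' m, act_op_eq_prod]; rfl)
    rw [act_op_eq_prod]
    exact h4
  have h5 : ∀ m, weightedNorm r (act (fun g => Gen.op c g) v (mulWeight n (-r) H - x m)) =
      edist (G' m) H' := fun m => by
    rw [act_op_sub, weightedNorm_sub_eq h2 (hG' m), edist_comm]
  simp only [h5]
  exact tendsto_iff_edist_tendsto_0.1 hH'

/-- The function represented by a distribution in a weighted `L²` space. -/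
theorem isFunction_of_mulWeight_eq {r : ℝ} {u : 𝓢'(Spacetime n, ℂ)}
    {g : Lp ℂ 2 (volume : Measure (Spacetime n))} (hg : mulWeight n r u = (g : 𝓢'(Spacetime n, ℂ))) :
    IsFunction u fun Z => weight n (-r) Z * g Z := by
  intro φ
  have hw := weight_hasTemperateGrowth n (-r)
  have h1 : ∀ Z, SchwartzMap.smulLeftCLM ℂ (weight n (-r)) φ Z = weight n (-r) Z * φ Z := fun Z => by
    rw [SchwartzMap.smulLeftCLM_apply_apply hw, smul_eq_mul]
  constructor
  · have h2 := MemLp.integrable_mul (p := 2) (q := 2)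
      ((SchwartzMap.smulLeftCLM ℂ (weight n (-r)) φ).memLp 2 volume) (Lp.memLp g)
    refine h2.congr (.of_forall fun Z => ?_)
    rw [Pi.mul_apply, h1]
    ring
  · rw [← mulWeight_neg_mulWeight r u, hg, mulWeight,
      TemperedDistribution.smulLeftCLM_apply_apply, Lp.toTemperedDistribution_apply]
    refine integral_congr_ae (.of_forall fun Z => ?_)
    simp only [h1, smul_eq_mul]
    ring

theorem mulWeight_toDist (r : ℝ) (f : Test n) : mulWeight n r (toDist f) =
    (((toSchw (mulTest (weightS n r) f)).toLp 2 volume :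
      Lp ℂ 2 (volume : Measure (Spacetime n))) : 𝓢'(Spacetime n, ℂ)) := by
  rw [← toDist_eq_coe_toLp, toDist_mulTest (weightS n r) (weight_hasTemperateGrowth n r) f]
  rfl

theorem tendsto_toLp {r : ℝ} {u : 𝓢'(Spacetime n, ℂ)} {f : ℕ → Test n}
    (h : Tendsto (fun m => weightedNorm r (u - toDist (f m))) atTop (𝓝 0))
    {g : Lp ℂ 2 (volume : Measure (Spacetime n))} (hg : mulWeight n r u = (g : 𝓢'(Spacetime n, ℂ))) :
    Tendsto (fun m => (toSchw (mulTest (weightS n r) (f m))).toLp 2 volume) atTop (𝓝 g) := by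
  rw [tendsto_iff_edist_tendsto_0]
  refine h.congr fun m => ?_
  rw [weightedNorm_sub_eq hg (mulWeight_toDist r (f m)), edist_comm]

theorem integrable_mul_mul (ψ : 𝓢(Spacetime n, ℂ)) (a b : Lp ℂ 2 (volume : Measure (Spacetime n))) :
    Integrable fun Z => ψ Z * (a Z * b Z) :=
  (MemLp.integrable_mul (p := 2) (q := 2) (Lp.memLp a) (Lp.memLp b)).bdd_mul
    (c := SchwartzMap.seminorm ℝ 0 0 ψ) ψ.continuous.aestronglyMeasurable
    (.of_forall fun Z => ψ.norm_le_seminorm ℝ Z)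

theorem tendsto_integral_mul_mul (ψ : 𝓢(Spacetime n, ℂ))
    {a b : ℕ → Lp ℂ 2 (volume : Measure (Spacetime n))}
    {a₀ b₀ : Lp ℂ 2 (volume : Measure (Spacetime n))} (ha : Tendsto a atTop (𝓝 a₀))
    (hb : Tendsto b atTop (𝓝 b₀)) :
    Tendsto (fun m => ∫ Z, ψ Z * (a m Z * b m Z)) atTop (𝓝 (∫ Z, ψ Z * (a₀ Z * b₀ Z))) := by
  obtain ⟨L, hL⟩ : ∃ L : Lp ℂ 2 (volume : Measure (Spacetime n)) →L[ℂ]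
      Lp ℂ 2 (volume : Measure (Spacetime n)) →L[ℂ] Lp ℂ 1 (volume : Measure (Spacetime n)),
      ∀ a b, L a b =ᵐ[volume] fun Z => a Z * b Z :=
    ⟨(ContinuousLinearMap.mul ℂ ℂ).holderL volume 2 2 1, fun a b => by
      rw [ContinuousLinearMap.holderL_apply_apply]
      exact (ContinuousLinearMap.mul ℂ ℂ).coeFn_holder (r := 1) a b⟩
  let Q : Lp ℂ 1 (volume : Measure (Spacetime n)) →L[ℂ] ℂ :=
    (ContinuousLinearMap.mul ℂ ℂ).lpPairing volume ⊤ 1 (ψ.toLp ⊤ volume)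
  have hQ : ∀ a b, Q (L a b) = ∫ Z, ψ Z * (a Z * b Z) := fun a b => by
    refine (ContinuousLinearMap.lpPairing_eq_integral _ _ _).trans (integral_congr_ae ?_)
    filter_upwards [hL a b, ψ.coeFn_toLp ⊤ volume] with Z h1 h2
    rw [h1, h2]
    rfl
  have h0 : Tendsto (fun p : Lp ℂ 2 (volume : Measure (Spacetime n)) ×
      Lp ℂ 2 (volume : Measure (Spacetime n)) => L p.1 p.2) (𝓝 (a₀, b₀)) (𝓝 (L a₀ b₀)) :=
    L.isBoundedBilinearMap.continuous.continuousAt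
  have h1 : Tendsto (fun m => L (a m) (b m)) atTop (𝓝 (L a₀ b₀)) :=
    h0.comp (ha.prodMk_nhds hb)
  have h2 := (Q.continuous.tendsto _).comp h1
  rw [hQ] at h2
  exact h2.congr fun m => hQ _ _

/-- If the factors converge in weighted `L²` spaces and so do the products, then the limit of the
products is the product of the limits. -/
theorem isProduct_of_tendsto {r₁ r₂ s : ℝ} {u₁ u₂ w : 𝓢'(Spacetime n, ℂ)} {f₁ f₂ : ℕ → Test n}
    (hu₁ : MemWeightedL2 r₁ u₁) (hu₂ : MemWeightedL2 r₂ u₂) (hw : MemWeightedL2 s w)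
    (h₁ : Tendsto (fun m => weightedNorm r₁ (u₁ - toDist (f₁ m))) atTop (𝓝 0))
    (h₂ : Tendsto (fun m => weightedNorm r₂ (u₂ - toDist (f₂ m))) atTop (𝓝 0))
    (h : Tendsto (fun m => weightedNorm s (w - toDist ((f₁ m).mul (f₂ m)))) atTop (𝓝 0)) :
    IsProduct u₁ u₂ w := by
  obtain ⟨g₁, hg₁⟩ := hu₁
  obtain ⟨g₂, hg₂⟩ := hu₂
  obtain ⟨g, hg⟩ := hw
  refine ⟨_, _, isFunction_of_mulWeight_eq hg₁, isFunction_of_mulWeight_eq hg₂, fun φ => ?_⟩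
  have hwt : ∀ (r : ℝ) Z, weight n (-r) Z * weight n r Z = 1 := fun r Z => by
    have h2 : (0 : ℝ) < 1 + ‖Z‖ ^ 2 := by positivity
    rw [weight, weight, ← Complex.ofReal_mul, ← Real.rpow_add h2, neg_div, neg_add_cancel,
      Real.rpow_zero, Complex.ofReal_one]
  -- all the weights are moved to the test function
  let ψ : 𝓢(Spacetime n, ℂ) := SchwartzMap.smulLeftCLM ℂ (weight n (-r₁))
    (SchwartzMap.smulLeftCLM ℂ (weight n (-r₂)) φ)
  have hψ : ∀ Z, ψ Z = weight n (-r₁) Z * (weight n (-r₂) Z * φ Z) := fun Z => by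
    simp only [ψ, SchwartzMap.smulLeftCLM_apply_apply (weight_hasTemperateGrowth n _), smul_eq_mul]
  constructor
  · refine (integrable_mul_mul ψ g₁ g₂).congr (.of_forall fun Z => ?_)
    simp only [hψ]
    ring
  · have hlim := tendsto_integral_mul_mul ψ (tendsto_toLp h₁ hg₁) (tendsto_toLp h₂ hg₂)
    have hval : ∀ m, ∫ Z, ψ Z * ((toSchw (mulTest (weightS n r₁) (f₁ m))).toLp 2 volume Z *
        (toSchw (mulTest (weightS n r₂) (f₂ m))).toLp 2 volume Z) = toDist ((f₁ m).mul (f₂ m)) φ := fun m => by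
      rw [toDist_apply]
      refine integral_congr_ae ?_
      filter_upwards [(toSchw (mulTest (weightS n r₁) (f₁ m))).coeFn_toLp 2 volume,
        (toSchw (mulTest (weightS n r₂) (f₂ m))).coeFn_toLp 2 volume] with Z e1 e2
      rw [e1, e2, hψ, toSchw_apply, toSchw_apply, mulTest_apply, mulTest_apply, Test.mul_apply]
      change weight n (-r₁) Z * (weight n (-r₂) Z * φ Z) *
        (weight n r₁ Z * (f₁ m).1 Z * (weight n r₂ Z * (f₂ m).1 Z)) = _
      linear_combination (weight n (-r₂) Z * weight n r₂ Z * φ Z * (f₁ m).1 Z * (f₂ m).1 Z) *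
        hwt r₁ Z + (φ Z * (f₁ m).1 Z * (f₂ m).1 Z) * hwt r₂ Z
    simp only [hval] at hlim
    have hlim' : Tendsto (fun m => toDist ((f₁ m).mul (f₂ m)) φ) atTop (𝓝 (w φ)) := by
      have h1 := ((mulWeight n (-s)).continuous.tendsto _).comp (tendsto_coe_lp (tendsto_toLp h hg))
      rw [← hg, mulWeight_neg_mulWeight] at h1
      have h2 := ((PointwiseConvergenceCLM.evalCLM (RingHom.id ℂ) ℂ φ).continuous.tendsto w).comp h1
      refine h2.congr fun m => ?_
      simp only [Function.comp_apply]
      rw [← mulWeight_toDist, mulWeight_neg_mulWeight]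
      rfl
    rw [tendsto_nhds_unique hlim' hlim]
    refine integral_congr_ae (.of_forall fun Z => ?_)
    simp only [hψ]
    ring

theorem distW_toDist (c r : ℝ) (k : ℕ) (f : Test n) : distW c r k (toDist f) = testW c r k f := by
  simp only [distW, testW, wnorm, ← toDist_act, weightedNorm_toDist]

/-- The product of elements of module regularity spaces. -/
theorem exists_isProduct {k : ℕ} (hk : 4 ≤ k) (hnk : n + 4 < 2 * k) {c₁ c₂ : ℝ} (hc₁ : c₁ ≠ 0)
    (hc₂ : c₂ ≠ 0) (r₁ r₂ : ℝ) : ∃ C : ℝ≥0, ∀ u₁ u₂ : 𝓢'(Spacetime n, ℂ),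
      distW c₁ r₁ k u₁ ≠ ⊤ → distW c₂ r₂ k u₂ ≠ ⊤ → ∃ w, IsProduct u₁ u₂ w ∧
        distW (c₁ + c₂) (r₁ + r₂ + ((n : ℝ) + 1) / 2) k w ≤
          C * (distW c₁ r₁ k u₁ * distW c₂ r₂ k u₂) := by
  obtain ⟨C, hC⟩ := testW_mul_le hk hnk hc₁ hc₂ r₁ r₂
  refine ⟨C, fun u₁ u₂ hu₁ hu₂ => ?_⟩
  set D₁ := distW c₁ r₁ k u₁
  set D₂ := distW c₂ r₂ k u₂
  let e : ℕ → ℝ≥0∞ := fun m => ((m : ℝ≥0∞) + 1)⁻¹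
  have he0 : ∀ m, 0 < e m := fun m => ENNReal.inv_pos.2 (by finiteness)
  have he1 : ∀ m, e m ≤ 1 := fun m => ENNReal.inv_le_one.2 le_add_self
  have he : Tendsto e atTop (𝓝 0) := by
    have := (tendsto_add_atTop_iff_nat 1).2 ENNReal.tendsto_inv_nat_nhds_zero
    simpa [e] using this
  choose f₁ hf₁ using fun m => exists_distW_sub_le hu₁ (he0 m)
  choose f₂ hf₂ using fun m => exists_distW_sub_le hu₂ (he0 m)
  have hsize : ∀ (c r : ℝ) (u : 𝓢'(Spacetime n, ℂ)) (f : Test n) (ε : ℝ≥0∞),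
      distW c r k (u - toDist f) ≤ ε → testW c r k f ≤ distW c r k u + ε := by
    intro c r u f ε h
    have e1 : toDist f = u + (-1 : ℂ) • (u - toDist f) := by
      rw [smul_sub, neg_smul, neg_smul, one_smul, one_smul]
      abel
    rw [← distW_toDist, e1]
    refine ((isGauge_distW c r k).add_le _ _).trans (add_le_add le_rfl ?_)
    refine ((isGauge_distW c r k).smul_le _ _).trans ?_
    simpa using h
  have hdiff : ∀ (c r : ℝ) (u : 𝓢'(Spacetime n, ℂ)) (f f' : Test n) (ε ε' : ℝ≥0∞),
      distW c r k (u - toDist f) ≤ ε → distW c r k (u - toDist f') ≤ ε' →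
      testW c r k (f - f') ≤ ε + ε' := by
    intro c r u f f' ε ε' h h'
    have e1 : toDist (f - f') = (u - toDist f') + (-1 : ℂ) • (u - toDist f) := by
      rw [smul_sub, neg_smul, neg_smul, one_smul, one_smul, map_sub]
      abel
    rw [← distW_toDist, e1, add_comm ε]
    refine ((isGauge_distW c r k).add_le _ _).trans (add_le_add h' ?_)
    refine ((isGauge_distW c r k).smul_le _ _).trans ?_
    simpa using h
  let r := r₁ + r₂ + ((n : ℝ) + 1) / 2
  -- the approximations have norms at most `D₁ + 1` and `D₂ + 1`
  let K : ℝ≥0∞ := C * (D₁ + D₂ + 2)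
  have hK : K ≠ ⊤ := by finiteness
  have hdist : ∀ m l, distW (c₁ + c₂) r k (toDist ((f₁ m).mul (f₂ m)) -
      toDist ((f₁ l).mul (f₂ l))) ≤ K * (e m + e l) := by
    intro m l
    have e1 : (f₁ m).mul (f₂ m) - (f₁ l).mul (f₂ l) =
        (f₁ m - f₁ l).mul (f₂ m) + (f₁ l).mul (f₂ m - f₂ l) := Test.ext fun Z => by
      simp only [Test.sub_apply, Test.add_apply, Test.mul_apply]
      ring
    rw [← map_sub, e1, map_add]
    refine ((isGauge_distW _ _ k).add_le _ _).trans ?_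
    rw [distW_toDist, distW_toDist]
    calc _ ≤ C * ((e m + e l) * (D₂ + 1)) + C * ((D₁ + 1) * (e m + e l)) := by
          refine add_le_add ((hC _ _).trans ?_) ((hC _ _).trans ?_)
          · exact mul_le_mul' le_rfl (mul_le_mul' (hdiff _ _ _ _ _ _ _ (hf₁ m) (hf₁ l))
              ((hsize _ _ _ _ _ (hf₂ m)).trans (add_le_add le_rfl (he1 m))))
          · exact mul_le_mul' le_rfl (mul_le_mul' ((hsize _ _ _ _ _ (hf₁ l)).trans
              (add_le_add le_rfl (he1 l))) (hdiff _ _ _ _ _ _ _ (hf₂ m) (hf₂ l)))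
      _ = K * (e m + e l) := by simp only [K]; ring
  have hprod : ∀ m, testW (c₁ + c₂) r k ((f₁ m).mul (f₂ m)) ≤ C * ((D₁ + e m) * (D₂ + e m)) :=
    fun m => (hC _ _).trans (mul_le_mul' le_rfl
      (mul_le_mul' (hsize _ _ _ _ _ (hf₁ m)) (hsize _ _ _ _ _ (hf₂ m))))
  have hfin : ∀ m, distW (c₁ + c₂) r k (toDist ((f₁ m).mul (f₂ m))) ≠ ⊤ := fun m => by
    have := ne_top_of_le_ne_top ENNReal.one_ne_top (he1 m)
    rw [distW_toDist]
    exact ne_top_of_le_ne_top (by finiteness) (hprod m)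
  obtain ⟨w, hw⟩ := exists_tendsto_distW hfin fun ε hε => by
    have h1 : Tendsto (fun m => K * e m) atTop (𝓝 0) := by
      simpa using ENNReal.Tendsto.const_mul he (.inr hK)
    obtain ⟨N, hN⟩ := eventually_atTop.1 (h1.eventually_lt_const (ENNReal.half_pos hε.ne'))
    refine ⟨N, fun m hm l hl => (hdist m l).trans_lt ?_⟩
    rw [mul_add, ← ENNReal.add_halves ε]
    exact ENNReal.add_lt_add (hN m hm) (hN l hl)
  have hwle : distW (c₁ + c₂) r k w ≤ C * (D₁ * D₂) := by
    have h1 : Tendsto (fun m => distW (c₁ + c₂) r k (w - toDist ((f₁ m).mul (f₂ m))) +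
        C * ((D₁ + e m) * (D₂ + e m))) atTop (𝓝 (0 + C * ((D₁ + 0) * (D₂ + 0)))) := by
      refine hw.add (ENNReal.Tendsto.const_mul (ENNReal.Tendsto.mul (tendsto_const_nhds.add he)
        (.inr ?_) (tendsto_const_nhds.add he) (.inr ?_)) (.inr ENNReal.coe_ne_top)) <;> finiteness
    rw [add_zero, add_zero, zero_add] at h1
    refine ge_of_tendsto' h1 fun m => ?_
    have e1 : w = (w - toDist ((f₁ m).mul (f₂ m))) + toDist ((f₁ m).mul (f₂ m)) := by abel
    conv_lhs => rw [e1]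
    refine ((isGauge_distW _ _ k).add_le _ _).trans (add_le_add le_rfl ?_)
    rw [distW_toDist]
    exact hprod m
  have hmem : ∀ {c r : ℝ} {u : 𝓢'(Spacetime n, ℂ)}, distW c r k u ≠ ⊤ → MemWeightedL2 r u :=
    fun h => memWeightedL2_of_distW h (w := []) (Nat.zero_le k)
  have hle : ∀ (c r : ℝ) (u : 𝓢'(Spacetime n, ℂ)), weightedNorm r u ≤ distW c r k u :=
    fun c r u => le_wnorm one_le_regOrder _ _ (w := []) (Nat.zero_le k) u
  have hsq : ∀ {c r : ℝ} {v : ℕ → 𝓢'(Spacetime n, ℂ)} {b : ℕ → ℝ≥0∞},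
      Tendsto b atTop (𝓝 0) → (∀ m, distW c r k (v m) ≤ b m) →
      Tendsto (fun m => weightedNorm r (v m)) atTop (𝓝 0) := fun hb hv =>
    tendsto_of_tendsto_of_tendsto_of_le_of_le tendsto_const_nhds hb (fun _ => zero_le)
      fun m => (hle _ _ _).trans (hv m)
  refine ⟨w, isProduct_of_tendsto (hmem hu₁) (hmem hu₂)
    (hmem (ne_top_of_le_ne_top (by finiteness) hwle)) (hsq he hf₁) (hsq he hf₂)
    (hsq hw fun _ => le_rfl), hwle⟩

end ModuleRegularity

end

noncomputable section

namespace ModuleRegularity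

open scoped LineDeriv

variable {n : ℕ}

/-! ### Graph norms and module regularity norms -/

theorem weightedNorm_genMonomial_le {c r : ℝ} {k : ℕ} {α : Gen n → ℕ} (hα : α ∈ multiIndices n k)
    (u : 𝓢'(Spacetime n, ℂ)) : weightedNorm r (genMonomial c α u) ≤ distW c r k u := by
  obtain ⟨w, hw, h⟩ := genMonomial_eq_act c α
  rw [h]
  exact le_wnorm one_le_regOrder _ _ (hw.trans_le (mem_multiIndices.1 hα)) u

theorem modRegNorm_le (n : ℕ) (c r : ℝ) (k : ℕ) : ∃ C : ℝ≥0, ∀ u : 𝓢'(Spacetime n, ℂ),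
    modRegNorm c r k u ≤ C * distW c r k u := by
  refine ⟨((multiIndices n k).card : ℝ≥0) ^ (1 / 2 : ℝ), fun u => ?_⟩
  calc modRegNorm c r k u ≤ ((multiIndices n k).card * distW c r k u ^ 2) ^ (1 / 2 : ℝ) := by
        refine ENNReal.rpow_le_rpow ?_ (by norm_num)
        rw [← nsmul_eq_mul]
        exact Finset.sum_le_card_nsmul _ _ _ fun α hα =>
          pow_le_pow_left' (weightedNorm_genMonomial_le hα u) 2
    _ = _ := by
        rw [ENNReal.mul_rpow_of_nonneg _ _ (by norm_num), ← ENNReal.rpow_natCast,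
          ← ENNReal.rpow_mul, ENNReal.coe_rpow_of_nonneg _ (by norm_num)]
        norm_num

theorem weightedNorm_genMonomial_le_modRegNorm {c r : ℝ} {k : ℕ} {α : Gen n → ℕ}
    (hα : α ∈ multiIndices n k) (u : 𝓢'(Spacetime n, ℂ)) :
    weightedNorm r (genMonomial c α u) ≤ modRegNorm c r k u := by
  have h1 : weightedNorm r (genMonomial c α u) =
      (weightedNorm r (genMonomial c α u) ^ 2) ^ (1 / 2 : ℝ) := by
    rw [← ENNReal.rpow_natCast, ← ENNReal.rpow_mul]
    norm_num
  rw [h1]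
  exact ENNReal.rpow_le_rpow (Finset.single_le_sum
    (f := fun α => weightedNorm r (genMonomial c α u) ^ 2) (fun _ _ => zero_le) hα) (by norm_num)

/-- By reordering, the norms of all words are controlled by those of the ordered monomials. -/
theorem distW_le (n : ℕ) (c r : ℝ) (k : ℕ) : ∃ C : ℝ≥0, ∀ u : 𝓢'(Spacetime n, ℂ),
    distW c r k u ≤ C * modRegNorm c r k u := by
  have h : ∀ w : List (Gen n), ∃ C : ℝ≥0, wt Gen.regOrder w ≤ k → ∀ u,
      weightedNorm r (act (fun g => Gen.op c g) w u) ≤ C * modRegNorm c r k u := by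
    intro w
    by_cases hw : wt Gen.regOrder w ≤ k
    · have key : ∀ T ∈ Submodule.span ℂ (genMonomial c '' (multiIndices n k : Set (Gen n → ℕ))),
          ∃ C : ℝ≥0, ∀ u, weightedNorm r (T u) ≤ C * modRegNorm c r k u := by
        intro T hT
        induction hT using Submodule.span_induction with
        | mem T hT =>
          obtain ⟨α, hα, rfl⟩ := hT
          exact ⟨1, fun u => by simpa using weightedNorm_genMonomial_le_modRegNorm hα u⟩
        | zero => exact ⟨0, fun u => by simp [(isGauge_weightedNorm r).zero]⟩
        | add T U _ _ hT hU =>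
          obtain ⟨C, hC⟩ := hT
          obtain ⟨D, hD⟩ := hU
          refine ⟨C + D, fun u => ((isGauge_weightedNorm r).add_le (T u) (U u)).trans ?_⟩
          rw [ENNReal.coe_add, add_mul]
          exact add_le_add (hC u) (hD u)
        | smul a T _ hT =>
          obtain ⟨C, hC⟩ := hT
          refine ⟨‖a‖₊ * C, fun u => ((isGauge_weightedNorm r).smul_le a (T u)).trans ?_⟩
          rw [ENNReal.coe_mul, mul_assoc]
          exact mul_le_mul' le_rfl (hC u)
      obtain ⟨C, hC⟩ := key _ (word_mem_span_genMonomial c hw)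
      exact ⟨C, fun _ u => by rw [act_op_eq_prod]; exact hC u⟩
    · exact ⟨0, fun h => absurd h hw⟩
  choose C hC using h
  refine ⟨∑ w ∈ wordsLE Gen.regOrder k, C w, fun u => ?_⟩
  rw [distW, wnorm, ENNReal.ofNNReal_finsetSum, Finset.sum_mul]
  exact Finset.sum_le_sum fun w hw => hC w (wt_le_of_mem_wordsLE hw) u

theorem mem_modRegSpace_iff {c r : ℝ} {k : ℕ} {u : 𝓢'(Spacetime n, ℂ)} :
    u ∈ modRegSpace n c r k ↔ distW c r k u ≠ ⊤ := by
  refine ⟨fun h => ?_, fun h α hα =>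
    memWeightedL2_iff.2 (ne_top_of_le_ne_top h (weightedNorm_genMonomial_le hα u))⟩
  obtain ⟨C, hC⟩ := distW_le n c r k
  refine ne_top_of_le_ne_top (ENNReal.mul_ne_top ENNReal.coe_ne_top ?_) (hC u)
  exact ENNReal.rpow_ne_top_of_nonneg (by norm_num)
    (ENNReal.sum_ne_top.2 fun α hα => ENNReal.pow_ne_top (memWeightedL2_iff.1 (h α hα)))

/-! ### Complex conjugation -/

theorem conjSchwartz_apply (φ : 𝓢(Spacetime n, ℂ)) (Z : Spacetime n) :
    conjSchwartz φ Z = conj (φ Z) := rfl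

theorem conjDistribution_apply (u : 𝓢'(Spacetime n, ℂ)) (φ : 𝓢(Spacetime n, ℂ)) :
    conjDistribution u φ = conj (u (conjSchwartz φ)) := rfl

theorem conjDistribution_conjDistribution (u : 𝓢'(Spacetime n, ℂ)) :
    conjDistribution (conjDistribution u) = u := by
  ext φ
  have h : conjSchwartz (conjSchwartz φ) = φ := by ext Z; simp [conjSchwartz_apply]
  rw [conjDistribution_apply, conjDistribution_apply, Complex.conj_conj, h]

theorem conjDistribution_smul (a : ℂ) (u : 𝓢'(Spacetime n, ℂ)) :
    conjDistribution (a • u) = conj a • conjDistribution u := by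
  ext φ
  exact map_mul (starRingEnd ℂ) _ _

/-- Complex conjugation of distributions, as an additive map. -/
def conjHom : 𝓢'(Spacetime n, ℂ) →+ 𝓢'(Spacetime n, ℂ) where
  toFun := conjDistribution
  map_zero' := by ext φ; exact map_zero (starRingEnd ℂ)
  map_add' u v := by ext φ; exact map_add (starRingEnd ℂ) _ _

theorem conjHom_apply (u : 𝓢'(Spacetime n, ℂ)) : conjHom u = conjDistribution u := rfl

theorem smulLeftCLM_conjDistribution {a : Spacetime n → ℂ} (ha : a.HasTemperateGrowth)
    (h : ∀ Z, conj (a Z) = a Z) (u : 𝓢'(Spacetime n, ℂ)) :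
    TemperedDistribution.smulLeftCLM ℂ a (conjDistribution u) =
      conjDistribution (TemperedDistribution.smulLeftCLM ℂ a u) := by
  ext φ
  rw [TemperedDistribution.smulLeftCLM_apply_apply, conjDistribution_apply, conjDistribution_apply,
    TemperedDistribution.smulLeftCLM_apply_apply]
  congr 2
  ext Z
  simp [conjSchwartz_apply, SchwartzMap.smulLeftCLM_apply_apply ha, h]

theorem posD_conjDistribution (a : Fin (n + 1)) (u : 𝓢'(Spacetime n, ℂ)) :
    posD a (conjDistribution u) = conjDistribution (posD a u) :=
  smulLeftCLM_conjDistribution (coord_hasTemperateGrowth a) (fun _ => Complex.conj_ofReal _) u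

theorem momD_conjDistribution (a : Fin (n + 1)) (u : 𝓢'(Spacetime n, ℂ)) :
    momD a (conjDistribution u) = -conjDistribution (momD a u) := by
  ext φ
  have h1 : conjSchwartz (∂_{unitVec a} φ) = ∂_{unitVec a} (conjSchwartz φ) := by
    ext Z
    have h2 : (conjSchwartz φ : Spacetime n → ℂ) = (Complex.conjCLE : ℂ →L[ℝ] ℂ) ∘ φ := rfl
    rw [conjSchwartz_apply, SchwartzMap.lineDerivOp_apply_eq_fderiv,
      SchwartzMap.lineDerivOp_apply_eq_fderiv, h2,
      ((Complex.conjCLE : ℂ →L[ℝ] ℂ).hasFDerivAt.comp Z φ.differentiableAt.hasFDerivAt).fderiv]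
    rfl
  have h3 : momD a (conjDistribution u) φ =
      -Complex.I * conj (u (conjSchwartz (-∂_{unitVec a} φ))) := rfl
  have h4 : (-conjDistribution (momD a u)) φ =
      -conj (-Complex.I * u (-∂_{unitVec a} (conjSchwartz φ))) := rfl
  rw [h3, h4, map_neg conjSchwartz, h1, map_mul, map_neg, map_neg,
    map_neg (starRingEnd ℂ) Complex.I, Complex.conj_I]
  ring

/-- Conjugation reverses the sign of the generators and of their parameter. -/
theorem op_conjDistribution (c : ℝ) (g : Gen n) (u : 𝓢'(Spacetime n, ℂ)) :
    g.op (-c) (conjDistribution u) = -conjDistribution (g.op c u) := by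
  have hp : ∀ a v, momD (n := n) a (conjHom v) = -conjHom (momD a v) := momD_conjDistribution
  have hq : ∀ a v, posD (n := n) a (conjHom v) = conjHom (posD a v) := posD_conjDistribution
  have hs : ∀ (a : ℂ) (v : 𝓢'(Spacetime n, ℂ)), conjHom (a • v) = conj a • conjHom v :=
    conjDistribution_smul
  rw [op_eq_weylGen, op_eq_weylGen, ← conjHom_apply, ← conjHom_apply]
  cases g with
  | dz j => exact hp _ u
  | dt => exact hp _ u
  | rot i j =>
    change posD _ (momD _ (conjHom u)) - posD _ (momD _ (conjHom u)) =
      -conjHom (posD _ (momD _ u) - posD _ (momD _ u))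
    rw [hp, hp, map_neg, map_neg, hq, hq, map_sub]
    abel
  | gal j =>
    change posD _ (momD _ (conjHom u)) - (((-c : ℝ) : ℂ) / 2) • posD _ (conjHom u) =
      -conjHom (posD _ (momD _ u) - ((c : ℂ) / 2) • posD _ u)
    have hn : ∀ (a : ℂ) (v : 𝓢'(Spacetime n, ℂ)), -a • v = -(a • v) := fun a v => neg_smul a v
    rw [hp, map_neg, hq, hq, map_sub, hs, Complex.ofReal_neg, neg_div, hn, map_div₀,
      Complex.conj_ofReal, Complex.conj_ofNat]
    abel
  | dil =>
    simp only [weylGen, add_apply, smul_apply, sum_apply]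
    change (2 : ℂ) • posD _ (momD _ (conjHom u)) + ∑ j, posD _ (momD _ (conjHom u)) =
      -conjHom ((2 : ℂ) • posD _ (momD _ u) + ∑ j, posD _ (momD _ u))
    simp only [hp, hq, hs, map_neg, map_add, map_sum, smul_neg, Finset.sum_neg_distrib,
      Complex.conj_ofNat]
    abel

theorem act_conjDistribution (c : ℝ) (w : List (Gen n)) (u : 𝓢'(Spacetime n, ℂ)) :
    act (fun g => Gen.op (-c) g) w (conjDistribution u) =
      (-1 : ℂ) ^ w.length • conjDistribution (act (fun g => Gen.op c g) w u) := by
  induction w with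
  | nil => simp
  | cons g w ih =>
    rw [act_cons, act_cons, ih, map_smul, op_conjDistribution, List.length_cons, pow_succ, mul_smul,
      neg_one_smul]

theorem MemWeightedL2.conj {r : ℝ} {u : 𝓢'(Spacetime n, ℂ)} (hu : MemWeightedL2 r u) :
    MemWeightedL2 r (conjDistribution u) := by
  obtain ⟨g, hg⟩ := hu
  have hm : MemLp (fun Z => conj (g Z)) 2 (volume : Measure (Spacetime n)) := (Lp.memLp g).star
  refine ⟨hm.toLp, ?_⟩
  rw [mulWeight, smulLeftCLM_conjDistribution (weight_hasTemperateGrowth n r)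
    fun _ => Complex.conj_ofReal _]
  change conjDistribution (mulWeight n r u) = _
  ext φ
  rw [hg, conjDistribution_apply, Lp.toTemperedDistribution_apply, Lp.toTemperedDistribution_apply,
    ← integral_conj]
  refine integral_congr_ae ?_
  filter_upwards [hm.coeFn_toLp] with Z h
  rw [h]
  simp [conjSchwartz_apply]

theorem conjDistribution_mem_modRegSpace {c r : ℝ} {k : ℕ} {u : 𝓢'(Spacetime n, ℂ)}
    (hu : u ∈ modRegSpace n c r k) : conjDistribution u ∈ modRegSpace n (-c) r k := by
  rw [mem_modRegSpace_iff] at hu ⊢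
  refine ENNReal.sum_ne_top.2 fun w hw => ?_
  rw [act_conjDistribution]
  refine ne_top_of_le_ne_top (ENNReal.mul_ne_top enorm_ne_top ?_)
    ((isGauge_weightedNorm r).smul_le _ _)
  exact memWeightedL2_iff.1 (memWeightedL2_of_distW hu (wt_le_of_mem_wordsLE hw)).conj

end ModuleRegularity

end

theorem mainTheorem6 (n k : ℕ) (hn : 1 ≤ n) (hk : max ((n : ℝ) / 2 + 2) 3 < (k : ℝ))
    (r r₁ r₂ c c₁ c₂ : ℝ) (hc : c ≠ 0) (hc₁ : c₁ ≠ 0) (hc₂ : c₂ ≠ 0) :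
    (∃ C : ℝ≥0, ∀ u₁ ∈ ModuleRegularity.modRegSpace n c₁ r₁ k,
      ∀ u₂ ∈ ModuleRegularity.modRegSpace n c₂ r₂ k,
        ∃ w ∈ ModuleRegularity.modRegSpace n (c₁ + c₂) (r₁ + r₂ + ((n : ℝ) + 1) / 2) k,
          ModuleRegularity.IsProduct u₁ u₂ w ∧
          ModuleRegularity.modRegNorm (c₁ + c₂) (r₁ + r₂ + ((n : ℝ) + 1) / 2) k w ≤
            C * ModuleRegularity.modRegNorm c₁ r₁ k u₁ *
              ModuleRegularity.modRegNorm c₂ r₂ k u₂) ∧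
    (∀ u : 𝓢'(ModuleRegularity.Spacetime n, ℂ),
      u ∈ ModuleRegularity.modRegSpace n c r k ↔
        ModuleRegularity.conjDistribution u ∈ ModuleRegularity.modRegSpace n (-c) r k) := by
  open ModuleRegularity in
  constructor
  · have hk4 : 4 ≤ k := by
      have : (3 : ℝ) < k := (le_max_right _ _).trans_lt hk
      exact_mod_cast this
    have hnk : n + 4 < 2 * k := by
      have : (n : ℝ) / 2 + 2 < k := (le_max_left _ _).trans_lt hk
      have h2 : (n : ℝ) + 4 < 2 * k := by linarith
      exact_mod_cast h2
    obtain ⟨C, hC⟩ := exists_isProduct hk4 hnk hc₁ hc₂ r₁ r₂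
    obtain ⟨C₁, hC₁⟩ := distW_le n c₁ r₁ k
    obtain ⟨C₂, hC₂⟩ := distW_le n c₂ r₂ k
    obtain ⟨C₃, hC₃⟩ := modRegNorm_le n (c₁ + c₂) (r₁ + r₂ + ((n : ℝ) + 1) / 2) k
    refine ⟨C₃ * C * C₁ * C₂, fun u₁ hu₁ u₂ hu₂ => ?_⟩
    rw [mem_modRegSpace_iff] at hu₁ hu₂
    obtain ⟨w, hw, hle⟩ := hC u₁ u₂ hu₁ hu₂
    refine ⟨w, mem_modRegSpace_iff.2 (ne_top_of_le_ne_top (by finiteness) hle), hw, ?_⟩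
    calc _ ≤ C₃ * (C * (C₁ * modRegNorm c₁ r₁ k u₁ * (C₂ * modRegNorm c₂ r₂ k u₂))) :=
          (hC₃ w).trans (mul_le_mul' le_rfl (hle.trans (mul_le_mul' le_rfl
            (mul_le_mul' (hC₁ u₁) (hC₂ u₂)))))
      _ = _ := by push_cast; ring
  · refine fun u => ⟨conjDistribution_mem_modRegSpace, fun h => ?_⟩
    have := conjDistribution_mem_modRegSpace h
    rwa [neg_neg, conjDistribution_conjDistribution] at this
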